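/- Let $n\ge 2$ be an integer and $\lambda\in\mathbb{R}$. Consider the following system (S) for positive functions $f_1,\dots,f_5$ (the diagonal part of the Einstein equations, with Einstein constant $\lambda$, for the metrics $dt^2+\sum_{i=1}^5 f_i(t)^2(\cdot,\cdot)|_{\mathfrak m_i\times\mathfrak m_i}$ invariant under $\mathrm{SU}(2)\times\mathrm{SU}(n+1)$ on $\mathbb{C}P^{2n+1}$, "Model B"): \begin{align*} &\tfrac{f_1''}{f_1}-\tfrac{2}{n+3}\tfrac{1}{f_1^2}-\tfrac{1}{n+3}\Bigl(\tfrac{f_1^2}{f_2^2f_3^2}-\tfrac{f_2^2}{f_1^2f_3^2}-\tfrac{f_3^2}{f_1^2f_2^2}\Bigr)-\tfrac{n-1}{4(n+1)(n+3)}\Bigl((n-1)\tfrac{f_1^2}{f_3^4}+\tfrac{f_1^2}{f_4^4}+\tfrac{f_1^2}{f_5^4}\Bigr)\\ &\quad+2\tfrac{f_1'f_2'}{f_1f_2}+2\tfrac{f_1'f_3'}{f_1f_3}+2(n-1)\tfrac{f_1'f_4'}{f_1f_4}+2(n-1)\tfrac{f_1'f_5'}{f_1f_5}=-\lambda,\\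 &\tfrac{f_2''}{f_2}-\tfrac{1}{2f_2^2}-\tfrac{1}{2(n+3)}\Bigl(\tfrac{f_2^2}{f_1^2f_3^2}-\tfrac{f_1^2}{f_2^2f_3^2}-\tfrac{f_3^2}{f_1^2f_2^2}\Bigr)-\tfrac{n-1}{4(n+3)}\Bigl(\tfrac{f_2^2}{f_4^2f_5^2}-\tfrac{f_4^2}{f_2^2f_5^2}-\tfrac{f_5^2}{f_2^2f_4^2}\Bigr)\\ &\quad+\tfrac{f_2'^2}{f_2^2}+\tfrac{f_1'f_2'}{f_1f_2}+2\tfrac{f_2'f_3'}{f_2f_3}+2(n-1)\tfrac{f_2'f_4'}{f_2f_4}+2(n-1)\tfrac{f_2'f_5'}{f_2f_5}=-\lambda,\\ &\tfrac{f_3''}{f_3}-\tfrac{1}{2f_3^2}-\tfrac{1}{2(n+3)}\Bigl(\tfrac{f_3^2}{f_1^2f_2^2}-\tfrac{f_1^2}{f_2^2f_3^2}-\tfrac{f_2^2}{f_1^2f_3^2}\Bigr)+\tfrac{n-1}{2(n+1)(n+3)}\Bigl(\tfrac{n-1}{2}\tfrac{f_1^2}{f_3^4}-\tfrac{f_3^2}{f_4^2f_5^2}+\tfrac{f_4^2}{f_3^2f_5^2}+\tfrac{f_5^2}{f_3^2f_4^2}\Bigr)\\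 &\quad+\tfrac{f_3'^2}{f_3^2}+\tfrac{f_1'f_3'}{f_1f_3}+2\tfrac{f_2'f_3'}{f_2f_3}+2(n-1)\tfrac{f_3'f_4'}{f_3f_4}+2(n-1)\tfrac{f_3'f_5'}{f_3f_5}=-\lambda,\\ &\tfrac{f_4''}{f_4}-\tfrac{1}{2f_4^2}-\tfrac{1}{4(n+3)}\Bigl(\tfrac{f_4^2}{f_2^2f_5^2}-\tfrac{f_2^2}{f_4^2f_5^2}-\tfrac{f_5^2}{f_2^2f_4^2}\Bigr)+\tfrac{1}{2(n+1)(n+3)}\Bigl(\tfrac12\tfrac{f_1^2}{f_4^4}-\tfrac{f_4^2}{f_3^2f_5^2}+\tfrac{f_3^2}{f_4^2f_5^2}+\tfrac{f_5^2}{f_3^2f_4^2}\Bigr)\\ &\quad+(2n-3)\tfrac{f_4'^2}{f_4^2}+\tfrac{f_1'f_4'}{f_1f_4}+2\tfrac{f_2'f_4'}{f_2f_4}+2\tfrac{f_3'f_4'}{f_3f_4}+2(n-1)\tfrac{f_4'f_5'}{f_4f_5}=-\lambda,\\ &\tfrac{f_5''}{f_5}-\tfrac{1}{2f_5^2}-\tfrac{1}{4(n+3)}\Bigl(\tfrac{f_5^2}{f_2^2f_4^2}-\tfrac{f_2^2}{f_4^2f_5^2}-\tfrac{f_4^2}{f_2^2f_5^2}\Bigr)+\tfrac{1}{2(n+1)(n+3)}\Bigl(\tfrac12\tfrac{f_1^2}{f_5^4}-\tfrac{f_5^2}{f_3^2f_4^2}+\tfrac{f_3^2}{f_4^2f_5^2}+\tfrac{f_4^2}{f_3^2f_5^2}\Bigr)\\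 &\quad+(2n-3)\tfrac{f_5'^2}{f_5^2}+\tfrac{f_1'f_5'}{f_1f_5}+2\tfrac{f_2'f_5'}{f_2f_5}+2\tfrac{f_3'f_5'}{f_3f_5}+2(n-1)\tfrac{f_4'f_5'}{f_4f_5}=-\lambda. \end{align*} A solution on $[0,\epsilon)$ (resp. $(1-\epsilon,1]$) is a tuple of functions that are real analytic on this interval, including the closed end point, positive in its interior, and satisfy (S) there. Two solutions on an interval are distinct if they differ as functions on it. *Initial conditions* (for $\zeta_0>0$): $f(0)=(0,\zeta_0,\zeta_0,0,\zeta_0)$, $f'(0)=\bigl(\sqrt{\tfrac{n+3}{2(n+1)}},0,0,\tfrac{1}{2\sqrt{n+1}},0\bigr)$, $f_1''(0)=f_4''(0)=0$. *Final conditions* (for $\zeta_1,\xi_1>0$): $f(1)=(\zeta_1,0,\zeta_1,\xi_1,\xi_1)$, $f'(1)=\bigl(0,-\tfrac{1}{\sqrt{n+3}},0,0,0\bigr)$, $f_2''(1)=0$. *The operator $\mathcal L_0$.* At $t=0$ put $x_i=f_i^2/t^2$, $y_i=f_if_i'/t^2-f_i^2/t^3$ for $i=1,4$ and $x_i=f_i^2$,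 $y_i=f_if_i'$ for $i=2,3,5$. At $t=1$ put $g_i(t)=f_i(1-t)$, $x_2=g_2^2/t^2$, $y_2=g_2g_2'/t^2-g_2^2/t^3$ and $x_i=g_i^2$, $y_i=g_ig_i'$ for $i\ne2$. In both cases (S) takes the form $x'=2y$, $y'=\frac1{t^2}A(x)+\frac1tB(x,y)+C(t,x,y)$. With $T(x,y)=\frac{y_1}{x_1}+2\frac{y_2}{x_2}+2\frac{y_3}{x_3}+2(n-1)\frac{y_4}{x_4}+2(n-1)\frac{y_5}{x_5}$, one has at $t=0$ \begin{align*} A_1&=-2(n-1)x_1+\tfrac2{n+3}-\tfrac1{n+3}\bigl(\tfrac{x_2}{x_3}+\tfrac{x_3}{x_2}\bigr)+\tfrac{n-1}{4(n+1)(n+3)}\tfrac{x_1^2}{x_4^2},\\ A_2&=\tfrac1{2(n+3)}\bigl(\tfrac{x_2^2}{x_1x_3}-\tfrac{x_3}{x_1}\bigr)+\tfrac{n-1}{4(n+3)}\bigl(\tfrac{x_2^2}{x_4x_5}-\tfrac{x_5}{x_4}\bigr),\\ A_3&=\tfrac1{2(n+3)}\bigl(\tfrac{x_3^2}{x_1x_2}-\tfrac{x_2}{x_1}\bigr)+\tfrac{n-1}{2(n+1)(n+3)}\bigl(\tfrac{x_3^2}{x_4x_5}-\tfrac{x_5}{x_4}\bigr),\\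 A_4&=-2(n-1)x_4+\tfrac12-\tfrac1{4(n+3)}\bigl(\tfrac{x_2}{x_5}+\tfrac{x_5}{x_2}\bigr)-\tfrac1{2(n+1)(n+3)}\bigl(\tfrac{x_1}{2x_4}+\tfrac{x_3}{x_5}+\tfrac{x_5}{x_3}\bigr),\\ A_5&=\tfrac1{4(n+3)}\bigl(\tfrac{x_5^2}{x_2x_4}-\tfrac{x_2}{x_4}\bigr)+\tfrac1{2(n+1)(n+3)}\bigl(\tfrac{x_5^2}{x_3x_4}-\tfrac{x_3}{x_4}\bigr), \end{align*} $B_i=-(2n-1)y_i-x_iT(x,y)$ for $i=1,4$, $B_i=-(2n-1)y_i$ for $i=2,3,5$, and at $t=1$ \begin{align*} A_1&=\tfrac1{n+3}\bigl(\tfrac{x_1^2}{x_2x_3}-\tfrac{x_3}{x_2}\bigr),\quad A_2=-x_2+\tfrac12-\tfrac1{2(n+3)}\bigl(\tfrac{x_1}{x_3}+\tfrac{x_3}{x_1}\bigr)-\tfrac{n-1}{4(n+3)}\bigl(\tfrac{x_4}{x_5}+\tfrac{x_5}{x_4}\bigr),\\ A_3&=\tfrac1{2(n+3)}\bigl(\tfrac{x_3^2}{x_1x_2}-\tfrac{x_1}{x_2}\bigr),\quad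 A_4=\tfrac1{4(n+3)}\bigl(\tfrac{x_4^2}{x_2x_5}-\tfrac{x_5}{x_2}\bigr),\quad A_5=\tfrac1{4(n+3)}\bigl(\tfrac{x_5^2}{x_2x_4}-\tfrac{x_4}{x_2}\bigr), \end{align*} $B_2=-2y_2-x_2T(x,y)$, $B_i=-2y_i$ for $i\neq2$. The boundary conditions become $y(0)=0$ and $x(0)=x^0$, where $x^0=\bigl(\tfrac{n+3}{2(n+1)},\zeta_0^2,\zeta_0^2,\tfrac1{4(n+1)},\zeta_0^2\bigr)$ in the initial case and $x^0=\bigl(\zeta_1^2,\tfrac1{n+3},\zeta_1^2,\xi_1^2,\xi_1^2\bigr)$ in the final case. Put $\mathcal L_0=\mathrm{Id}-(dA)_{x^0}-(\partial_yB)_{(x^0,0)}$, an endomorphism of $\mathbb{R}^5$, and let $x^2$ denote the second-order coefficient in $x(t)=x^0+\frac{t^2}{2}x^2+o(t^2)$ as $t\downarrow0$. Then: a) For every $\zeta_0>0$ there is $\epsilon_0>0$ such that (S) with the initial conditions has infinitely many solutions on $[0,\epsilon_0)$. b) For all $\zeta_1,\xi_1>0$ there is $\epsilon_1>0$ such that (S)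 with the final conditions has infinitely many solutions on $(1-\epsilon_1,1]$. In both cases the local solutions are parametrized by $\ker\mathcal L_0$, which is one-dimensional: there is $p\in\mathbb{R}^5$ such that for every $v\in\ker\mathcal L_0$ there is a solution, on some interval $[0,\epsilon)$ (resp. $(1-\epsilon,1]$) with $\epsilon>0$, with $x^2=p+v$; every solution on such an interval has $x^2=p+v$ for some $v\in\ker\mathcal L_0$; and two solutions on the same interval with the same $x^2$ coincide. -/

import Mathlib

open Set Filter Topology

noncomputable section

namespace ModelB

/-- The left-hand side of the first equation, as a function of the values `a i = fᵢ`,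
the first derivatives `b i = fᵢ'` and the second derivative `c = f₁''`. -/
def lhs1 (n a1 a2 a3 a4 a5 b1 b2 b3 b4 b5 c : ℝ) : ℝ :=
  c / a1 - 2 / (n + 3) * (1 / a1 ^ 2)
    - 1 / (n + 3) * (a1 ^ 2 / (a2 ^ 2 * a3 ^ 2) - a2 ^ 2 / (a1 ^ 2 * a3 ^ 2)
        - a3 ^ 2 / (a1 ^ 2 * a2 ^ 2))
    - (n - 1) / (4 * (n + 1) * (n + 3))
        * ((n - 1) * (a1 ^ 2 / a3 ^ 4) + a1 ^ 2 / a4 ^ 4 + a1 ^ 2 / a5 ^ 4)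
    + 2 * (b1 * b2 / (a1 * a2)) + 2 * (b1 * b3 / (a1 * a3))
    + 2 * (n - 1) * (b1 * b4 / (a1 * a4)) + 2 * (n - 1) * (b1 * b5 / (a1 * a5))

/-- The left-hand side of the second equation (`c = f₂''`). -/
def lhs2 (n a1 a2 a3 a4 a5 b1 b2 b3 b4 b5 c : ℝ) : ℝ :=
  c / a2 - 1 / (2 * a2 ^ 2)
    - 1 / (2 * (n + 3)) * (a2 ^ 2 / (a1 ^ 2 * a3 ^ 2) - a1 ^ 2 / (a2 ^ 2 * a3 ^ 2)
        - a3 ^ 2 / (a1 ^ 2 * a2 ^ 2))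
    - (n - 1) / (4 * (n + 3)) * (a2 ^ 2 / (a4 ^ 2 * a5 ^ 2) - a4 ^ 2 / (a2 ^ 2 * a5 ^ 2)
        - a5 ^ 2 / (a2 ^ 2 * a4 ^ 2))
    + b2 ^ 2 / a2 ^ 2 + b1 * b2 / (a1 * a2) + 2 * (b2 * b3 / (a2 * a3))
    + 2 * (n - 1) * (b2 * b4 / (a2 * a4)) + 2 * (n - 1) * (b2 * b5 / (a2 * a5))

/-- The left-hand side of the third equation (`c = f₃''`). -/
def lhs3 (n a1 a2 a3 a4 a5 b1 b2 b3 b4 b5 c : ℝ) : ℝ :=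
  c / a3 - 1 / (2 * a3 ^ 2)
    - 1 / (2 * (n + 3)) * (a3 ^ 2 / (a1 ^ 2 * a2 ^ 2) - a1 ^ 2 / (a2 ^ 2 * a3 ^ 2)
        - a2 ^ 2 / (a1 ^ 2 * a3 ^ 2))
    + (n - 1) / (2 * (n + 1) * (n + 3))
        * ((n - 1) / 2 * (a1 ^ 2 / a3 ^ 4) - a3 ^ 2 / (a4 ^ 2 * a5 ^ 2)
          + a4 ^ 2 / (a3 ^ 2 * a5 ^ 2) + a5 ^ 2 / (a3 ^ 2 * a4 ^ 2))
    + b3 ^ 2 / a3 ^ 2 + b1 * b3 / (a1 * a3) + 2 * (b2 * b3 / (a2 * a3))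
    + 2 * (n - 1) * (b3 * b4 / (a3 * a4)) + 2 * (n - 1) * (b3 * b5 / (a3 * a5))

/-- The left-hand side of the fourth equation (`c = f₄''`). -/
def lhs4 (n a1 a2 a3 a4 a5 b1 b2 b3 b4 b5 c : ℝ) : ℝ :=
  c / a4 - 1 / (2 * a4 ^ 2)
    - 1 / (4 * (n + 3)) * (a4 ^ 2 / (a2 ^ 2 * a5 ^ 2) - a2 ^ 2 / (a4 ^ 2 * a5 ^ 2)
        - a5 ^ 2 / (a2 ^ 2 * a4 ^ 2))
    + 1 / (2 * (n + 1) * (n + 3))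
        * (1 / 2 * (a1 ^ 2 / a4 ^ 4) - a4 ^ 2 / (a3 ^ 2 * a5 ^ 2)
          + a3 ^ 2 / (a4 ^ 2 * a5 ^ 2) + a5 ^ 2 / (a3 ^ 2 * a4 ^ 2))
    + (2 * n - 3) * (b4 ^ 2 / a4 ^ 2) + b1 * b4 / (a1 * a4) + 2 * (b2 * b4 / (a2 * a4))
    + 2 * (b3 * b4 / (a3 * a4)) + 2 * (n - 1) * (b4 * b5 / (a4 * a5))

/-- The left-hand side of the fifth equation (`c = f₅''`). -/
def lhs5 (n a1 a2 a3 a4 a5 b1 b2 b3 b4 b5 c : ℝ) : ℝ :=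
  c / a5 - 1 / (2 * a5 ^ 2)
    - 1 / (4 * (n + 3)) * (a5 ^ 2 / (a2 ^ 2 * a4 ^ 2) - a2 ^ 2 / (a4 ^ 2 * a5 ^ 2)
        - a4 ^ 2 / (a2 ^ 2 * a5 ^ 2))
    + 1 / (2 * (n + 1) * (n + 3))
        * (1 / 2 * (a1 ^ 2 / a5 ^ 4) - a5 ^ 2 / (a3 ^ 2 * a4 ^ 2)
          + a3 ^ 2 / (a4 ^ 2 * a5 ^ 2) + a4 ^ 2 / (a3 ^ 2 * a5 ^ 2))
    + (2 * n - 3) * (b5 ^ 2 / a5 ^ 2) + b1 * b5 / (a1 * a5) + 2 * (b2 * b5 / (a2 * a5))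
    + 2 * (b3 * b5 / (a3 * a5)) + 2 * (n - 1) * (b4 * b5 / (a4 * a5))

/-- One of the five left-hand sides above, evaluated along `f` at time `t`.
The functions `f₁, …, f₅` are `f 0, …, f 4`; `k` is the function that is differentiated twice. -/
def along (L : ℝ → ℝ → ℝ → ℝ → ℝ → ℝ → ℝ → ℝ → ℝ → ℝ → ℝ → ℝ → ℝ) (n : ℕ) (k : Fin 5)
    (f : Fin 5 → ℝ → ℝ) (t : ℝ) : ℝ :=
  L n (f 0 t) (f 1 t) (f 2 t) (f 3 t) (f 4 t)
    (deriv (f 0) t) (deriv (f 1) t) (deriv (f 2) t) (deriv (f 3) t) (deriv (f 4) t)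
    (iteratedDeriv 2 (f k) t)

/-- `f = (f₁, …, f₅)` solves the diagonal system with constant `lam` on the interval `I`: the
functions are real analytic on `I` (up to an end point that belongs to `I`), positive in the
interior of `I`, and satisfy the five equations there. -/
structure IsSolutionOn (n : ℕ) (lam : ℝ) (I : Set ℝ) (f : Fin 5 → ℝ → ℝ) : Prop where
  analytic : ∀ i, AnalyticOn ℝ (f i) I
  pos : ∀ i, ∀ t ∈ interior I, 0 < f i t
  eq1 : ∀ t ∈ interior I, along lhs1 n 0 f t = -lam
  eq2 : ∀ t ∈ interior I, along lhs2 n 1 f t = -lam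
  eq3 : ∀ t ∈ interior I, along lhs3 n 2 f t = -lam
  eq4 : ∀ t ∈ interior I, along lhs4 n 3 f t = -lam
  eq5 : ∀ t ∈ interior I, along lhs5 n 4 f t = -lam

/-- The initial conditions at `t = 0`, with one-sided derivatives on `[0, ε)`. -/
structure InitialConditions (n : ℕ) (ζ ε : ℝ) (f : Fin 5 → ℝ → ℝ) : Prop where
  value : ∀ i, f i 0 = ![0, ζ, ζ, 0, ζ] i
  deriv_one : ∀ i, derivWithin (f i) (Ico 0 ε) 0 =
    ![√(((n : ℝ) + 3) / (2 * ((n : ℝ) + 1))), 0, 0, 1 / (2 * √((n : ℝ) + 1)), 0] i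
  deriv_two_1 : iteratedDerivWithin 2 (f 0) (Ico 0 ε) 0 = 0
  deriv_two_4 : iteratedDerivWithin 2 (f 3) (Ico 0 ε) 0 = 0

/-- The final conditions at `t = 1`, with one-sided derivatives on `(1 - ε, 1]`. -/
structure FinalConditions (n : ℕ) (ζ ξ ε : ℝ) (f : Fin 5 → ℝ → ℝ) : Prop where
  value : ∀ i, f i 1 = ![ζ, 0, ζ, ξ, ξ] i
  deriv_one : ∀ i, derivWithin (f i) (Ioc (1 - ε) 1) 1 =
    ![0, -(1 / √((n : ℝ) + 3)), 0, 0, 0] i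
  deriv_two_2 : iteratedDerivWithin 2 (f 1) (Ioc (1 - ε) 1) 1 = 0

/-- Solutions of the initial value problem on `[0, ε)`. -/
def InitialSolution (n : ℕ) (lam ζ ε : ℝ) (f : Fin 5 → ℝ → ℝ) : Prop :=
  IsSolutionOn n lam (Ico 0 ε) f ∧ InitialConditions n ζ ε f

/-- Solutions of the final value problem on `(1 - ε, 1]`. -/
def FinalSolution (n : ℕ) (lam ζ ξ ε : ℝ) (f : Fin 5 → ℝ → ℝ) : Prop :=
  IsSolutionOn n lam (Ioc (1 - ε) 1) f ∧ FinalConditions n ζ ξ ε f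

/-- For a singular system `x' = 2y`, `y' = A(x)/t² + B(x,y)/t + C(t,x,y)`, the operator
`𝓛_m = (m+1) Id - 2/(m+2) (dA)_{x₀} - (∂_y B)_{(x₀,y₀)}` that determines the Taylor coefficient
of order `m + 2` of a power series solution with `x(0) = x₀`, `y(0) = y₀`. -/
def recursionOp (A : (Fin 5 → ℝ) → (Fin 5 → ℝ)) (B : (Fin 5 → ℝ) → (Fin 5 → ℝ) → (Fin 5 → ℝ))
    (x₀ y₀ : Fin 5 → ℝ) (m : ℕ) : (Fin 5 → ℝ) →L[ℝ] (Fin 5 → ℝ) :=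
  ((m : ℝ) + 1) • ContinuousLinearMap.id ℝ (Fin 5 → ℝ)
    - (2 / ((m : ℝ) + 2)) • fderiv ℝ A x₀ - fderiv ℝ (fun y => B x₀ y) y₀

/-- `∑ d_k y_k / x_k` with the dimensions `d = (1, 2, 2, 2(n-1), 2(n-1))`. -/
def logTrace (n : ℝ) (x y : Fin 5 → ℝ) : ℝ :=
  y 0 / x 0 + 2 * (y 1 / x 1) + 2 * (y 2 / x 2) + 2 * (n - 1) * (y 3 / x 3)
    + 2 * (n - 1) * (y 4 / x 4)

/-! ### The end `t = 0`

Here `xᵢ = fᵢ²/t²`, `yᵢ = fᵢfᵢ'/t² - fᵢ²/t³` for `i = 1, 4` and `xᵢ = fᵢ²`, `yᵢ = fᵢfᵢ'` for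
`i = 2, 3, 5`. -/

/-- The variables `x` at `t = 0`, for `t > 0`. -/
def xInitial (f : Fin 5 → ℝ → ℝ) (t : ℝ) : Fin 5 → ℝ :=
  ![f 0 t ^ 2 / t ^ 2, f 1 t ^ 2, f 2 t ^ 2, f 3 t ^ 2 / t ^ 2, f 4 t ^ 2]

/-- The limit `x(0)` prescribed by the initial conditions. -/
def baseInitial (n : ℕ) (ζ : ℝ) : Fin 5 → ℝ :=
  ![((n : ℝ) + 3) / (2 * ((n : ℝ) + 1)), ζ ^ 2, ζ ^ 2, 1 / (4 * ((n : ℝ) + 1)), ζ ^ 2]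

/-- The coefficient of `1/t²` in the system for `(x, y)` at `t = 0`. -/
def AInitial (n : ℝ) (x : Fin 5 → ℝ) : Fin 5 → ℝ :=
  ![-(2 * (n - 1)) * x 0 + 2 / (n + 3) - 1 / (n + 3) * (x 1 / x 2 + x 2 / x 1)
      + (n - 1) / (4 * (n + 1) * (n + 3)) * (x 0 ^ 2 / x 3 ^ 2),
    1 / (2 * (n + 3)) * (x 1 ^ 2 / (x 0 * x 2) - x 2 / x 0)
      + (n - 1) / (4 * (n + 3)) * (x 1 ^ 2 / (x 3 * x 4) - x 4 / x 3),
    1 / (2 * (n + 3)) * (x 2 ^ 2 / (x 0 * x 1) - x 1 / x 0)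
      + (n - 1) / (2 * (n + 1) * (n + 3)) * (x 2 ^ 2 / (x 3 * x 4) - x 4 / x 3),
    -(2 * (n - 1)) * x 3 + 1 / 2 - 1 / (4 * (n + 3)) * (x 1 / x 4 + x 4 / x 1)
      - 1 / (2 * (n + 1) * (n + 3)) * (1 / 2 * (x 0 / x 3) + x 2 / x 4 + x 4 / x 2),
    1 / (4 * (n + 3)) * (x 4 ^ 2 / (x 1 * x 3) - x 1 / x 3)
      + 1 / (2 * (n + 1) * (n + 3)) * (x 4 ^ 2 / (x 2 * x 3) - x 2 / x 3)]

/-- The coefficient of `1/t` in the system for `(x, y)` at `t = 0`. -/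
def BInitial (n : ℝ) (x y : Fin 5 → ℝ) : Fin 5 → ℝ :=
  ![-(2 * n - 1) * y 0 - x 0 * logTrace n x y,
    -(2 * n - 1) * y 1,
    -(2 * n - 1) * y 2,
    -(2 * n - 1) * y 3 - x 3 * logTrace n x y,
    -(2 * n - 1) * y 4]

/-- The operator `𝓛₀` at `t = 0`. -/
def L0Initial (n : ℕ) (ζ : ℝ) : (Fin 5 → ℝ) →L[ℝ] (Fin 5 → ℝ) :=
  recursionOp (AInitial n) (BInitial n) (baseInitial n ζ) 0 0

/-- `w` is the second derivative at `0` of the variables `x` attached to `f`, whose first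
derivative vanishes there: `x(t) = x(0) + (t²/2) w + o(t²)` as `t ↓ 0`. -/
def SecondCoeffInitial (n : ℕ) (ζ : ℝ) (f : Fin 5 → ℝ → ℝ) (w : Fin 5 → ℝ) : Prop :=
  Tendsto (fun t => (2 / t ^ 2) • (xInitial f t - baseInitial n ζ)) (𝓝[>] 0) (𝓝 w)

/-! ### The end `t = 1`

Put `gᵢ(t) = fᵢ(1 - t)`. Then `x₂ = g₂²/t²`, `y₂ = g₂g₂'/t² - g₂²/t³` and `xᵢ = gᵢ²`,
`yᵢ = gᵢgᵢ'` for `i = 1, 3, 4, 5`. -/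

/-- The variables `x` at the end `1`, as functions of `t = 1 - (original time) > 0`. -/
def xFinal (f : Fin 5 → ℝ → ℝ) (t : ℝ) : Fin 5 → ℝ :=
  ![f 0 (1 - t) ^ 2, f 1 (1 - t) ^ 2 / t ^ 2, f 2 (1 - t) ^ 2, f 3 (1 - t) ^ 2, f 4 (1 - t) ^ 2]

/-- The limit `x(0)` prescribed by the final conditions. -/
def baseFinal (n : ℕ) (ζ ξ : ℝ) : Fin 5 → ℝ :=
  ![ζ ^ 2, 1 / ((n : ℝ) + 3), ζ ^ 2, ξ ^ 2, ξ ^ 2]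

/-- The coefficient of `1/t²` in the system for `(x, y)` at the end `1`. -/
def AFinal (n : ℝ) (x : Fin 5 → ℝ) : Fin 5 → ℝ :=
  ![1 / (n + 3) * (x 0 ^ 2 / (x 1 * x 2) - x 2 / x 1),
    -x 1 + 1 / 2 - 1 / (2 * (n + 3)) * (x 0 / x 2 + x 2 / x 0)
      - (n - 1) / (4 * (n + 3)) * (x 3 / x 4 + x 4 / x 3),
    1 / (2 * (n + 3)) * (x 2 ^ 2 / (x 0 * x 1) - x 0 / x 1),
    1 / (4 * (n + 3)) * (x 3 ^ 2 / (x 1 * x 4) - x 4 / x 1),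
    1 / (4 * (n + 3)) * (x 4 ^ 2 / (x 1 * x 3) - x 3 / x 1)]

/-- The coefficient of `1/t` in the system for `(x, y)` at the end `1`. -/
def BFinal (n : ℝ) (x y : Fin 5 → ℝ) : Fin 5 → ℝ :=
  ![-2 * y 0, -2 * y 1 - x 1 * logTrace n x y, -2 * y 2, -2 * y 3, -2 * y 4]

/-- The operator `𝓛₀` at the end `1`. -/
def L0Final (n : ℕ) (ζ ξ : ℝ) : (Fin 5 → ℝ) →L[ℝ] (Fin 5 → ℝ) :=
  recursionOp (AFinal n) (BFinal n) (baseFinal n ζ ξ) 0 0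

/-- `w` is the second derivative at `0` of the variables `x` attached to `f` at the end `1`, whose
first derivative vanishes there: `x(t) = x(0) + (t²/2) w + o(t²)` as `t ↓ 0`. -/
def SecondCoeffFinal (n : ℕ) (ζ ξ : ℝ) (f : Fin 5 → ℝ → ℝ) (w : Fin 5 → ℝ) : Prop :=
  Tendsto (fun t => (2 / t ^ 2) • (xFinal f t - baseFinal n ζ ξ)) (𝓝[>] 0) (𝓝 w)

end ModelB

end

/-! At a singular end write fᵢ = t^σᵢ Hᵢ, with σᵢ = 1 for the collapsing components and σᵢ = 0 for
the others. The boundary conditions say exactly that Hᵢ(0) = αᵢ > 0 and Hᵢ'(0) = 0. The squares x =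
H² then satisfy the singular system x' = 2y, y' = A(x)/t² + B(x,y)/t + C(t,x,y) with A(x₀) = 0
(`reduces_of_potential`, `eqAt_iff_singularEq`). The end t = 1 is brought to this form by the
reflection t ↦ 1 - t, under which (S) is invariant.

Put x = x₀ + t²u and U = (u, t u'). Since A(x₀) = 0, A(x)/t² is analytic in (t, u), and the system
becomes a Briot-Bouquet equation t U' = 𝓕(t, U) with 𝓕(0, ·) affine (`singularEq_iff`,
`briotBouquetRhs_zero`). Its admissible initial values are the (u₀, 0) with 𝓛₀ u₀ = C(0, x₀, 0), and
a positive integer k is an eigenvalue of its linearization exactly when 𝓛ₖ has a kernel (one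
direction is `briotBouquetLin_spec`). If 𝓛ₖ is injective for all k ≥ 1, every admissible u₀
therefore carries exactly one analytic germ (`exists_briotBouquet`, `briotBouquet_unique`), and x² =
2u₀ runs through the affine space 𝓛₀ w = 2C(0, x₀, 0).

The Briot-Bouquet theorem is proved without majorants. With θ = t d/dt, the equation (θ + m + 1)U =
𝓕 + (m + 1)U is a fixed point equation for the averaging operator (θ + m + 1)⁻¹, of norm at most
1/(m + 1) on C([0,1], V). The analytic implicit function theorem, applied to the rescaled unknown s
↦ U(ts), solves it if M + (m + 1) has norm below m + 1. The general case reduces to this one by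
repeated substitution U = U₀ + tW, which replaces M by M - 1.

What is left is linear algebra at the two ends: `initial_kernel` and `final_kernel` give the
injectivity of 𝓛ₖ for k ≥ 1 and the line ker 𝓛₀; a functional that annihilates both the range of 𝓛₀
and C(0, x₀, 0) gives a particular solution p. The existence interval depends on the kernel vector,
but uncountably many vectors compete for countably many lengths 1/(N + 1), so infinitely many
solutions share one interval (`parametrized_by_ker`). -/

noncomputable section

namespace ModelB

/-! ### Analytic composition operators on spaces of continuous functions -/

section Lift

variable {X E F : Type*} [TopologicalSpace X] [CompactSpace X]
  [NormedAddCommGroup E] [NormedSpace ℝ E] [NormedAddCommGroup F] [NormedSpace ℝ F]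

/-- The pointwise action of a continuous multilinear map on continuous functions. -/
def liftMultilinear (X : Type*) [TopologicalSpace X] [CompactSpace X] {n : ℕ}
    (p : ContinuousMultilinearMap ℝ (fun _ : Fin n => E) F) :
    ContinuousMultilinearMap ℝ (fun _ : Fin n => C(X, E)) C(X, F) :=
  MultilinearMap.mkContinuous
    { toFun := fun w => ⟨fun x => p fun i => w i x, by fun_prop⟩
      map_update_add' := by
        intro _ w i a b
        ext x
        have h : ∀ z : C(X, E), (fun j => (Function.update w i z) j x)
            = Function.update (fun j => w j x) i (z x) := fun z => by
          ext j; rcases eq_or_ne j i with rfl | hj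
          · simp
          · simp [hj]
        have e : ‹DecidableEq (Fin n)› = instDecidableEqFin n := Subsingleton.elim _ _
        subst e
        simp [h]
      map_update_smul' := by
        intro _ w i c a
        ext x
        have h : ∀ z : C(X, E), (fun j => (Function.update w i z) j x)
            = Function.update (fun j => w j x) i (z x) := fun z => by
          ext j; rcases eq_or_ne j i with rfl | hj
          · simp
          · simp [hj]
        have e : ‹DecidableEq (Fin n)› = instDecidableEqFin n := Subsingleton.elim _ _
        subst e
        simp [h] } ‖p‖ (by
      intro w
      rw [ContinuousMap.norm_le _ (by positivity)]
      intro x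
      refine (p.le_opNorm _).trans ?_
      gcongr with i
      exact (w i).norm_coe_le_norm x)

theorem norm_liftMultilinear_le {n : ℕ}
    (p : ContinuousMultilinearMap ℝ (fun _ : Fin n => E) F) : ‖liftMultilinear X p‖ ≤ ‖p‖ :=
  MultilinearMap.mkContinuous_norm_le _ (norm_nonneg _) _

/-- Composition with a map that is analytic at `c` is an analytic operation on continuous
functions close to the constant function `c`. -/
theorem exists_analyticAt_lift (X : Type*) [TopologicalSpace X] [CompactSpace X]
    [CompleteSpace F] {g : E → F} {c : E} (hg : AnalyticAt ℝ g c) :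
    ∃ G : C(X, E) → C(X, F), AnalyticAt ℝ G (ContinuousMap.const X c) ∧
      ∃ r > 0, ∀ w : C(X, E), ‖w - ContinuousMap.const X c‖ < r → ∀ x, G w x = g (w x) := by
  obtain ⟨p, r, hp⟩ := hg
  let P : FormalMultilinearSeries ℝ C(X, E) C(X, F) := fun n => liftMultilinear X (p n)
  -- Lifting does not increase the norms of the coefficients, so the lifted series converges at
  -- least on the ball of the original one.
  have hrad : r ≤ P.radius := hp.r_le.trans
    (FormalMultilinearSeries.radius_le_of_le fun n => norm_liftMultilinear_le (p n))
  have hP : HasFPowerSeriesOnBall P.sum P 0 r :=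
    (P.hasFPowerSeriesOnBall (hp.r_pos.trans_le hrad)).mono hp.r_pos hrad
  refine ⟨fun w => P.sum (w - ContinuousMap.const X c), ?_, ?_⟩
  · have h1 : AnalyticAt ℝ P.sum (ContinuousMap.const X c - ContinuousMap.const X c) := by
      rw [sub_self]; exact hP.analyticAt
    exact h1.comp_of_eq (by fun_prop) rfl
  · obtain ⟨s, hs0, hsr⟩ := ENNReal.lt_iff_exists_nnreal_btwn.1 hp.r_pos
    refine ⟨s, by exact_mod_cast hs0, fun w hw x => ?_⟩
    have hw' : w - ContinuousMap.const X c ∈ Metric.eball (0 : C(X, E)) r := by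
      rw [Metric.mem_eball, edist_zero_right]
      refine lt_trans ?_ hsr
      rw [← ofReal_norm, ← ENNReal.ofReal_coe_nnreal]
      exact (ENNReal.ofReal_lt_ofReal_iff (lt_of_le_of_lt (norm_nonneg _) hw)).2 hw
    have hx : w x - c ∈ Metric.eball (0 : E) r := by
      rw [Metric.mem_eball, edist_zero_right] at hw' ⊢
      refine lt_of_le_of_lt ?_ hw'
      rw [← ofReal_norm, ← ofReal_norm]
      exact ENNReal.ofReal_le_ofReal ((w - ContinuousMap.const X c).norm_coe_le_norm x)
    have h1 := ContinuousMap.hasSum_apply (hP.hasSum hw') x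
    have h2 := hp.hasSum hx
    rw [zero_add] at h1
    rw [add_sub_cancel] at h2
    exact h1.unique h2

/-- The derivative of the composition operator at a constant function is pointwise. -/
theorem fderiv_lift_apply {g : E → F} {c : E} (hg : DifferentiableAt ℝ g c)
    {G : C(X, E) → C(X, F)} (hG : DifferentiableAt ℝ G (ContinuousMap.const X c))
    {r : ℝ} (hr : 0 < r)
    (h : ∀ w : C(X, E), ‖w - ContinuousMap.const X c‖ < r → ∀ x, G w x = g (w x))
    (w : C(X, E)) (x : X) :
    fderiv ℝ G (ContinuousMap.const X c) w x = fderiv ℝ g c (w x) := by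
  have h1 : HasFDerivAt (fun w => G w x)
      ((ContinuousMap.evalCLM ℝ x : C(X, F) →L[ℝ] F) ∘L fderiv ℝ G (ContinuousMap.const X c))
      (ContinuousMap.const X c) :=
    (ContinuousMap.evalCLM ℝ x : C(X, F) →L[ℝ] F).hasFDerivAt.comp _ hG.hasFDerivAt
  have h2 : HasFDerivAt (fun w : C(X, E) => g (w x))
      (fderiv ℝ g c ∘L (ContinuousMap.evalCLM ℝ x : C(X, E) →L[ℝ] E))
      (ContinuousMap.const X c) :=
    HasFDerivAt.comp (g := g) (f := fun w : C(X, E) => w x) _ hg.hasFDerivAt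
      (ContinuousMap.evalCLM ℝ x : C(X, E) →L[ℝ] E).hasFDerivAt
  have h3 : (fun w => G w x) =ᶠ[𝓝 (ContinuousMap.const X c)] fun w => g (w x) := by
    filter_upwards [Metric.ball_mem_nhds (ContinuousMap.const X c) hr] with w hw
    exact h w (by simpa [dist_eq_norm] using hw) x
  exact congrArg (fun L => L w) (h1.unique (h2.congr_of_eventuallyEq h3))

end Lift

/-! ### Averaging along rays and Hadamard's lemma -/

section Averaging

open unitInterval

variable {E F : Type*} [NormedAddCommGroup E] [NormedSpace ℝ E]
  [NormedAddCommGroup F] [NormedSpace ℝ F]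

/-- The operator `w ↦ (s ↦ ∫₀¹ τᵐ w(sτ) dτ)`, the inverse of `θ + m + 1` with `θ = s d/ds`. -/
def average (E : Type*) [NormedAddCommGroup E] [NormedSpace ℝ E] (m : ℕ) : C(I, E) →L[ℝ] C(I, E) :=
  LinearMap.mkContinuous
    -- For τ in [0,1] the product sτ already lies in [0,1]; `projIcc` only makes the integrand
    -- total.
    { toFun := fun w => ⟨fun s => ∫ τ in (0 : ℝ)..1, τ ^ m • w (projIcc 0 1 zero_le_one (s * τ)), by
        apply intervalIntegral.continuous_parametric_intervalIntegral_of_continuous'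
        fun_prop⟩
      map_add' := fun v w => by
        ext s
        simp only [ContinuousMap.add_apply, smul_add, ContinuousMap.coe_mk]
        refine intervalIntegral.integral_add ?_ ?_ <;>
          exact Continuous.intervalIntegrable (by fun_prop) _ _
      map_smul' := fun c w => by
        ext s
        simp only [ContinuousMap.smul_apply, ContinuousMap.coe_mk, RingHom.id_apply, smul_comm _ c]
        exact intervalIntegral.integral_smul _ _ } (1 / (m + 1)) (fun w => by
      rw [ContinuousMap.norm_le _ (by positivity)]
      intro s
      have h : ‖∫ τ in (0 : ℝ)..1, τ ^ m • w (projIcc 0 1 zero_le_one (s * τ))‖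
          ≤ ∫ τ in (0 : ℝ)..1, τ ^ m * ‖w‖ := by
        refine intervalIntegral.norm_integral_le_of_norm_le zero_le_one ?_
          (Continuous.intervalIntegrable (by fun_prop) _ _)
        refine Filter.Eventually.of_forall fun τ hτ => ?_
        rw [norm_smul, norm_pow, Real.norm_of_nonneg hτ.1.le]
        have := hτ.1.le
        gcongr
        exact w.norm_coe_le_norm _
      simpa [integral_pow] using h)

theorem average_apply (m : ℕ) (w : C(I, E)) (s : I) :
    average E m w s = ∫ τ in (0 : ℝ)..1, τ ^ m • w (projIcc 0 1 zero_le_one (s * τ)) := rfl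

theorem norm_average_le (m : ℕ) : ‖average E m‖ ≤ 1 / (m + 1) :=
  LinearMap.mkContinuous_norm_le _ (by positivity) _

theorem average_const [CompleteSpace E] (m : ℕ) (c : E) :
    average E m (ContinuousMap.const I c) = ContinuousMap.const I ((1 / ((m : ℝ) + 1)) • c) := by
  ext s
  simp [average_apply, integral_pow]

/-- Hadamard's lemma: a divided difference of an analytic map is analytic. -/
theorem AnalyticAt.exists_dividedDifference [CompleteSpace F] {f : E → F} {c : E}
    (hf : AnalyticAt ℝ f c) :
    ∃ K : E × E → E →L[ℝ] F, AnalyticAt ℝ K (c, c) ∧ K (c, c) = fderiv ℝ f c ∧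
      ∀ᶠ z in 𝓝 (c, c), f z.2 - f z.1 = K z (z.2 - z.1) := by
  -- K(z) is the mean of df over the segment from z.1 to z.2. It is analytic in z as a composite of
  -- the linear map `seg`, the composition operator `G` of df, and the linear map `A` that
  -- integrates over [0,1].
  obtain ⟨G, hG, r, hr, hGr⟩ := exists_analyticAt_lift I hf.fderiv
  let seg : E × E →L[ℝ] C(I, E) := LinearMap.mkContinuous
    { toFun := fun z => ⟨fun s => z.1 + (s : ℝ) • (z.2 - z.1), by fun_prop⟩
      map_add' := fun y z => by
        ext s
        simp only [Prod.fst_add, Prod.snd_add, ContinuousMap.coe_mk, ContinuousMap.add_apply]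
        module
      map_smul' := fun a z => by
        ext s
        simp only [Prod.smul_fst, Prod.smul_snd, ContinuousMap.coe_mk, ContinuousMap.smul_apply,
          RingHom.id_apply]
        module } 3 (fun z => by
      rw [ContinuousMap.norm_le _ (by positivity)]
      intro s
      calc ‖z.1 + (s : ℝ) • (z.2 - z.1)‖ ≤ ‖z.1‖ + ‖(s : ℝ)‖ * ‖z.2 - z.1‖ := by
            refine (norm_add_le _ _).trans ?_
            rw [norm_smul]
        _ ≤ ‖z‖ + 1 * (‖z‖ + ‖z‖) := by
            gcongr
            · exact norm_fst_le z
            · rw [Real.norm_of_nonneg s.2.1]; exact s.2.2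
            · exact (norm_sub_le _ _).trans (add_le_add (norm_snd_le z) (norm_fst_le z))
        _ = 3 * ‖z‖ := by ring)
  have hseg : ∀ z s, seg z s = z.1 + (s : ℝ) • (z.2 - z.1) := fun z s => rfl
  have hsegc : seg (c, c) = ContinuousMap.const I c := by ext s; simp [hseg]
  let A : C(I, E →L[ℝ] F) →L[ℝ] (E →L[ℝ] F) :=
    (ContinuousMap.evalCLM ℝ (1 : I) : C(I, E →L[ℝ] F) →L[ℝ] _) ∘L average (E →L[ℝ] F) 0
  have hA : ∀ w, A w = ∫ τ in (0 : ℝ)..1, w (projIcc 0 1 zero_le_one τ) := fun w => by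
    simp [A, average_apply]
  refine ⟨fun z => A (G (seg z)), ?_, ?_, ?_⟩
  · have h1 : AnalyticAt ℝ (fun z => G (seg z)) (c, c) :=
      hG.comp_of_eq (seg.analyticAt _) hsegc
    exact (A.analyticAt _).comp h1
  · have h1 : G (ContinuousMap.const I c) = ContinuousMap.const I (fderiv ℝ f c) := by
      ext1 s
      exact hGr _ (by simpa using hr) s
    simp [hsegc, h1, hA]
  · have hs : ∀ᶠ z in 𝓝 (c, c), ‖seg z - ContinuousMap.const I c‖ < r := by
      have : Tendsto (fun z => ‖seg z - ContinuousMap.const I c‖) (𝓝 (c, c)) (𝓝 0) := by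
        have h : Continuous fun z => ‖seg z - ContinuousMap.const I c‖ := by fun_prop
        simpa [hsegc] using h.tendsto (c, c)
      exact this.eventually_lt_const hr
    have hd := (hf.eventually_analyticAt).filter_mono (le_refl _)
    obtain ⟨δ, hδ, hd⟩ := Metric.eventually_nhds_iff_ball.1 hd
    have hb : ∀ᶠ z in 𝓝 (c, c), z ∈ Metric.ball (c, c) δ := Metric.ball_mem_nhds _ hδ
    filter_upwards [hs, hb] with z hz hzb
    have hz1 : z.1 ∈ Metric.ball c δ := by
      rw [Metric.mem_ball] at hzb ⊢; exact (le_max_left _ _).trans_lt hzb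
    have hz2 : z.2 ∈ Metric.ball c δ := by
      rw [Metric.mem_ball] at hzb ⊢; exact (le_max_right _ _).trans_lt hzb
    have hmem : ∀ s ∈ Icc (0 : ℝ) 1, z.1 + s • (z.2 - z.1) ∈ Metric.ball c δ := fun s hs =>
      (convex_ball c δ).add_smul_sub_mem hz1 hz2 hs
    have hint : ∀ s ∈ Icc (0 : ℝ) 1, G (seg z) (projIcc 0 1 zero_le_one s)
        = fderiv ℝ f (z.1 + s • (z.2 - z.1)) := fun s hs => by
      rw [hGr _ hz, hseg, projIcc_of_mem _ hs]
    have hcont : Continuous fun s => G (seg z) (projIcc (0 : ℝ) 1 zero_le_one s) := by fun_prop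
    have hftc : ∫ s in (0 : ℝ)..1, (G (seg z) (projIcc 0 1 zero_le_one s)) (z.2 - z.1)
        = f (z.1 + (1 : ℝ) • (z.2 - z.1)) - f (z.1 + (0 : ℝ) • (z.2 - z.1)) := by
      refine intervalIntegral.integral_eq_sub_of_hasDerivAt
        (f := fun s : ℝ => f (z.1 + s • (z.2 - z.1))) (fun s hs => ?_)
        (Continuous.intervalIntegrable (by fun_prop) _ _)
      rw [uIcc_of_le zero_le_one] at hs
      rw [hint s hs]
      have h1 : HasDerivAt (fun s : ℝ => z.1 + s • (z.2 - z.1)) (z.2 - z.1) s := by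
        simpa using ((hasDerivAt_id s).smul_const (z.2 - z.1)).const_add z.1
      exact (hd _ (hmem s hs)).differentiableAt.hasFDerivAt.comp_hasDerivAt s h1
    rw [hA]
    have h2 := (ContinuousLinearMap.apply ℝ F (z.2 - z.1)).intervalIntegral_comp_comm
      (hcont.intervalIntegrable (μ := MeasureTheory.volume) 0 1)
    simp only [ContinuousLinearMap.apply_apply] at h2
    rw [← h2, hftc]
    simp

end Averaging

attribute [local fun_prop] analyticAt_fst analyticAt_snd

/-! ### The Briot-Bouquet theorem -/

section BriotBouquet

open unitInterval
open scoped ContDiff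

theorem AnalyticAt.clm_apply {D E F : Type*} [NormedAddCommGroup D] [NormedSpace ℝ D]
    [NormedAddCommGroup E] [NormedSpace ℝ E] [NormedAddCommGroup F] [NormedSpace ℝ F]
    {K : D → E →L[ℝ] F} {w : D → E} {z : D} (hK : AnalyticAt ℝ K z) (hw : AnalyticAt ℝ w z) :
    AnalyticAt ℝ (fun y => K y (w y)) z :=
  ((ContinuousLinearMap.id ℝ (E →L[ℝ] F)).analyticAt_bilinear (K z, w z)).comp₂ hK hw

variable {V : Type*} [NormedAddCommGroup V] [NormedSpace ℝ V] [CompleteSpace V]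

/-- A function that is a weighted average of `H` along rays satisfies an Euler equation. -/
theorem euler_equation_of_average {m : ℕ} {v H : ℝ → V} {η : ℝ}
    (hH : ContinuousOn H (Ioo (-η) η)) (hv : DifferentiableOn ℝ v (Ioo (-η) η))
    (h : ∀ t ∈ Ioo (-η) η, v t = ∫ τ in (0 : ℝ)..1, τ ^ m • H (t * τ)) :
    ∀ t ∈ Ioo (-η) η, t • deriv v t + ((m : ℝ) + 1) • v t = H t := by
  intro t ht
  have hη : 0 < η := by linarith [ht.1, ht.2]
  -- At t = 0 the factor tᵐ cannot be cancelled, but there the average is just H(0)/(m + 1).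
  rcases eq_or_ne t 0 with rfl | ht0
  · rw [h 0 ht]
    have hm : (m : ℝ) + 1 ≠ 0 := by positivity
    simp [integral_pow, smul_smul, hm]
  have hcont : ContinuousOn (fun r => r ^ m • H r) (Ioo (-η) η) := by fun_prop
  -- The substitution r = sτ turns the average into a primitive of rᵐH(r); differentiating it and
  -- cancelling tᵐ gives the Euler equation.
  have hprim : ∀ s ∈ Ioo (-η) η, s ^ (m + 1) • v s = ∫ r in (0 : ℝ)..s, r ^ m • H r := by
    intro s hs
    have e := intervalIntegral.smul_integral_comp_mul_left (a := 0) (b := 1)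
      (fun r => r ^ m • H r) s
    rw [mul_zero, mul_one] at e
    rw [← e, h s hs, pow_succ', mul_smul, ← intervalIntegral.integral_smul]
    congr 2
    ext τ
    rw [smul_smul, mul_pow]
  have hnhds : Ioo (-η) η ∈ 𝓝 t := Ioo_mem_nhds ht.1 ht.2
  have d1 : HasDerivAt (fun s => s ^ (m + 1) • v s)
      (t ^ (m + 1) • deriv v t + (((m + 1 : ℕ) : ℝ) * t ^ m) • v t) t := by
    have := (hasDerivAt_pow (m + 1) t).fun_smul ((hv.differentiableAt hnhds).hasDerivAt)
    simpa using this
  have d2 : HasDerivAt (fun s => ∫ r in (0 : ℝ)..s, r ^ m • H r) (t ^ m • H t) t := by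
    refine intervalIntegral.integral_hasDerivAt_right ?_ ?_ ?_
    · refine ContinuousOn.intervalIntegrable (hcont.mono fun x hx => ?_)
      rw [mem_uIcc] at hx
      constructor <;> rcases hx with hx | hx <;> linarith [ht.1, ht.2, hx.1, hx.2]
    · exact hcont.stronglyMeasurableAtFilter isOpen_Ioo t ht
    · exact hcont.continuousAt hnhds
  have d3 := d1.unique (d2.congr_of_eventuallyEq (by
    filter_upwards [hnhds] with s hs using hprim s hs))
  have htm : t ^ m ≠ 0 := pow_ne_zero _ ht0
  apply smul_right_injective V htm
  simp only
  rw [← d3, smul_add, smul_smul, smul_smul, pow_succ]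
  push_cast
  rw [mul_comm (t ^ m) ((m : ℝ) + 1)]

/-- The Briot-Bouquet equation `t U' = 𝓕(t, U)` has an analytic solution if the linearization of
`𝓕` is close to a large negative multiple of the identity. -/
theorem exists_briotBouquet_of_norm_lt {𝓕 : ℝ × V → V} {U₀ : V} {M : V →L[ℝ] V} {m : ℕ}
    (h𝓕 : AnalyticAt ℝ 𝓕 (0, U₀)) (h0 : 𝓕 (0, U₀) = 0)
    (hM : HasFDerivAt (fun U => 𝓕 (0, U)) M U₀)
    (hm : ‖M + ((m : ℝ) + 1) • ContinuousLinearMap.id ℝ V‖ < (m : ℝ) + 1) :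
    ∃ U : ℝ → V, AnalyticAt ℝ U 0 ∧ U 0 = U₀ ∧ ∀ᶠ t in 𝓝 0, t • deriv U t = 𝓕 (t, U t) := by
  set c : ℝ × V := (0, U₀) with hc
  -- Adding (m + 1)U to both sides makes the left side (θ + m + 1)U, which `average V m` inverts.
  set 𝓖 : ℝ × V → V := fun z => 𝓕 z + ((m : ℝ) + 1) • z.2 with h𝓖def
  set M' := M + ((m : ℝ) + 1) • ContinuousLinearMap.id ℝ V with hM'
  have h𝓖 : AnalyticAt ℝ 𝓖 c := by fun_prop
  have hm0 : (0 : ℝ) < (m : ℝ) + 1 := by positivity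
  obtain ⟨G, hG, r, hr, hGr⟩ := exists_analyticAt_lift I h𝓖
  let e₁ : C(I, ℝ × V) := ⟨fun s => ((s : ℝ), 0), by fun_prop⟩
  -- The unknown at parameter ε is the rescaled solution s ↦ U(εs), accompanied by the time εs. At ε
  -- = 0 it is the constant U₀, around which the implicit function theorem applies.
  let ι : ℝ × C(I, V) →L[ℝ] C(I, ℝ × V) :=
    (ContinuousLinearMap.toSpanSingleton ℝ e₁) ∘L ContinuousLinearMap.fst ℝ ℝ C(I, V)
      + (ContinuousLinearMap.compLeftContinuous ℝ I (ContinuousLinearMap.inr ℝ ℝ V))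
          ∘L ContinuousLinearMap.snd ℝ ℝ C(I, V)
  have hι : ∀ ε w s, ι (ε, w) s = (ε * (s : ℝ), w s) := by
    intro ε w s
    simp [ι, e₁]
  let c₀ : C(I, V) := ContinuousMap.const I U₀
  have hιc : ι (0, c₀) = ContinuousMap.const I c := by
    ext1 s; simp [hι, c₀, hc]
  let Φ : ℝ × C(I, V) → C(I, V) := fun z => z.2 - average V m (G (ι z))
  have hGι : AnalyticAt ℝ (fun z => G (ι z)) (0, c₀) := hG.comp_of_eq (ι.analyticAt _) hιc
  have hΦ : AnalyticAt ℝ Φ (0, c₀) :=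
    analyticAt_snd.sub (((average V m).analyticAt _).comp hGι)
  have hΦ0 : Φ (0, c₀) = 0 := by
    have h1 : G (ContinuousMap.const I c) = ContinuousMap.const I (𝓖 c) := by
      ext1 s; exact hGr _ (by simpa using hr) s
    have h2 : 𝓖 c = ((m : ℝ) + 1) • U₀ := by simp only [h𝓖def, h0, zero_add]; rfl
    simp only [Φ, hιc, h1, average_const, h2, smul_smul]
    rw [one_div_mul_cancel hm0.ne', one_smul, sub_self]
  have hM𝓖 : ∀ h : V, fderiv ℝ 𝓖 c (0, h) = M' h := by
    intro h
    have d1 : HasFDerivAt (fun U : V => 𝓖 (0, U)) (fderiv ℝ 𝓖 c ∘L ContinuousLinearMap.inr ℝ ℝ V)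
        U₀ :=
      HasFDerivAt.comp (g := 𝓖) (f := fun U : V => ((0 : ℝ), U)) U₀
        h𝓖.differentiableAt.hasFDerivAt (ContinuousLinearMap.inr ℝ ℝ V).hasFDerivAt
    have d2 : HasFDerivAt (fun U : V => 𝓖 (0, U)) M' U₀ :=
      hM.add ((hasFDerivAt_id U₀).const_smul ((m : ℝ) + 1))
    simpa using congrArg (fun L => L h) (d1.unique d2)
  -- The partial derivative of Φ in w is id - T, invertible by a Neumann series because ‖T‖ ≤
  -- ‖M'‖/(m + 1) < 1.
  let T : C(I, V) →L[ℝ] C(I, V) :=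
    average V m ∘L ContinuousLinearMap.compLeftContinuous ℝ I M'
  have hderiv : fderiv ℝ Φ (0, c₀) ∘L ContinuousLinearMap.inr ℝ ℝ C(I, V)
      = ContinuousLinearMap.id ℝ _ - T := by
    have hGd : DifferentiableAt ℝ G (ι (0, c₀)) := hιc ▸ hG.differentiableAt
    have d1 : HasFDerivAt Φ (ContinuousLinearMap.snd ℝ ℝ C(I, V)
        - average V m ∘L (fderiv ℝ G (ι (0, c₀)) ∘L ι)) (0, c₀) :=
      hasFDerivAt_snd.sub ((average V m).hasFDerivAt.comp _
        (hGd.hasFDerivAt.comp (0, c₀) ι.hasFDerivAt))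
    rw [d1.fderiv]
    ext1 h
    have h2 : fderiv ℝ G (ι (0, c₀)) (ι (0, h)) = ContinuousLinearMap.compLeftContinuous ℝ I M' h := by
      ext1 s
      rw [hιc, fderiv_lift_apply h𝓖.differentiableAt hG.differentiableAt hr hGr, hι, zero_mul, hM𝓖]
      rfl
    simp [T, h2]
  have hT : ‖T‖ < 1 := by
    have h1 : ‖ContinuousLinearMap.compLeftContinuous ℝ I M'‖ ≤ ‖M'‖ := by
      refine ContinuousLinearMap.opNorm_le_bound _ (norm_nonneg _) fun w => ?_
      rw [ContinuousMap.norm_le _ (by positivity)]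
      intro s
      exact (M'.le_opNorm _).trans (by gcongr; exact w.norm_coe_le_norm s)
    calc ‖T‖ ≤ ‖average V m‖ * ‖ContinuousLinearMap.compLeftContinuous ℝ I M'‖ :=
          ContinuousLinearMap.opNorm_comp_le _ _
      _ ≤ 1 / ((m : ℝ) + 1) * ‖M'‖ := by
          gcongr
          exact norm_average_le m
      _ < 1 / ((m : ℝ) + 1) * ((m : ℝ) + 1) := by gcongr
      _ = 1 := one_div_mul_cancel hm0.ne'
  have hinv : (fderiv ℝ Φ (0, c₀) ∘L ContinuousLinearMap.inr ℝ ℝ C(I, V)).IsInvertible := by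
    rw [hderiv]
    obtain ⟨u, hu⟩ := isUnit_one_sub_of_norm_lt_one (x := T) hT
    exact ⟨ContinuousLinearEquiv.ofUnit u, hu⟩
  have hcd : ContDiffAt ℝ ω Φ (0, c₀) := hΦ.contDiffAt
  have hω : (ω : ℕ∞ω) ≠ 0 := by simp
  set ψ := hcd.implicitFunction hω hinv with hψ
  have hψan : AnalyticAt ℝ ψ 0 := (hcd.contDiffAt_implicitFunction hω hinv).analyticAt
  have hψ0 : ψ 0 = c₀ := hcd.implicitFunction_apply_self hω hinv
  have hψsol : ∀ᶠ t in 𝓝 (0 : ℝ), Φ (t, ψ t) = 0 := by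
    have := hcd.eventually_apply_implicitFunction hω hinv
    rwa [hΦ0] at this
  have hψuniq : ∀ᶠ z in 𝓝 ((0 : ℝ), c₀), Φ z = 0 ↔ ψ z.1 = z.2 := by
    have := hcd.eventually_apply_eq_iff_implicitFunction hω hinv
    rwa [hΦ0] at this
  obtain ⟨δ, hδ, hδu⟩ := Metric.eventually_nhds_iff_ball.1 hψuniq
  let v : ℝ → V := fun t => ψ t 1
  have hv : AnalyticAt ℝ v 0 :=
    ((ContinuousMap.evalCLM ℝ (1 : I) : C(I, V) →L[ℝ] V).analyticAt _).comp hψan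
  have hv0 : v 0 = U₀ := by simp [v, hψ0, c₀]
  have hHan : AnalyticAt ℝ (fun t => 𝓖 (t, v t)) 0 :=
    h𝓖.comp_of_eq (analyticAt_id.prod hv) (by simp [hv0, hc])
  -- The smallness conditions on the parameter.
  have hsmall1 : ∀ᶠ t in 𝓝 (0 : ℝ), ‖ψ t - c₀‖ < δ := by
    have : Tendsto (fun t => ‖ψ t - c₀‖) (𝓝 0) (𝓝 0) := by
      have h := (hψan.continuousAt.sub (continuousAt_const (y := c₀))).norm
      simpa [ContinuousAt, hψ0] using h
    exact this.eventually_lt_const hδ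
  have hsmall2 : ∀ᶠ t in 𝓝 (0 : ℝ), ‖ι (t, ψ t) - ContinuousMap.const I c‖ < r := by
    have hh : ContinuousAt (fun t => ‖ι (t, ψ t) - ContinuousMap.const I c‖) 0 := by
      have : ContinuousAt (fun t => ι (t, ψ t)) 0 :=
        ι.continuous.continuousAt.comp (continuousAt_id.prodMk hψan.continuousAt)
      exact (this.sub continuousAt_const).norm
    have : Tendsto (fun t => ‖ι (t, ψ t) - ContinuousMap.const I c‖) (𝓝 0) (𝓝 0) := by
      simpa [ContinuousAt, hψ0, hιc] using hh
    exact this.eventually_lt_const hr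
  obtain ⟨η, hη, hall⟩ := Metric.eventually_nhds_iff_ball.1
    (((hψsol.and hsmall1).and hsmall2).and
      (hv.eventually_analyticAt.and hHan.eventually_analyticAt))
  rw [Real.ball_eq_Ioo, zero_sub, zero_add] at hall
  have hηδ : 0 < min η δ := lt_min hη hδ
  have hsub : ∀ t ∈ Ioo (-min η δ) (min η δ), t ∈ Ioo (-η) η := fun t ht =>
    ⟨by linarith [ht.1, min_le_left η δ], ht.2.trans_le (min_le_left _ _)⟩
  have hpt : ∀ t ∈ Ioo (-η) η, ∀ s : I, ψ t s = ∫ τ in (0 : ℝ)..1,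
      τ ^ m • 𝓖 (t * (projIcc (0 : ℝ) 1 zero_le_one (s * τ) : I),
        ψ t (projIcc 0 1 zero_le_one (s * τ))) := by
    intro t ht s
    obtain ⟨⟨⟨h1, -⟩, h2⟩, -⟩ := hall t ht
    have h3 : ψ t = average V m (G (ι (t, ψ t))) := sub_eq_zero.1 h1
    conv_lhs => rw [h3, average_apply]
    simp only [hGr _ h2, hι]
  -- The path ρ ↦ ψₜ(sρ) solves the fixed point equation with parameter ts and is close to c₀. Local
  -- uniqueness identifies it with the implicit function at ts, so the family ψ really consists of
  -- rescalings of the single function v.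
  have hscale : ∀ t ∈ Ioo (-min η δ) (min η δ), ∀ s : I, ψ t s = v (t * s) := by
    intro t ht s
    let w : C(I, V) := (ψ t).comp ⟨fun ρ => s * ρ, by fun_prop⟩
    have hwρ : ∀ ρ, w ρ = ψ t (s * ρ) := fun ρ => rfl
    have ht' := hsub t ht
    obtain ⟨⟨⟨h1, hsm⟩, h2⟩, -⟩ := hall t ht'
    have hw1 : ‖w - c₀‖ ≤ ‖ψ t - c₀‖ := by
      rw [ContinuousMap.norm_le _ (norm_nonneg _)]
      intro ρ
      exact (ψ t - c₀).norm_coe_le_norm (s * ρ)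
    have hw2 : ‖ι (t * s, w) - ContinuousMap.const I c‖ ≤ ‖ι (t, ψ t) - ContinuousMap.const I c‖ := by
      rw [ContinuousMap.norm_le _ (norm_nonneg _)]
      intro ρ
      have h4 := (ι (t, ψ t) - ContinuousMap.const I c).norm_coe_le_norm (s * ρ)
      simp only [ContinuousMap.sub_apply, hι] at h4 ⊢
      simpa [hwρ, mul_assoc] using h4
    have hmem : ((t * s : ℝ), w) ∈ Metric.ball ((0 : ℝ), c₀) δ := by
      rw [Metric.mem_ball, Prod.dist_eq, max_lt_iff]
      constructor
      · have : |t| < δ := abs_lt.2 ⟨by linarith [ht.1, min_le_right η δ],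
          ht.2.trans_le (min_le_right _ _)⟩
        rw [dist_zero_right, Real.norm_eq_abs, abs_mul, abs_of_nonneg s.2.1]
        exact (mul_le_of_le_one_right (abs_nonneg _) s.2.2).trans_lt this
      · rw [dist_eq_norm]; exact hw1.trans_lt hsm
    have hΦw : Φ (t * s, w) = 0 := by
      refine sub_eq_zero.2 ?_
      ext1 ρ
      simp only [hwρ]
      rw [hpt t ht', average_apply]
      refine intervalIntegral.integral_congr fun τ hτ => ?_
      rw [uIcc_of_le zero_le_one] at hτ
      have e1 : (ρ : ℝ) * τ ∈ Icc (0 : ℝ) 1 :=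
        ⟨mul_nonneg ρ.2.1 hτ.1, mul_le_one₀ ρ.2.2 hτ.1 hτ.2⟩
      have e2 : ((s * ρ : I) : ℝ) * τ ∈ Icc (0 : ℝ) 1 :=
        ⟨mul_nonneg (s * ρ).2.1 hτ.1, mul_le_one₀ (s * ρ).2.2 hτ.1 hτ.2⟩
      rw [projIcc_of_mem _ e1, projIcc_of_mem _ e2, hGr _ (hw2.trans_lt h2), hι, hwρ]
      have e3 : (⟨((s * ρ : I) : ℝ) * τ, e2⟩ : I) = s * ⟨(ρ : ℝ) * τ, e1⟩ := by
        ext; simp [mul_assoc]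
      rw [e3]
      simp [mul_assoc]
    have h5 := (hδu _ hmem).1 hΦw
    simp only at h5
    simp only [v, h5, hwρ, mul_one]
  have heuler := euler_equation_of_average (m := m) (v := v) (H := fun t => 𝓖 (t, v t))
    (η := min η δ)
    (fun t ht => ((hall t (hsub t ht)).2.2.continuousAt).continuousWithinAt)
    (fun t ht => ((hall t (hsub t ht)).2.1.differentiableAt).differentiableWithinAt)
    (fun t ht => by
      have h1 := hpt t (hsub t ht) 1
      simp only [v]
      rw [h1]
      refine intervalIntegral.integral_congr fun τ hτ => ?_
      rw [uIcc_of_le zero_le_one] at hτ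
      simp only [Icc.coe_one, one_mul]
      rw [projIcc_of_mem _ hτ, hscale t ht])
  refine ⟨v, hv, hv0, ?_⟩
  filter_upwards [Ioo_mem_nhds (neg_lt_zero.2 hηδ) hηδ] with t ht
  exact add_right_cancel (heuler t ht)

/-- **Briot-Bouquet**: the singular equation `t U' = 𝓕(t, U)` has an analytic solution through
every zero `U₀` of `𝓕(0, ·)` at which the linearization has no positive integer eigenvalue. -/
theorem exists_briotBouquet [FiniteDimensional ℝ V] {𝓕 : ℝ × V → V} {U₀ : V} {M : V →L[ℝ] V}
    (h𝓕 : AnalyticAt ℝ 𝓕 (0, U₀)) (h0 : 𝓕 (0, U₀) = 0)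
    (hM : HasFDerivAt (fun U => 𝓕 (0, U)) M U₀)
    (hspec : ∀ k : ℕ, 1 ≤ k → ∀ a : V, M a = (k : ℝ) • a → a = 0) :
    ∃ U : ℝ → V, AnalyticAt ℝ U 0 ∧ U 0 = U₀ ∧ ∀ᶠ t in 𝓝 0, t • deriv U t = 𝓕 (t, U t) := by
  -- N counts the substitutions U = U₀ + tW still to be made; afterwards the linearization is M - N
  -- and must satisfy the norm condition. For N = m + 1 that condition is just ‖M‖ < m + 1.
  suffices H : ∀ N : ℕ, ∀ (𝓕 : ℝ × V → V) (U₀ : V) (M : V →L[ℝ] V),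
      AnalyticAt ℝ 𝓕 (0, U₀) → 𝓕 (0, U₀) = 0 → HasFDerivAt (fun U => 𝓕 (0, U)) M U₀ →
      (∀ k : ℕ, 1 ≤ k → ∀ a : V, M a = (k : ℝ) • a → a = 0) →
      (∃ m : ℕ, ‖M + ((m : ℝ) + 1 - N) • ContinuousLinearMap.id ℝ V‖ < (m : ℝ) + 1) →
      ∃ U : ℝ → V, AnalyticAt ℝ U 0 ∧ U 0 = U₀ ∧ ∀ᶠ t in 𝓝 0, t • deriv U t = 𝓕 (t, U t) by
    obtain ⟨m, hm⟩ := exists_nat_gt ‖M‖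
    refine H (m + 1) 𝓕 U₀ M h𝓕 h0 hM hspec ⟨m, ?_⟩
    push_cast
    rw [sub_self, zero_smul, add_zero]
    linarith
  intro N
  induction N with
  | zero =>
    rintro 𝓕 U₀ M h𝓕 h0 hM - ⟨m, hm⟩
    refine exists_briotBouquet_of_norm_lt (m := m) h𝓕 h0 hM ?_
    simpa using hm
  | succ N ih =>
    rintro 𝓕 U₀ M h𝓕 h0 hM hspec ⟨m, hm⟩
    obtain ⟨K, hK, hKc, hKeq⟩ := AnalyticAt.exists_dividedDifference h𝓕
    set c : ℝ × V := (0, U₀) with hc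
    have hinj : Function.Injective (ContinuousLinearMap.id ℝ V - M).toLinearMap := by
      rw [← LinearMap.ker_eq_bot, LinearMap.ker_eq_bot']
      intro a ha
      refine hspec 1 le_rfl a ?_
      have : a - M a = 0 := ha
      simpa using (sub_eq_zero.1 this).symm
    -- W₀ is the first Taylor coefficient of U; solving for it uses that 1 is not an eigenvalue of
    -- M.
    obtain ⟨W₀, hW₀⟩ := LinearMap.surjective_of_injective hinj (fderiv ℝ 𝓕 c (1, 0))
    have hW₀' : W₀ - M W₀ = fderiv ℝ 𝓕 c (1, 0) := hW₀
    have hM𝓕 : ∀ h : V, fderiv ℝ 𝓕 c (0, h) = M h := by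
      intro h
      have d1 : HasFDerivAt (fun U : V => 𝓕 (0, U))
          (fderiv ℝ 𝓕 c ∘L ContinuousLinearMap.inr ℝ ℝ V) U₀ :=
        HasFDerivAt.comp (g := 𝓕) (f := fun U : V => ((0 : ℝ), U)) U₀
          h𝓕.differentiableAt.hasFDerivAt (ContinuousLinearMap.inr ℝ ℝ V).hasFDerivAt
      simpa using congrArg (fun L => L h) (d1.unique hM)
    -- This is 𝓕(t, U₀ + tW)/t - W for t ≠ 0; writing the quotient with the divided difference makes
    -- it analytic across t = 0.
    let 𝓕₁ : ℝ × V → V := fun z => K (c, c + z.1 • ((1 : ℝ), z.2)) ((1 : ℝ), z.2) - z.2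
    have h𝓕₁0 : ∀ W, 𝓕₁ (0, W) = fderiv ℝ 𝓕 c (1, 0) + (M - ContinuousLinearMap.id ℝ V) W := by
      intro W
      have : ((1 : ℝ), W) = (1, 0) + (0, W) := by simp
      simp only [𝓕₁, zero_smul, add_zero, hKc]
      rw [this, map_add, hM𝓕]
      simp only [sub_apply, ContinuousLinearMap.id_apply]
      abel
    have h𝓕₁an : AnalyticAt ℝ 𝓕₁ (0, W₀) := by
      have h1 : AnalyticAt ℝ (fun z : ℝ × V => K (c, c + z.1 • ((1 : ℝ), z.2))) (0, W₀) :=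
        hK.comp_of_eq (by fun_prop) (by simp)
      have h2 : AnalyticAt ℝ (fun z : ℝ × V => ((1 : ℝ), z.2)) (0, W₀) := by fun_prop
      exact (AnalyticAt.clm_apply h1 h2).sub analyticAt_snd
    obtain ⟨W, hWan, hW0, hWeq⟩ := ih 𝓕₁ W₀ (M - ContinuousLinearMap.id ℝ V) h𝓕₁an
      (by
        rw [h𝓕₁0, ← hW₀']
        simp)
      (by
        simp only [h𝓕₁0]
        exact (M - ContinuousLinearMap.id ℝ V).hasFDerivAt.const_add _)
      -- An eigenvalue k of M - 1 is an eigenvalue k + 1 of M, so the spectral hypothesis survives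
      -- the substitution.
      (fun k hk a ha => hspec (k + 1) (by omega) a (by
        have h1 : M a - a = (k : ℝ) • a := ha
        rw [sub_eq_iff_eq_add] at h1
        rw [h1]
        push_cast
        module))
      ⟨m, by
        convert hm using 2
        push_cast
        module⟩
    refine ⟨fun t => U₀ + t • W t, by fun_prop, by simp, ?_⟩
    have htend : Tendsto (fun t : ℝ => (c, c + t • ((1 : ℝ), W t))) (𝓝 0) (𝓝 (c, c)) := by
      have : ContinuousAt (fun t : ℝ => (c, c + t • ((1 : ℝ), W t))) 0 := by
        have := hWan.continuousAt
        fun_prop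
      simpa [ContinuousAt] using this
    filter_upwards [hWeq, htend.eventually hKeq, hWan.eventually_analyticAt] with t h1 h2 h3
    have d : HasDerivAt (fun t => U₀ + t • W t) (t • deriv W t + (1 : ℝ) • W t) t :=
      ((hasDerivAt_id t).smul h3.differentiableAt.hasDerivAt).const_add U₀
    rw [d.deriv]
    have e : c + t • ((1 : ℝ), W t) = (t, U₀ + t • W t) := by simp [hc]
    simp only [𝓕₁] at h1
    rw [e] at h1 h2
    rw [hc, h0, sub_zero, ← hc] at h2
    rw [h2, one_smul, h1, sub_add_cancel]
    have e2 : (t, U₀ + t • W t) - c = t • ((1 : ℝ), W t) := by simp [hc]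
    rw [e2, map_smul]

/-- Two analytic solutions of a Briot-Bouquet equation with the same initial value coincide, if
the linearization has no positive integer eigenvalue. -/
theorem briotBouquet_unique {𝓕 : ℝ × V → V} {U₀ : V} {M : V →L[ℝ] V}
    (h𝓕 : AnalyticAt ℝ 𝓕 (0, U₀))
    (hM : HasFDerivAt (fun U => 𝓕 (0, U)) M U₀)
    (hspec : ∀ k : ℕ, 1 ≤ k → ∀ a : V, M a = (k : ℝ) • a → a = 0)
    {U W : ℝ → V} (hU : AnalyticAt ℝ U 0) (hW : AnalyticAt ℝ W 0) (hU0 : U 0 = U₀) (hW0 : W 0 = U₀)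
    (hUeq : ∀ᶠ t in 𝓝[>] 0, t • deriv U t = 𝓕 (t, U t))
    (hWeq : ∀ᶠ t in 𝓝[>] 0, t • deriv W t = 𝓕 (t, W t)) : U =ᶠ[𝓝 0] W := by
  by_contra hne
  have hd : AnalyticAt ℝ (fun t => U t - W t) 0 := hU.sub hW
  have hne' : ¬ ∀ᶠ t in 𝓝 (0 : ℝ), U t - W t = 0 := fun h =>
    hne (h.mono fun t ht => sub_eq_zero.1 ht)
  -- If U - W = tᵏe with e(0) ≠ 0, subtracting the equations, dividing by tᵏ and letting t ↓ 0 gives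
  -- M e(0) = k e(0), which the spectral hypothesis forbids.
  obtain ⟨k, e, he, he0, heq⟩ := hd.exists_eventuallyEq_pow_smul_nonzero_iff.2 hne'
  simp only [sub_zero] at heq
  obtain ⟨K, hK, hKc, hKeq⟩ := AnalyticAt.exists_dividedDifference h𝓕
  have hk : 1 ≤ k := by
    rcases Nat.eq_zero_or_pos k with rfl | h
    · have := heq.self_of_nhds
      simp [hU0, hW0] at this
      exact absurd this.symm he0
    · exact h
  set c : ℝ × V := (0, U₀) with hc
  have hzcont : ContinuousAt (fun t : ℝ => (((t, W t), (t, U t)) : (ℝ × V) × (ℝ × V))) 0 := by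
    have := hU.continuousAt
    have := hW.continuousAt
    fun_prop
  have hz0 : (((0 : ℝ), W 0), ((0 : ℝ), U 0)) = (c, c) := by simp [hU0, hW0, hc]
  have htend : Tendsto (fun t : ℝ => (((t, W t), (t, U t)) : (ℝ × V) × (ℝ × V))) (𝓝 0)
      (𝓝 (c, c)) := by
    rw [← hz0]; exact hzcont
  have hKt : Tendsto (fun t : ℝ => K ((t, W t), (t, U t)) ((0 : ℝ), e t)) (𝓝[>] 0)
      (𝓝 (fderiv ℝ 𝓕 c (0, e 0))) := by
    have h1 : Tendsto (fun t : ℝ => K ((t, W t), (t, U t))) (𝓝 0) (𝓝 (fderiv ℝ 𝓕 c)) := by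
      rw [← hKc]; exact hK.continuousAt.tendsto.comp htend
    have h2 : Tendsto (fun t : ℝ => ((0 : ℝ), e t)) (𝓝 0) (𝓝 ((0 : ℝ), e 0)) :=
      tendsto_const_nhds.prodMk_nhds he.continuousAt
    exact ((isBoundedBilinearMap_apply.continuous.tendsto _).comp
      (h1.prodMk_nhds h2)).mono_left nhdsWithin_le_nhds
  have hlhs : Tendsto (fun t : ℝ => t • deriv e t + (k : ℝ) • e t) (𝓝[>] 0)
      (𝓝 ((k : ℝ) • e 0)) := by
    have : ContinuousAt (fun t : ℝ => t • deriv e t + (k : ℝ) • e t) 0 := by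
      have h1 := he.deriv.continuousAt
      have h2 := he.continuousAt
      fun_prop
    have h := this.tendsto
    simp only [zero_smul, zero_add] at h
    exact h.mono_left nhdsWithin_le_nhds
  have hev : (fun t : ℝ => t • deriv e t + (k : ℝ) • e t)
      =ᶠ[𝓝[>] 0] fun t : ℝ => K ((t, W t), (t, U t)) ((0 : ℝ), e t) := by
    filter_upwards [hUeq, hWeq, (htend.eventually hKeq).filter_mono nhdsWithin_le_nhds,
      heq.eventually_nhds.filter_mono nhdsWithin_le_nhds,
      he.eventually_analyticAt.filter_mono nhdsWithin_le_nhds,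
      hU.eventually_analyticAt.filter_mono nhdsWithin_le_nhds,
      hW.eventually_analyticAt.filter_mono nhdsWithin_le_nhds, self_mem_nhdsWithin]
      with t h1 h2 h3 h4 h5 h6 h7 ht
    have ht0 : t ≠ 0 := ne_of_gt ht
    have d1 : HasDerivAt (fun s => U s - W s) (deriv U t - deriv W t) t :=
      h6.differentiableAt.hasDerivAt.sub h7.differentiableAt.hasDerivAt
    have d2 : HasDerivAt (fun s => s ^ k • e s)
        (t ^ k • deriv e t + ((k : ℝ) * t ^ (k - 1)) • e t) t := by
      simpa using (hasDerivAt_pow k t).fun_smul h5.differentiableAt.hasDerivAt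
    have d3 := d1.unique (d2.congr_of_eventuallyEq h4)
    have h8 : (((t, U t), (t, W t)).1 - ((t, U t), (t, W t)).2 : ℝ × V) = (0, t ^ k • e t) := by
      simp [h4.self_of_nhds]
    simp only at h3 h8
    rw [h8] at h3
    have h9 : t • (deriv U t - deriv W t) = K ((t, W t), (t, U t)) (0, t ^ k • e t) := by
      rw [smul_sub, h1, h2, h3]
    have h10 : ((0 : ℝ), t ^ k • e t) = t ^ k • ((0 : ℝ), e t) := by simp
    rw [d3, h10, map_smul] at h9
    apply smul_right_injective V (pow_ne_zero k ht0)
    simp only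
    rw [← h9, smul_add, smul_add, smul_smul, smul_smul, smul_smul, smul_smul]
    obtain ⟨j, rfl⟩ : ∃ j, k = j + 1 := ⟨k - 1, by omega⟩
    simp only [Nat.add_sub_cancel]
    congr 2 <;> ring
  have hfin := tendsto_nhds_unique (hlhs.congr' hev) hKt
  have hM𝓕 : fderiv ℝ 𝓕 c (0, e 0) = M (e 0) := by
    have d1 : HasFDerivAt (fun U : V => 𝓕 (0, U))
        (fderiv ℝ 𝓕 c ∘L ContinuousLinearMap.inr ℝ ℝ V) U₀ :=
      HasFDerivAt.comp (g := 𝓕) (f := fun U : V => ((0 : ℝ), U)) U₀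
        h𝓕.differentiableAt.hasFDerivAt (ContinuousLinearMap.inr ℝ ℝ V).hasFDerivAt
    simpa using congrArg (fun L => L (e 0)) (d1.unique hM)
  exact he0 (hspec k hk _ (by rw [hfin, hM𝓕]))

end BriotBouquet

/-! ### Singular second order systems in Briot-Bouquet form -/

section SecondOrder

variable {E : Type*} [NormedAddCommGroup E] [NormedSpace ℝ E]

/-- The system `x' = 2y`, `y' = A(x)/t² + B(x,y)/t + C(t,x,y)` at time `t`. -/
def SingularEq (A : E → E) (B : E → E → E) (C : ℝ → E → E → E) (x : ℝ → E) (t : ℝ) : Prop :=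
  (1 / 2 : ℝ) • deriv (deriv x) t = (1 / t ^ 2) • A (x t)
    + (1 / t) • B (x t) ((1 / 2 : ℝ) • deriv x t) + C t (x t) ((1 / 2 : ℝ) • deriv x t)

/-- The hypotheses on a singular system under which solutions near `t = 0` are governed by
`𝓛₀`: the operators `𝓛ₘ` with `m ≥ 1` are injective. -/
structure SingularSystem (A : E → E) (B : E → E → E) (C : ℝ → E → E → E) (x₀ : E)
    (A' B' : E →L[ℝ] E) : Prop where
  analyticA : AnalyticAt ℝ A x₀
  fderivA : fderiv ℝ A x₀ = A'
  zeroA : A x₀ = 0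
  analyticB : ∀ y, AnalyticAt ℝ (fun z : E × E => B z.1 z.2) (x₀, y)
  smulB : ∀ x y (s : ℝ), B x (s • y) = s • B x y
  baseB : ∀ y, B x₀ y = B' y
  analyticC : AnalyticAt ℝ (fun z : ℝ × E × E => C z.1 z.2.1 z.2.2) (0, x₀, 0)
  injective : ∀ k : ℕ, 1 ≤ k → ∀ a : E,
    ((k : ℝ) + 1) • a - (2 / ((k : ℝ) + 2)) • A' a - B' a = 0 → a = 0

/-- The right-hand side of the Briot-Bouquet form of a singular second order system; `K` is the
divided difference of `A`. -/
def briotBouquetRhs (K : E × E → E →L[ℝ] E) (B : E → E → E) (C : ℝ → E → E → E) (x₀ : E)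
    (z : ℝ × E × E) : E × E :=
  (z.2.2, (2 : ℝ) • (K (x₀, x₀ + z.1 ^ 2 • z.2.1) z.2.1
      + B (x₀ + z.1 ^ 2 • z.2.1) (z.2.1 + (1 / 2 : ℝ) • z.2.2)
      + C z.1 (x₀ + z.1 ^ 2 • z.2.1) (z.1 • (z.2.1 + (1 / 2 : ℝ) • z.2.2)) - z.2.1)
    - (3 : ℝ) • z.2.2)

variable {A : E → E} {B : E → E → E} {C : ℝ → E → E → E} {x₀ : E} {A' B' : E →L[ℝ] E}
  {K : E × E → E →L[ℝ] E}

theorem analyticAt_briotBouquetRhs [CompleteSpace E] (h : SingularSystem A B C x₀ A' B')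
    (hK : AnalyticAt ℝ K (x₀, x₀)) (U : E × E) :
    AnalyticAt ℝ (briotBouquetRhs K B C x₀) (0, U) := by
  have e1 : AnalyticAt ℝ (fun z : ℝ × E × E => x₀ + z.1 ^ 2 • z.2.1) (0, U) := by fun_prop
  have e2 : AnalyticAt ℝ (fun z : ℝ × E × E => z.2.1 + (1 / 2 : ℝ) • z.2.2) (0, U) := by fun_prop
  have e3 : AnalyticAt ℝ (fun z : ℝ × E × E => K (x₀, x₀ + z.1 ^ 2 • z.2.1)) (0, U) :=
    hK.comp_of_eq (analyticAt_const.prod e1) (by simp)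
  have e4 : AnalyticAt ℝ (fun z : ℝ × E × E => K (x₀, x₀ + z.1 ^ 2 • z.2.1) z.2.1) (0, U) :=
    AnalyticAt.clm_apply e3 (by fun_prop)
  have e5 : AnalyticAt ℝ (fun z : ℝ × E × E => B (x₀ + z.1 ^ 2 • z.2.1)
      (z.2.1 + (1 / 2 : ℝ) • z.2.2)) (0, U) :=
    AnalyticAt.comp_of_eq (g := fun z : E × E => B z.1 z.2) (h.analyticB (U.1 + (1 / 2 : ℝ) • U.2)) (e1.prod e2)
      (by simp)
  have e6 : AnalyticAt ℝ (fun z : ℝ × E × E => C z.1 (x₀ + z.1 ^ 2 • z.2.1)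
      (z.1 • (z.2.1 + (1 / 2 : ℝ) • z.2.2))) (0, U) :=
    AnalyticAt.comp_of_eq (g := fun z : ℝ × E × E => C z.1 z.2.1 z.2.2) h.analyticC
      (analyticAt_fst.prod (e1.prod (analyticAt_fst.smul e2))) (by simp)
  have e7 : AnalyticAt ℝ (fun z : ℝ × E × E => z.2.1) (0, U) := by fun_prop
  have e8 : AnalyticAt ℝ (fun z : ℝ × E × E => z.2.2) (0, U) := by fun_prop
  exact e8.prod ((analyticAt_const.smul (((e4.add e5).add e6).sub e7)).sub
    (analyticAt_const.smul e8))

/-- The linearization of the Briot-Bouquet form. -/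
def briotBouquetLin (A' B' : E →L[ℝ] E) : E × E →L[ℝ] E × E :=
  (ContinuousLinearMap.snd ℝ E E).prod
    ((2 : ℝ) • (A' ∘L ContinuousLinearMap.fst ℝ E E
        + B' ∘L (ContinuousLinearMap.fst ℝ E E + (1 / 2 : ℝ) • ContinuousLinearMap.snd ℝ E E)
        - ContinuousLinearMap.fst ℝ E E)
      - (3 : ℝ) • ContinuousLinearMap.snd ℝ E E)

/-- At t = 0 the coefficients are frozen at x₀, where B is linear in y, so the right-hand side is
affine in U. Its linearization is therefore the same at every initial value. -/
theorem briotBouquetRhs_zero (h : SingularSystem A B C x₀ A' B') (hK : K (x₀, x₀) = A')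
    (U : E × E) : briotBouquetRhs K B C x₀ (0, U) =
      (0, (2 : ℝ) • C 0 x₀ 0) + briotBouquetLin A' B' U := by
  ext
  · simp [briotBouquetRhs, briotBouquetLin]
  · simp only [briotBouquetRhs, briotBouquetLin, hK, h.baseB, ne_eq, OfNat.ofNat_ne_zero,
      not_false_eq_true, zero_pow, zero_smul, add_zero, Prod.snd_add,
      ContinuousLinearMap.prod_apply, sub_apply, add_apply, smul_apply,
      ContinuousLinearMap.comp_apply, ContinuousLinearMap.coe_fst', ContinuousLinearMap.coe_snd']
    module

theorem hasFDerivAt_briotBouquetRhs (h : SingularSystem A B C x₀ A' B') (hK : K (x₀, x₀) = A')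
    (U : E × E) :
    HasFDerivAt (fun U => briotBouquetRhs K B C x₀ (0, U)) (briotBouquetLin A' B') U := by
  simp only [briotBouquetRhs_zero h hK]
  exact (briotBouquetLin A' B').hasFDerivAt.const_add _

/-- An eigenvector for k has the form (a, ka), and its second component is -2(k + 2) times 𝓛ₖ a up
to the common scaling of the equation; hence a lies in the kernel of 𝓛ₖ. -/
theorem briotBouquetLin_spec (h : SingularSystem A B C x₀ A' B') (k : ℕ) (hk : 1 ≤ k)
    (U : E × E) (hU : briotBouquetLin A' B' U = (k : ℝ) • U) : U = 0 := by
  obtain ⟨a, b⟩ := U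
  have h1 : b = (k : ℝ) • a := congrArg Prod.fst hU
  have h2 : (2 : ℝ) • (A' a + B' (a + (1 / 2 : ℝ) • b) - a) - (3 : ℝ) • b = (k : ℝ) • b :=
    congrArg Prod.snd hU
  have hk2 : ((k : ℝ) + 2) ≠ 0 := by positivity
  have ha : a = 0 := by
    refine h.injective k hk a ?_
    apply smul_right_injective E hk2
    simp only
    rw [h1, map_add, map_smul, map_smul] at h2
    rw [smul_zero, smul_sub, smul_sub, smul_smul, smul_smul, mul_div_cancel₀ _ hk2]
    rw [← sub_eq_zero] at h2
    rw [← neg_eq_zero, ← h2]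
    module
  simp [h1, ha]

/-- With q = t u' one has y = t(u + q/2) and y' = u + 3q/2 + t q'/2, while A(x)/t² = K u. The first
component of the Briot-Bouquet equation is the definition of q. -/
theorem singularEq_iff (h : SingularSystem A B C x₀ A' B') {u : ℝ → E} {t : ℝ} (ht : t ≠ 0)
    (hu : AnalyticAt ℝ u t) [CompleteSpace E]
    (hK : A (x₀ + t ^ 2 • u t) - A x₀ = K (x₀, x₀ + t ^ 2 • u t) (x₀ + t ^ 2 • u t - x₀)) :
    SingularEq A B C (fun s => x₀ + s ^ 2 • u s) t ↔
      t • deriv (fun s => (u s, s • deriv u s)) t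
        = briotBouquetRhs K B C x₀ (t, u t, t • deriv u t) := by
  have d1 : ∀ s, AnalyticAt ℝ u s → HasDerivAt (fun s => x₀ + s ^ 2 • u s)
      ((2 * s) • u s + s ^ 2 • deriv u s) s := fun s hs => by
    have := ((hasDerivAt_pow 2 s).fun_smul hs.differentiableAt.hasDerivAt).const_add x₀
    convert this using 1
    simp [add_comm]
  have d2 : deriv (fun s => x₀ + s ^ 2 • u s) =ᶠ[𝓝 t]
      fun s => (2 * s) • u s + s ^ 2 • deriv u s := by
    filter_upwards [hu.eventually_analyticAt] with s hs using (d1 s hs).deriv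
  have du := hu.differentiableAt.hasDerivAt
  have ddu := hu.deriv.differentiableAt.hasDerivAt
  have d3 : HasDerivAt (fun s => (2 * s) • u s + s ^ 2 • deriv u s)
      ((2 * t) • deriv u t + (2 : ℝ) • u t
        + (t ^ 2 • deriv (deriv u) t + (2 * t) • deriv u t)) t := by
    have e1 := ((hasDerivAt_id t).const_mul 2).fun_smul du
    have e2 := (hasDerivAt_pow 2 t).fun_smul ddu
    have e3 := e1.fun_add e2
    simp only [id, mul_one, Nat.cast_ofNat, Nat.add_one_sub_one, pow_one] at e3
    exact e3
  have d4 : HasDerivAt (fun s => (u s, s • deriv u s))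
      (deriv u t, t • deriv (deriv u) t + deriv u t) t := by
    have := du.prodMk ((hasDerivAt_id t).fun_smul ddu)
    simpa using this
  have e1 : deriv (fun s => x₀ + s ^ 2 • u s) t = (2 * t) • u t + t ^ 2 • deriv u t :=
    (d1 t hu).deriv
  have e2 : deriv (deriv (fun s => x₀ + s ^ 2 • u s)) t = _ := d2.deriv_eq.trans d3.deriv
  have e3 : (1 / 2 : ℝ) • ((2 * t) • u t + t ^ 2 • deriv u t)
      = t • (u t + (1 / 2 : ℝ) • t • deriv u t) := by module
  have e4 : A (x₀ + t ^ 2 • u t) = t ^ 2 • K (x₀, x₀ + t ^ 2 • u t) (u t) := by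
    rw [h.zeroA, sub_zero, add_sub_cancel_left, map_smul] at hK
    exact hK
  have ht2 : t ^ 2 ≠ 0 := pow_ne_zero 2 ht
  unfold SingularEq
  rw [d4.deriv, e2, e1, e3, e4, h.smulB, smul_smul, smul_smul, one_div_mul_cancel ht2,
    one_div_mul_cancel ht, one_smul, one_smul]
  unfold briotBouquetRhs
  rw [Prod.smul_mk, Prod.mk.injEq]
  simp only [true_and]
  set R := K (x₀, x₀ + t ^ 2 • u t) (u t) + B (x₀ + t ^ 2 • u t) (u t + (1 / 2 : ℝ) • t • deriv u t)
    + C t (x₀ + t ^ 2 • u t) (t • (u t + (1 / 2 : ℝ) • t • deriv u t)) with hR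
  constructor
  · intro hh
    rw [← hh]
    module
  · intro hh
    have : R = (1 / 2 : ℝ) • (t • (t • deriv (deriv u) t + deriv u t) + (3 : ℝ) • t • deriv u t)
        + u t := by
      rw [hh]; module
    rw [this]
    module

theorem SingularSystem.eventually_dividedDifference (u : ℝ → E) (hu : AnalyticAt ℝ u 0)
    (hKeq : ∀ᶠ z in 𝓝 (x₀, x₀), A z.2 - A z.1 = K z (z.2 - z.1)) :
    ∀ᶠ t : ℝ in 𝓝 0, A (x₀ + t ^ 2 • u t) - A x₀
      = K (x₀, x₀ + t ^ 2 • u t) (x₀ + t ^ 2 • u t - x₀) := by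
  have : Tendsto (fun t : ℝ => (x₀, x₀ + t ^ 2 • u t)) (𝓝 0) (𝓝 (x₀, x₀)) := by
    have hc : ContinuousAt (fun t : ℝ => (x₀, x₀ + t ^ 2 • u t)) 0 := by
      have := hu.continuousAt
      fun_prop
    simpa [ContinuousAt] using hc
  exact this.eventually hKeq

/-- Every solution of the linear equation for the second order coefficient extends to an analytic
solution. -/
theorem SingularSystem.exists_solution [FiniteDimensional ℝ E] [CompleteSpace E] (h : SingularSystem A B C x₀ A' B')
    {u₀ : E} (hu₀ : u₀ - A' u₀ - B' u₀ = C 0 x₀ 0) :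
    ∃ u : ℝ → E, AnalyticAt ℝ u 0 ∧ u 0 = u₀ ∧
      ∀ᶠ t in 𝓝[>] 0, SingularEq A B C (fun s => x₀ + s ^ 2 • u s) t := by
  obtain ⟨K, hK, hKc, hKeq⟩ := AnalyticAt.exists_dividedDifference h.analyticA
  rw [h.fderivA] at hKc
  obtain ⟨U, hU, hU0, hUeq⟩ := exists_briotBouquet (U₀ := (u₀, (0 : E)))
    (analyticAt_briotBouquetRhs h hK _)
    (by
      rw [briotBouquetRhs_zero h hKc, ← hu₀]
      ext
      · simp [briotBouquetLin]
      · simp only [briotBouquetLin, Prod.snd_add, ContinuousLinearMap.prod_apply, sub_apply,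
          add_apply, smul_apply, ContinuousLinearMap.coe_fst', ContinuousLinearMap.coe_snd',
          ContinuousLinearMap.coe_comp, Function.comp_apply, smul_zero, add_zero, Prod.snd_zero]
        module)
    (hasFDerivAt_briotBouquetRhs h hKc _) (briotBouquetLin_spec h)
  have hu : AnalyticAt ℝ (fun t => (U t).1) 0 := analyticAt_fst.comp hU
  refine ⟨fun t => (U t).1, hu, by simp [hU0], ?_⟩
  -- The first component of the equation forces the second component of U to be t u'.
  have hq : ∀ᶠ t in 𝓝 (0 : ℝ), U t = ((U t).1, t • deriv (fun s => (U s).1) t) := by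
    filter_upwards [hUeq, hU.eventually_analyticAt] with t h1 h2
    have h3 : HasDerivAt (fun s => (U s).1) (deriv U t).1 t :=
      (ContinuousLinearMap.fst ℝ E E).hasFDerivAt.comp_hasDerivAt t h2.differentiableAt.hasDerivAt
    have h4 : t • (deriv U t).1 = (U t).2 := congrArg Prod.fst h1
    rw [h3.deriv, h4]
  filter_upwards [(SingularSystem.eventually_dividedDifference _ hu hKeq).filter_mono
      nhdsWithin_le_nhds, hUeq.filter_mono nhdsWithin_le_nhds,
    hq.eventually_nhds.filter_mono nhdsWithin_le_nhds,
    hu.eventually_analyticAt.filter_mono nhdsWithin_le_nhds, self_mem_nhdsWithin] with t h1 h2 h3 h4 ht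
  rw [singularEq_iff h (ne_of_gt ht) h4 h1]
  have h5 : U =ᶠ[𝓝 t] fun t => ((U t).1, t • deriv (fun s => (U s).1) t) := h3
  rw [← h5.deriv_eq, h2]
  conv_lhs => rw [h3.self_of_nhds]

/-- The Briot-Bouquet form of a solution. -/
theorem SingularSystem.eventually_briotBouquet [CompleteSpace E]
    (h : SingularSystem A B C x₀ A' B')
    (hKeq : ∀ᶠ z in 𝓝 (x₀, x₀), A z.2 - A z.1 = K z (z.2 - z.1))
    {u : ℝ → E} (hu : AnalyticAt ℝ u 0)
    (hsol : ∀ᶠ t in 𝓝[>] 0, SingularEq A B C (fun s => x₀ + s ^ 2 • u s) t) :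
    ∀ᶠ t in 𝓝[>] 0, t • deriv (fun s => (u s, s • deriv u s)) t
      = briotBouquetRhs K B C x₀ (t, u t, t • deriv u t) := by
  filter_upwards [hsol, (SingularSystem.eventually_dividedDifference u hu hKeq).filter_mono
      nhdsWithin_le_nhds, hu.eventually_analyticAt.filter_mono nhdsWithin_le_nhds,
    self_mem_nhdsWithin] with t h1 h2 h3 ht
  exact (singularEq_iff h (ne_of_gt ht) h3 h2).1 h1

/-- As t ↓ 0 the left side t U' of the Briot-Bouquet equation tends to 0, so (u(0), 0) is a zero of
the right side. -/
theorem SingularSystem.second_coeff [CompleteSpace E] (h : SingularSystem A B C x₀ A' B')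
    {u : ℝ → E} (hu : AnalyticAt ℝ u 0)
    (hsol : ∀ᶠ t in 𝓝[>] 0, SingularEq A B C (fun s => x₀ + s ^ 2 • u s) t) :
    u 0 - A' (u 0) - B' (u 0) = C 0 x₀ 0 := by
  obtain ⟨K, hK, hKc, hKeq⟩ := AnalyticAt.exists_dividedDifference h.analyticA
  rw [h.fderivA] at hKc
  have hbb := h.eventually_briotBouquet hKeq hu hsol
  have hU : AnalyticAt ℝ (fun s => (u s, s • deriv u s)) 0 :=
    hu.prod (analyticAt_id.smul hu.deriv)
  have hl : Tendsto (fun t : ℝ => t • deriv (fun s => (u s, s • deriv u s)) t) (𝓝[>] 0) (𝓝 0) := by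
    have : ContinuousAt (fun t : ℝ => t • deriv (fun s => (u s, s • deriv u s)) t) 0 := by
      have := hU.deriv.continuousAt
      fun_prop
    have h1 := this.tendsto
    rw [zero_smul] at h1
    exact h1.mono_left nhdsWithin_le_nhds
  have hr : Tendsto (fun t : ℝ => briotBouquetRhs K B C x₀ (t, u t, t • deriv u t)) (𝓝[>] 0)
      (𝓝 (briotBouquetRhs K B C x₀ (0, u 0, 0))) := by
    have h1 : Tendsto (fun t : ℝ => (t, u t, t • deriv u t)) (𝓝 0) (𝓝 (0, u 0, 0)) := by
      have : ContinuousAt (fun t : ℝ => (t, u t, t • deriv u t)) 0 := by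
        have := hu.deriv.continuousAt
        have := hu.continuousAt
        fun_prop
      simpa [ContinuousAt] using this
    exact ((analyticAt_briotBouquetRhs h hK (u 0, 0)).continuousAt.tendsto.comp h1).mono_left
      nhdsWithin_le_nhds
  have h2 := tendsto_nhds_unique (hl.congr' hbb) hr
  rw [briotBouquetRhs_zero h hKc] at h2
  have h3 : 0 = (2 : ℝ) • C 0 x₀ 0 + ((2 : ℝ) • (A' (u 0) + B' (u 0 + (1 / 2 : ℝ) • (0 : E)) - u 0)
      - (3 : ℝ) • (0 : E)) := congrArg Prod.snd h2
  rw [smul_zero, smul_zero, add_zero, sub_zero, ← smul_add, eq_comm, smul_eq_zero] at h3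
  have h4 := h3.resolve_left two_ne_zero
  rw [add_eq_zero_iff_eq_neg] at h4
  rw [h4]
  abel

theorem SingularSystem.unique [CompleteSpace E] (h : SingularSystem A B C x₀ A' B')
    {u w : ℝ → E} (hu : AnalyticAt ℝ u 0) (hw : AnalyticAt ℝ w 0) (huw : u 0 = w 0)
    (husol : ∀ᶠ t in 𝓝[>] 0, SingularEq A B C (fun s => x₀ + s ^ 2 • u s) t)
    (hwsol : ∀ᶠ t in 𝓝[>] 0, SingularEq A B C (fun s => x₀ + s ^ 2 • w s) t) :
    u =ᶠ[𝓝 0] w := by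
  obtain ⟨K, hK, hKc, hKeq⟩ := AnalyticAt.exists_dividedDifference h.analyticA
  rw [h.fderivA] at hKc
  have := briotBouquet_unique (U₀ := (u 0, (0 : E))) (analyticAt_briotBouquetRhs h hK _)
    (hasFDerivAt_briotBouquetRhs h hKc _) (briotBouquetLin_spec h)
    (U := fun s => (u s, s • deriv u s)) (W := fun s => (w s, s • deriv w s))
    (hu.prod (analyticAt_id.smul hu.deriv)) (hw.prod (analyticAt_id.smul hw.deriv))
    (by simp) (by simp [huw])
    (h.eventually_briotBouquet hKeq hu husol) (h.eventually_briotBouquet hKeq hw hwsol)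
  exact this.mono fun t ht => congrArg Prod.fst ht

end SecondOrder

/-! ### Germs of solutions at a singular end -/

section Germs

/-- The left-hand side of the `k`-th equation. -/
def lhs (n : ℝ) (a b : Fin 5 → ℝ) (c : ℝ) (k : Fin 5) : ℝ :=
  ![lhs1 n (a 0) (a 1) (a 2) (a 3) (a 4) (b 0) (b 1) (b 2) (b 3) (b 4) c,
    lhs2 n (a 0) (a 1) (a 2) (a 3) (a 4) (b 0) (b 1) (b 2) (b 3) (b 4) c,
    lhs3 n (a 0) (a 1) (a 2) (a 3) (a 4) (b 0) (b 1) (b 2) (b 3) (b 4) c,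
    lhs4 n (a 0) (a 1) (a 2) (a 3) (a 4) (b 0) (b 1) (b 2) (b 3) (b 4) c,
    lhs5 n (a 0) (a 1) (a 2) (a 3) (a 4) (b 0) (b 1) (b 2) (b 3) (b 4) c] k

/-- The five equations at time `t`. -/
def EqAt (n : ℕ) (lam : ℝ) (f : Fin 5 → ℝ → ℝ) (t : ℝ) : Prop :=
  ∀ k, lhs n (fun i => f i t) (fun i => deriv (f i) t) (iteratedDeriv 2 (f k) t) k = -lam

theorem isSolutionOn_iff {n : ℕ} {lam : ℝ} {s : Set ℝ} {f : Fin 5 → ℝ → ℝ} :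
    IsSolutionOn n lam s f ↔ (∀ i, AnalyticOn ℝ (f i) s) ∧ (∀ i, ∀ t ∈ interior s, 0 < f i t) ∧
      ∀ t ∈ interior s, EqAt n lam f t := by
  constructor
  · rintro ⟨h1, h2, e1, e2, e3, e4, e5⟩
    refine ⟨h1, h2, fun t ht k => ?_⟩
    fin_cases k
    exacts [e1 t ht, e2 t ht, e3 t ht, e4 t ht, e5 t ht]
  · rintro ⟨h1, h2, e⟩
    exact ⟨h1, h2, fun t ht => e t ht 0, fun t ht => e t ht 1, fun t ht => e t ht 2,
      fun t ht => e t ht 3, fun t ht => e t ht 4⟩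

theorem eqAt_congr {n : ℕ} {lam : ℝ} {f g : Fin 5 → ℝ → ℝ} {t : ℝ}
    (h : ∀ i, f i =ᶠ[𝓝 t] g i) : EqAt n lam f t ↔ EqAt n lam g t := by
  have h1 : (fun i => f i t) = fun i => g i t := funext fun i => (h i).self_of_nhds
  have h2 : (fun i => deriv (f i) t) = fun i => deriv (g i) t := funext fun i => (h i).deriv_eq
  have h3 : ∀ k, iteratedDeriv 2 (f k) t = iteratedDeriv 2 (g k) t := fun k =>
    (h k).iteratedDeriv_eq 2
  simp only [EqAt, h1, h2, h3]

/-- The equations for `f`, written in terms of `x` and `y`, where `fᵢ = t ^ σᵢ √xᵢ`, form the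
singular system with coefficients `A`, `B`, `C`. -/
def Reduces (n : ℕ) (lam : ℝ) (σ : Fin 5 → ℕ) (A : (Fin 5 → ℝ) → Fin 5 → ℝ)
    (B : (Fin 5 → ℝ) → (Fin 5 → ℝ) → Fin 5 → ℝ)
    (C : ℝ → (Fin 5 → ℝ) → (Fin 5 → ℝ) → Fin 5 → ℝ) : Prop :=
  ∀ t : ℝ, 0 < t → ∀ x y : Fin 5 → ℝ, (∀ i, 0 < x i) → ∀ a b : Fin 5 → ℝ,
    (∀ i, a i ^ 2 = t ^ (2 * σ i) * x i) → (∀ i, b i / a i = σ i / t + y i / x i) →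
    ∀ k z c, c / a k = z / x k - y k ^ 2 / x k ^ 2 + 2 * σ k * (y k / (t * x k)) →
      (lhs n a b c k = -lam ↔
        z = (1 / t ^ 2) * A x k + (1 / t) * B x y k + C t x y k)

/-- Solutions `fᵢ = t ^ σᵢ Hᵢ` near a singular end `t = 0`, with leading coefficients `α`. -/
structure IsGerm (n : ℕ) (lam : ℝ) (σ : Fin 5 → ℕ) (α : Fin 5 → ℝ) (H : Fin 5 → ℝ → ℝ) :
    Prop where
  analytic : ∀ i, AnalyticAt ℝ (H i) 0
  value : ∀ i, H i 0 = α i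
  deriv_zero : ∀ i, deriv (H i) 0 = 0
  eq : ∀ᶠ t in 𝓝[>] 0, EqAt n lam (fun i s => s ^ σ i * H i s) t

/-- The squares of the functions `Hᵢ`. -/
def squares (H : Fin 5 → ℝ → ℝ) (t : ℝ) : Fin 5 → ℝ := fun i => H i t ^ 2

variable {n : ℕ} {lam : ℝ} {σ : Fin 5 → ℕ} {α : Fin 5 → ℝ}
  {A : (Fin 5 → ℝ) → Fin 5 → ℝ} {B : (Fin 5 → ℝ) → (Fin 5 → ℝ) → Fin 5 → ℝ}
  {C : ℝ → (Fin 5 → ℝ) → (Fin 5 → ℝ) → Fin 5 → ℝ}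

theorem deriv_squares {H : Fin 5 → ℝ → ℝ} {t : ℝ} (hH : ∀ i, AnalyticAt ℝ (H i) t) :
    deriv (squares H) t = fun i => 2 * (H i t * deriv (H i) t) := by
  refine (hasDerivAt_pi.2 fun i => ?_).deriv
  have := (hH i).differentiableAt.hasDerivAt.fun_pow 2
  simpa [squares, mul_assoc] using this

theorem deriv_deriv_squares {H : Fin 5 → ℝ → ℝ} {t : ℝ} (hH : ∀ i, AnalyticAt ℝ (H i) t) :
    deriv (deriv (squares H)) t
      = fun i => 2 * (deriv (H i) t ^ 2 + H i t * deriv (deriv (H i)) t) := by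
  have h1 : deriv (squares H) =ᶠ[𝓝 t] fun s i => 2 * (H i s * deriv (H i) s) := by
    have : ∀ᶠ s in 𝓝 t, ∀ i, AnalyticAt ℝ (H i) s :=
      eventually_all.2 fun i => (hH i).eventually_analyticAt
    filter_upwards [this] with s hs using deriv_squares hs
  rw [h1.deriv_eq]
  refine (hasDerivAt_pi.2 fun i => ?_).deriv
  have := ((hH i).differentiableAt.hasDerivAt.fun_mul
    (hH i).deriv.differentiableAt.hasDerivAt).const_mul 2
  simpa only [sq] using this

theorem analyticAt_squares {H : Fin 5 → ℝ → ℝ} {t : ℝ} (hH : ∀ i, AnalyticAt ℝ (H i) t) :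
    AnalyticAt ℝ (squares H) t :=
  analyticAt_pi_iff.2 fun i => (hH i).pow 2

/-- For x = H² one has y = HH' and y' = H'² + HH'', the values to which `Reduces` is applied. As σ ≤
1, the derivative of t^σ is the constant σ, so f'' has no term from a second derivative of t^σ. -/
theorem eqAt_iff_singularEq (hred : Reduces n lam σ A B C) (hσ : ∀ i, σ i ≤ 1)
    {H : Fin 5 → ℝ → ℝ} {t : ℝ} (ht : 0 < t) (hH : ∀ i, AnalyticAt ℝ (H i) t)
    (hpos : ∀ i, 0 < H i t) :
    EqAt n lam (fun i s => s ^ σ i * H i s) t ↔ SingularEq A B C (squares H) t := by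
  have hd1 : ∀ i, deriv (fun s => s ^ σ i * H i s) t
      = σ i * H i t + t ^ σ i * deriv (H i) t := by
    intro i
    have h := ((hasDerivAt_pow (σ i) t).fun_mul (hH i).differentiableAt.hasDerivAt).deriv
    rw [h]
    rcases Nat.le_one_iff_eq_zero_or_eq_one.1 (hσ i) with h0 | h0 <;> simp [h0]
  have hd2 : ∀ i, iteratedDeriv 2 (fun s => s ^ σ i * H i s) t
      = 2 * σ i * deriv (H i) t + t ^ σ i * deriv (deriv (H i)) t := by
    intro i
    rw [iteratedDeriv_succ, iteratedDeriv_one]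
    have h1 : deriv (fun s => s ^ σ i * H i s) =ᶠ[𝓝 t]
        fun s => σ i * H i s + s ^ σ i * deriv (H i) s := by
      filter_upwards [(hH i).eventually_analyticAt] with s hs
      have h := ((hasDerivAt_pow (σ i) s).fun_mul hs.differentiableAt.hasDerivAt).deriv
      rw [h]
      rcases Nat.le_one_iff_eq_zero_or_eq_one.1 (hσ i) with h0 | h0 <;> simp [h0]
    rw [h1.deriv_eq]
    have h2 := (((hH i).differentiableAt.hasDerivAt.const_mul (σ i : ℝ)).fun_add
      ((hasDerivAt_pow (σ i) t).fun_mul (hH i).deriv.differentiableAt.hasDerivAt)).deriv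
    rw [h2]
    rcases Nat.le_one_iff_eq_zero_or_eq_one.1 (hσ i) with h0 | h0 <;> simp [h0] ; ring
  have hmain := hred t ht (squares H t) (fun i => H i t * deriv (H i) t)
    (fun i => pow_pos (hpos i) 2) (fun i => t ^ σ i * H i t)
    (fun i => deriv (fun s => s ^ σ i * H i s) t)
    (fun i => by simp only [squares]; ring)
    (fun i => by
      have := (hpos i).ne'
      rw [hd1]
      simp only [squares]
      rcases Nat.le_one_iff_eq_zero_or_eq_one.1 (hσ i) with h0 | h0
      · simp only [h0, Nat.cast_zero, pow_zero]; field_simp; simp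
      · simp only [h0, Nat.cast_one, pow_one]; field_simp)
  have hhalf : (1 / 2 : ℝ) • deriv (squares H) t = fun i => H i t * deriv (H i) t := by
    rw [deriv_squares hH]
    ext i
    simp
  unfold EqAt SingularEq
  rw [hhalf, deriv_deriv_squares hH, funext_iff]
  refine forall_congr' fun k => ?_
  refine (hmain k (deriv (H k) t ^ 2 + H k t * deriv (deriv (H k)) t) _ ?_).trans ?_
  · have := (hpos k).ne'
    rw [hd2]
    simp only [squares]
    rcases Nat.le_one_iff_eq_zero_or_eq_one.1 (hσ k) with h0 | h0
    · simp only [h0, Nat.cast_zero, pow_zero]; field_simp; ring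
    · simp only [h0, Nat.cast_one, pow_one]; field_simp; ring
  · simp only [Pi.add_apply, Pi.smul_apply, smul_eq_mul]
    rw [← mul_assoc, one_div_mul_cancel (two_ne_zero' ℝ), one_mul]

/-- The second order coefficient of the squares of a germ. -/
theorem IsGerm.exists_quotient {H : Fin 5 → ℝ → ℝ} (hH : IsGerm n lam σ α H) :
    ∃ u : ℝ → Fin 5 → ℝ, AnalyticAt ℝ u 0 ∧
      squares H =ᶠ[𝓝 0] fun t => (fun i => α i ^ 2) + t ^ 2 • u t := by
  obtain ⟨u, hu, heq⟩ := (analyticAt_squares hH.analytic).exists_eventuallyEq_sum_add_pow_mul 2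
  refine ⟨u, hu, heq.mono fun t ht => ?_⟩
  have h1 : deriv (squares H) 0 = 0 := by
    rw [deriv_squares hH.analytic]
    ext i
    simp [hH.deriv_zero]
  have h2 : squares H 0 = fun i => α i ^ 2 := by
    ext i
    simp [squares, hH.value]
  rw [ht]
  simp [Finset.sum_range_succ, h1, h2]

/-- The factor 2 compares the two normalizations x₀ + t²u and x₀ + (t²/2)w. -/
theorem tendsto_second_coeff {x₀ : Fin 5 → ℝ} {x u : ℝ → Fin 5 → ℝ} (hu : AnalyticAt ℝ u 0)
    (h : x =ᶠ[𝓝[>] 0] fun t => x₀ + t ^ 2 • u t) :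
    Tendsto (fun t => (2 / t ^ 2) • (x t - x₀)) (𝓝[>] 0) (𝓝 ((2 : ℝ) • u 0)) := by
  have h1 : Tendsto (fun t => (2 : ℝ) • u t) (𝓝[>] 0) (𝓝 ((2 : ℝ) • u 0)) :=
    (hu.continuousAt.tendsto.const_smul (2 : ℝ)).mono_left nhdsWithin_le_nhds
  refine h1.congr' ?_
  filter_upwards [h, self_mem_nhdsWithin] with t ht ht0
  have : t ≠ 0 := ne_of_gt ht0
  rw [ht, add_sub_cancel_left, smul_smul]
  congr 1
  field_simp

theorem IsGerm.eventually_pos (hα : ∀ i, 0 < α i) {H : Fin 5 → ℝ → ℝ}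
    (hH : IsGerm n lam σ α H) : ∀ᶠ t in 𝓝 (0 : ℝ), ∀ i, 0 < H i t :=
  eventually_all.2 fun i => (hH.analytic i).continuousAt.tendsto.eventually_const_lt
    (by rw [hH.value]; exact hα i)

theorem IsGerm.eventually_analytic {H : Fin 5 → ℝ → ℝ}
    (hH : IsGerm n lam σ α H) : ∀ᶠ t in 𝓝 (0 : ℝ), ∀ i, AnalyticAt ℝ (H i) t :=
  eventually_all.2 fun i => (hH.analytic i).eventually_analyticAt

theorem singularEq_congr {E : Type*} [NormedAddCommGroup E] [NormedSpace ℝ E] {A : E → E}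
    {B : E → E → E} {C : ℝ → E → E → E} {x w : ℝ → E} {t : ℝ} (h : x =ᶠ[𝓝 t] w) :
    SingularEq A B C x t ↔ SingularEq A B C w t := by
  unfold SingularEq
  rw [h.self_of_nhds, h.deriv_eq, h.deriv.deriv_eq]

theorem IsGerm.eventually_singularEq (hred : Reduces n lam σ A B C) (hσ : ∀ i, σ i ≤ 1)
    (hα : ∀ i, 0 < α i) {H : Fin 5 → ℝ → ℝ} (hH : IsGerm n lam σ α H) {x : ℝ → Fin 5 → ℝ}
    (hx : squares H =ᶠ[𝓝 0] x) : ∀ᶠ t in 𝓝[>] 0, SingularEq A B C x t := by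
  filter_upwards [hH.eq, (hH.eventually_pos hα).filter_mono nhdsWithin_le_nhds,
    hH.eventually_analytic.filter_mono nhdsWithin_le_nhds,
    hx.eventually_nhds.filter_mono nhdsWithin_le_nhds, self_mem_nhdsWithin] with t h1 h2 h3 h4 ht
  rw [← singularEq_congr h4]
  exact (eqAt_iff_singularEq hred hσ ht h3 h2).1 h1

variable {A' B' : (Fin 5 → ℝ) →L[ℝ] Fin 5 → ℝ}

/-- The second order coefficient of a germ solves the linear equation for `𝓛₀`. -/
theorem IsGerm.second_coeff (hred : Reduces n lam σ A B C) (hσ : ∀ i, σ i ≤ 1)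
    (hα : ∀ i, 0 < α i) (hS : SingularSystem A B C (fun i => α i ^ 2) A' B')
    {H : Fin 5 → ℝ → ℝ} (hH : IsGerm n lam σ α H) :
    ∃ w, w - A' w - B' w = (2 : ℝ) • C 0 (fun i => α i ^ 2) 0 ∧
      Tendsto (fun t => (2 / t ^ 2) • (squares H t - fun i => α i ^ 2)) (𝓝[>] 0) (𝓝 w) := by
  obtain ⟨u, hu, heq⟩ := hH.exists_quotient
  refine ⟨(2 : ℝ) • u 0, ?_, tendsto_second_coeff hu (heq.filter_mono nhdsWithin_le_nhds)⟩
  rw [← hS.second_coeff hu (hH.eventually_singularEq hred hσ hα heq), map_smul, map_smul,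
    smul_sub, smul_sub]

/-- Every solution of the linear equation for `𝓛₀` is the second order coefficient of a germ. -/
theorem exists_isGerm (hred : Reduces n lam σ A B C) (hσ : ∀ i, σ i ≤ 1)
    (hα : ∀ i, 0 < α i) (hS : SingularSystem A B C (fun i => α i ^ 2) A' B')
    {w : Fin 5 → ℝ} (hw : w - A' w - B' w = (2 : ℝ) • C 0 (fun i => α i ^ 2) 0) :
    ∃ H, IsGerm n lam σ α H ∧
      Tendsto (fun t => (2 / t ^ 2) • (squares H t - fun i => α i ^ 2)) (𝓝[>] 0) (𝓝 w) := by
  obtain ⟨u, hu, hu0, hsol⟩ := hS.exists_solution (u₀ := (1 / 2 : ℝ) • w) (by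
    rw [map_smul, map_smul, ← smul_sub, ← smul_sub, hw, smul_smul]
    norm_num)
  let x : ℝ → Fin 5 → ℝ := fun t => (fun i => α i ^ 2) + t ^ 2 • u t
  have hx0 : x 0 = fun i => α i ^ 2 := by simp [x]
  have hx : AnalyticAt ℝ x 0 := by
    have : AnalyticAt ℝ (fun t : ℝ => t ^ 2 • u t) 0 := by fun_prop
    exact analyticAt_const.add this
  have hxi : ∀ i, AnalyticAt ℝ (fun t => x t i) 0 := fun i => analyticAt_pi_iff.1 hx i
  have hxpos : ∀ᶠ t in 𝓝 (0 : ℝ), ∀ i, 0 < x t i :=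
    eventually_all.2 fun i => (hxi i).continuousAt.tendsto.eventually_const_lt
      (by rw [hx0]; exact pow_pos (hα i) 2)
  -- The root is analytic at 0 because xᵢ(0) = αᵢ² > 0.
  let H : Fin 5 → ℝ → ℝ := fun i t => √(x t i)
  have hHan : ∀ i, AnalyticAt ℝ (H i) 0 := fun i => by
    have h0 : x 0 i ≠ 0 := by rw [hx0]; exact (pow_pos (hα i) 2).ne'
    have h1 : AnalyticAt ℝ (fun y : ℝ => √y) (x 0 i) := (Real.contDiffAt_sqrt h0).analyticAt
    exact AnalyticAt.comp_of_eq h1 (hxi i) rfl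
  have hsq : squares H =ᶠ[𝓝 0] x := by
    filter_upwards [hxpos] with t ht
    ext i
    exact Real.sq_sqrt (ht i).le
  have hval : ∀ i, H i 0 = α i := fun i => by
    simp only [H, hx0]
    exact Real.sqrt_sq (hα i).le
  have hHpos : ∀ᶠ t in 𝓝 (0 : ℝ), ∀ i, 0 < H i t := by
    filter_upwards [hxpos] with t ht i using Real.sqrt_pos.2 (ht i)
  have hHan' : ∀ᶠ t in 𝓝 (0 : ℝ), ∀ i, AnalyticAt ℝ (H i) t :=
    eventually_all.2 fun i => (hHan i).eventually_analyticAt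
  refine ⟨H, ⟨hHan, hval, fun i => ?_, ?_⟩, ?_⟩
  · have h1 : HasDerivAt x ((0 : ℝ) ^ 2 • deriv u 0 + (2 * (0 : ℝ)) • u 0) 0 := by
      have := ((hasDerivAt_pow 2 (0 : ℝ)).fun_smul hu.differentiableAt.hasDerivAt).const_add
        (fun i => α i ^ 2)
      have e : ((2 : ℕ) : ℝ) * (0 : ℝ) ^ (2 - 1) = 2 * 0 := by norm_num
      rw [e] at this
      exact this
    -- At 0 the derivative of x vanishes and equals 2HH' with H(0) = α ≠ 0, so H'(0) = 0.
    have h2 := deriv_squares hHan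
    rw [hsq.deriv_eq, h1.deriv] at h2
    have h3 := congrFun h2 i
    simp [hval, (hα i).ne'] at h3
    exact h3
  · filter_upwards [hsol, hHpos.filter_mono nhdsWithin_le_nhds,
      hHan'.filter_mono nhdsWithin_le_nhds,
      hsq.eventually_nhds.filter_mono nhdsWithin_le_nhds, self_mem_nhdsWithin] with t h1 h2 h3 h4 ht
    rw [eqAt_iff_singularEq hred hσ ht h3 h2]
    exact (singularEq_congr h4).2 h1
  · have := tendsto_second_coeff hu (hsq.filter_mono nhdsWithin_le_nhds)
    rwa [hu0, smul_smul, mul_one_div_cancel two_ne_zero, one_smul] at this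

/-- A germ is determined by its second order coefficient. -/
theorem IsGerm.unique (hred : Reduces n lam σ A B C) (hσ : ∀ i, σ i ≤ 1)
    (hα : ∀ i, 0 < α i) (hS : SingularSystem A B C (fun i => α i ^ 2) A' B')
    {H G : Fin 5 → ℝ → ℝ} (hH : IsGerm n lam σ α H) (hG : IsGerm n lam σ α G) {w : Fin 5 → ℝ}
    (hHw : Tendsto (fun t => (2 / t ^ 2) • (squares H t - fun i => α i ^ 2)) (𝓝[>] 0) (𝓝 w))
    (hGw : Tendsto (fun t => (2 / t ^ 2) • (squares G t - fun i => α i ^ 2)) (𝓝[>] 0) (𝓝 w)) :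
    ∀ i, H i =ᶠ[𝓝 0] G i := by
  obtain ⟨u, hu, hueq⟩ := hH.exists_quotient
  obtain ⟨v, hv, hveq⟩ := hG.exists_quotient
  have h1 := tendsto_nhds_unique hHw
    (tendsto_second_coeff hu (hueq.filter_mono nhdsWithin_le_nhds))
  have h2 := tendsto_nhds_unique hGw
    (tendsto_second_coeff hv (hveq.filter_mono nhdsWithin_le_nhds))
  have h3 : u 0 = v 0 := smul_right_injective _ (two_ne_zero' ℝ) (h1.symm.trans h2)
  have h4 := hS.unique hu hv h3 (hH.eventually_singularEq hred hσ hα hueq)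
    (hG.eventually_singularEq hred hσ hα hveq)
  intro i
  filter_upwards [hueq, hveq, h4, hH.eventually_pos hα, hG.eventually_pos hα]
    with t e1 e2 e3 p1 p2
  have h5 : squares H t = squares G t := by rw [e1, e2, e3]
  exact (pow_left_inj₀ (p1 i).le (p2 i).le two_ne_zero).1 (congrFun h5 i)

end Germs

/-! ### From germs to solutions on half-open intervals -/

section Ends

/-- The prescribed one-sided jet at `0`: `α, 0` if `σ = 0`, and `0, α, 0` if `σ = 1`. -/
def JetCond (s : Set ℝ) (σ : ℕ) (α : ℝ) (g : ℝ → ℝ) : Prop :=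
  (σ = 0 ∧ g 0 = α ∧ derivWithin g s 0 = 0) ∨
    (σ = 1 ∧ g 0 = 0 ∧ derivWithin g s 0 = α ∧ iteratedDerivWithin 2 g s 0 = 0)

theorem derivWithin_eq_of_eqOn {f G : ℝ → ℝ} {s : Set ℝ} {x : ℝ} (hs : UniqueDiffOn ℝ s)
    (hx : x ∈ s) (hG : AnalyticAt ℝ G x) (h : EqOn f G s) :
    derivWithin f s x = deriv G x ∧ iteratedDerivWithin 2 f s x = iteratedDeriv 2 G x := by
  constructor
  · rw [derivWithin_congr h (h hx), hG.differentiableAt.derivWithin (hs x hx)]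
  · rw [iteratedDerivWithin_congr h hx,
      iteratedDerivWithin_eq_iteratedDeriv hs hG.contDiffAt hx]

theorem jetCond_iff {f G : ℝ → ℝ} {s : Set ℝ} {σ : ℕ} {α : ℝ} (hs : UniqueDiffOn ℝ s)
    (h0 : (0 : ℝ) ∈ s) (hG : AnalyticAt ℝ G 0) (h : EqOn f G s) :
    JetCond s σ α f ↔ JetCond univ σ α G := by
  obtain ⟨h1, h2⟩ := derivWithin_eq_of_eqOn hs h0 hG h
  rw [JetCond, JetCond, h1, h2, h h0, derivWithin_univ, iteratedDerivWithin_univ]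

theorem jetCond_pow_mul {H : ℝ → ℝ} (hH : AnalyticAt ℝ H 0) (h1 : deriv H 0 = 0) {σ : ℕ}
    (hσ : σ ≤ 1) : JetCond univ σ (H 0) (fun t => t ^ σ * H t) := by
  rcases Nat.le_one_iff_eq_zero_or_eq_one.1 hσ with rfl | rfl
  · left
    simp [h1]
  · right
    have hd : deriv (fun t => t ^ 1 * H t) =ᶠ[𝓝 0] fun t => H t + t * deriv H t := by
      filter_upwards [hH.eventually_analyticAt] with t ht
      simpa using ((hasDerivAt_pow 1 t).fun_mul ht.differentiableAt.hasDerivAt).deriv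
    refine ⟨rfl, by simp, ?_, ?_⟩
    · rw [derivWithin_univ, hd.self_of_nhds]
      simp
    · rw [iteratedDerivWithin_univ, iteratedDeriv_succ, iteratedDeriv_one, hd.deriv_eq]
      have := (hH.differentiableAt.hasDerivAt.fun_add
        ((hasDerivAt_id (0 : ℝ)).fun_mul hH.deriv.differentiableAt.hasDerivAt)).deriv
      simpa [h1] using this

/-- For σ = 1 the value G(0) = 0 allows division by t, and G = tH gives G'(0) = H(0) and G''(0) =
2H'(0). The condition on the second derivative is thus H'(0) = 0. -/
theorem JetCond.exists_factor {G : ℝ → ℝ} (hG : AnalyticAt ℝ G 0) {σ : ℕ} {α : ℝ}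
    (h : JetCond univ σ α G) :
    ∃ H : ℝ → ℝ, AnalyticAt ℝ H 0 ∧ H 0 = α ∧ deriv H 0 = 0 ∧
      G =ᶠ[𝓝 0] fun t => t ^ σ * H t := by
  rw [JetCond, derivWithin_univ, iteratedDerivWithin_univ] at h
  rcases h with ⟨rfl, h1, h2⟩ | ⟨rfl, h1, h2, h3⟩
  · exact ⟨G, hG, h1, h2, Eventually.of_forall fun t => by simp⟩
  · obtain ⟨H, hH, heq⟩ := hG.exists_eventuallyEq_sum_add_pow_mul 1
    have heq' : G =ᶠ[𝓝 0] fun t => t ^ 1 * H t := heq.mono fun t ht => by simpa [h1] using ht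
    have hd : deriv G =ᶠ[𝓝 0] fun t => H t + t * deriv H t := by
      filter_upwards [hH.eventually_analyticAt, heq'.eventually_nhds] with t ht h4
      rw [EventuallyEq.deriv_eq h4]
      simpa using ((hasDerivAt_pow 1 t).fun_mul ht.differentiableAt.hasDerivAt).deriv
    refine ⟨H, hH, ?_, ?_, heq'⟩
    · simpa [h2] using hd.self_of_nhds.symm
    · rw [iteratedDeriv_succ, iteratedDeriv_one, hd.deriv_eq] at h3
      have := (hH.differentiableAt.hasDerivAt.fun_add
        ((hasDerivAt_id (0 : ℝ)).fun_mul hH.deriv.differentiableAt.hasDerivAt)).deriv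
      simp only [id, one_mul, zero_mul, add_zero] at this
      rw [this] at h3
      linarith

/-- Solutions on `[0, ε)` with a singular end at `0` described by `σ` and `α`. -/
def IsEndSolution (n : ℕ) (lam : ℝ) (σ : Fin 5 → ℕ) (α : Fin 5 → ℝ) (ε : ℝ)
    (f : Fin 5 → ℝ → ℝ) : Prop :=
  IsSolutionOn n lam (Ico 0 ε) f ∧ ∀ i, JetCond (Ico 0 ε) (σ i) (α i) (f i)

/-- The second order coefficient of the variables `xᵢ = fᵢ² / t ^ (2 σᵢ)`. -/
def HasSecondCoeff (σ : Fin 5 → ℕ) (α : Fin 5 → ℝ) (f : Fin 5 → ℝ → ℝ) (w : Fin 5 → ℝ) : Prop :=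
  Tendsto (fun t : ℝ => (2 / t ^ 2) • ((fun i => f i t ^ 2 / t ^ (2 * σ i)) - fun i => α i ^ 2))
    (𝓝[>] 0) (𝓝 w)

variable {n : ℕ} {lam : ℝ} {σ : Fin 5 → ℕ} {α : Fin 5 → ℝ} {ε : ℝ} {f g : Fin 5 → ℝ → ℝ}

theorem hasSecondCoeff_iff {H : Fin 5 → ℝ → ℝ}
    (h : ∀ᶠ t in 𝓝[>] 0, ∀ i, f i t = t ^ σ i * H i t) (w : Fin 5 → ℝ) :
    HasSecondCoeff σ α f w ↔
      Tendsto (fun t => (2 / t ^ 2) • (squares H t - fun i => α i ^ 2)) (𝓝[>] 0) (𝓝 w) := by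
  refine tendsto_congr' ?_
  filter_upwards [h, self_mem_nhdsWithin] with t ht ht0
  have ht0' : t ≠ 0 := ne_of_gt ht0
  congr 2
  ext i
  simp only [ht i, squares]
  rw [mul_pow, ← pow_mul, mul_comm (σ i) 2, mul_div_cancel_left₀ _ (pow_ne_zero _ ht0')]

theorem HasSecondCoeff.unique {w w' : Fin 5 → ℝ} (h : HasSecondCoeff σ α f w)
    (h' : HasSecondCoeff σ α f w') : w = w' :=
  tendsto_nhds_unique h h'

theorem HasSecondCoeff.congr {w : Fin 5 → ℝ} (hε : 0 < ε) (h : ∀ i, EqOn (f i) (g i) (Ico 0 ε))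
    (hf : HasSecondCoeff σ α f w) : HasSecondCoeff σ α g w := by
  refine Tendsto.congr' ?_ hf
  filter_upwards [Ioo_mem_nhdsGT hε] with t ht
  congr 2
  ext i
  rw [h i ⟨ht.1.le, ht.2⟩]

/-- One-sided analyticity at the closed end is analyticity of an extension. `G` agrees with `f` on
the whole interval but need be analytic only at 0. -/
theorem exists_analytic_extension {f : ℝ → ℝ} (hε : 0 < ε) (hf : AnalyticOn ℝ f (Ico 0 ε)) :
    ∃ G : ℝ → ℝ, AnalyticAt ℝ G 0 ∧ EqOn f G (Ico 0 ε) := by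
  have h0 : (0 : ℝ) ∈ Ico 0 ε := ⟨le_rfl, hε⟩
  obtain ⟨G, -, hG, hGan⟩ := analyticWithinAt_iff_exists_analyticAt'.1 (hf 0 h0)
  rw [insert_eq_of_mem h0] at hG
  exact ⟨G, hGan, hG⟩

theorem IsEndSolution.mono {ε' : ℝ} (hε' : 0 < ε') (hle : ε' ≤ ε)
    (h : IsEndSolution n lam σ α ε f) : IsEndSolution n lam σ α ε' f := by
  obtain ⟨h1, h2⟩ := h
  rw [isSolutionOn_iff] at h1
  have hsub : Ico 0 ε' ⊆ Ico 0 ε := Ico_subset_Ico_right hle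
  refine ⟨isSolutionOn_iff.2 ⟨fun i => (h1.1 i).mono hsub,
    fun i t ht => h1.2.1 i t (interior_mono hsub ht),
    fun t ht => h1.2.2 t (interior_mono hsub ht)⟩, fun i => ?_⟩
  obtain ⟨G, hG, hfG⟩ := exists_analytic_extension (hε'.trans_le hle) (h1.1 i)
  rw [jetCond_iff (uniqueDiffOn_Ico _ _) ⟨le_rfl, hε'⟩ hG (hfG.mono hsub)]
  exact (jetCond_iff (uniqueDiffOn_Ico _ _) ⟨le_rfl, hε'.trans_le hle⟩ hG hfG).1 (h2 i)

/-- A solution with a singular end is given by a germ. -/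
theorem IsEndSolution.exists_isGerm (hε : 0 < ε) (h : IsEndSolution n lam σ α ε f) :
    ∃ H, IsGerm n lam σ α H ∧ ∀ᶠ t in 𝓝[>] 0, ∀ i, f i t = t ^ σ i * H i t := by
  obtain ⟨h1, h2⟩ := h
  rw [isSolutionOn_iff, interior_Ico] at h1
  have key : ∀ i, ∃ H : ℝ → ℝ, AnalyticAt ℝ H 0 ∧ H 0 = α i ∧ deriv H 0 = 0 ∧
      ∀ᶠ t in 𝓝[>] 0, f i t = t ^ σ i * H t := by
    intro i
    obtain ⟨G, hG, hfG⟩ := exists_analytic_extension hε (h1.1 i)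
    obtain ⟨H, hH, hH0, hH1, hGH⟩ := JetCond.exists_factor hG
      ((jetCond_iff (uniqueDiffOn_Ico _ _) ⟨le_rfl, hε⟩ hG hfG).1 (h2 i))
    refine ⟨H, hH, hH0, hH1, ?_⟩
    filter_upwards [hGH.filter_mono nhdsWithin_le_nhds, Ioo_mem_nhdsGT hε] with t ht ht'
    rw [hfG ⟨ht'.1.le, ht'.2⟩, ht]
  choose H hH hH0 hH1 hfH using key
  have hall := eventually_all.2 hfH
  refine ⟨H, ⟨hH, hH0, hH1, ?_⟩, hall⟩
  obtain ⟨δ, hδ, hsub⟩ := mem_nhdsGT_iff_exists_Ioo_subset.1 hall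
  filter_upwards [Ioo_mem_nhdsGT hε, Ioo_mem_nhdsGT hδ] with t ht htδ
  refine (eqAt_congr fun i => ?_).1 (h1.2.2 t ht)
  filter_upwards [Ioo_mem_nhds htδ.1 htδ.2] with s hs using hsub hs i

theorem IsGerm.exists_isEndSolution (hσ : ∀ i, σ i ≤ 1) (hα : ∀ i, 0 < α i)
    {H : Fin 5 → ℝ → ℝ} (hH : IsGerm n lam σ α H) :
    ∃ ε > 0, IsEndSolution n lam σ α ε (fun i t => t ^ σ i * H i t) := by
  obtain ⟨δ, hδ, hsub⟩ := mem_nhdsGT_iff_exists_Ioo_subset.1 hH.eq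
  obtain ⟨η, hη, hηall⟩ := Metric.eventually_nhds_iff_ball.1
    ((hH.eventually_pos hα).and hH.eventually_analytic)
  rw [Real.ball_eq_Ioo, zero_sub, zero_add] at hηall
  have hδ' : (0 : ℝ) < δ := hδ
  have hε : 0 < min δ η := lt_min hδ' hη
  have hmem : ∀ t ∈ Ico 0 (min δ η), t ∈ Ioo (-η) η := fun t ht =>
    ⟨by linarith [ht.1], ht.2.trans_le (min_le_right _ _)⟩
  have han : ∀ i, ∀ t ∈ Ico 0 (min δ η), AnalyticAt ℝ (fun t => t ^ σ i * H i t) t :=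
    fun i t ht => by
      have := (hηall t (hmem t ht)).2 i
      fun_prop
  refine ⟨min δ η, hε, isSolutionOn_iff.2 ⟨fun i t ht => (han i t ht).analyticWithinAt, ?_, ?_⟩,
    fun i => ?_⟩
  · rw [interior_Ico]
    intro i t ht
    exact mul_pos (pow_pos ht.1 _) ((hηall t (hmem t ⟨ht.1.le, ht.2⟩)).1 i)
  · rw [interior_Ico]
    intro t ht
    exact hsub ⟨ht.1, ht.2.trans_le (min_le_left _ _)⟩
  · have h0 : (0 : ℝ) ∈ Ico 0 (min δ η) := ⟨le_rfl, hε⟩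
    rw [jetCond_iff (uniqueDiffOn_Ico _ _) h0 (han i 0 h0) (fun _ _ => rfl), ← hH.value i]
    exact jetCond_pow_mul (hH.analytic i) (hH.deriv_zero i) (hσ i)

variable {A : (Fin 5 → ℝ) → Fin 5 → ℝ} {B : (Fin 5 → ℝ) → (Fin 5 → ℝ) → Fin 5 → ℝ}
  {C : ℝ → (Fin 5 → ℝ) → (Fin 5 → ℝ) → Fin 5 → ℝ} {A' B' : (Fin 5 → ℝ) →L[ℝ] Fin 5 → ℝ}

theorem exists_isEndSolution (hred : Reduces n lam σ A B C) (hσ : ∀ i, σ i ≤ 1)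
    (hα : ∀ i, 0 < α i) (hS : SingularSystem A B C (fun i => α i ^ 2) A' B')
    {w : Fin 5 → ℝ} (hw : w - A' w - B' w = (2 : ℝ) • C 0 (fun i => α i ^ 2) 0) :
    ∃ ε > 0, ∃ f, IsEndSolution n lam σ α ε f ∧ HasSecondCoeff σ α f w := by
  obtain ⟨H, hH, hHw⟩ := exists_isGerm hred hσ hα hS hw
  obtain ⟨ε, hε, h⟩ := hH.exists_isEndSolution hσ hα
  exact ⟨ε, hε, _, h, (hasSecondCoeff_iff (Eventually.of_forall fun _ _ => rfl) w).2 hHw⟩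

theorem IsEndSolution.exists_secondCoeff (hred : Reduces n lam σ A B C) (hσ : ∀ i, σ i ≤ 1)
    (hα : ∀ i, 0 < α i) (hS : SingularSystem A B C (fun i => α i ^ 2) A' B') (hε : 0 < ε)
    (hf : IsEndSolution n lam σ α ε f) :
    ∃ w, w - A' w - B' w = (2 : ℝ) • C 0 (fun i => α i ^ 2) 0 ∧ HasSecondCoeff σ α f w := by
  obtain ⟨H, hH, hfH⟩ := hf.exists_isGerm hε
  obtain ⟨w, hw, hHw⟩ := hH.second_coeff hred hσ hα hS
  exact ⟨w, hw, (hasSecondCoeff_iff hfH w).2 hHw⟩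

/-- Equal second coefficients give equal germs, the identity theorem spreads the equality over the
connected interval (0, ε), and the prescribed jets settle the point 0. -/
theorem IsEndSolution.eqOn (hred : Reduces n lam σ A B C) (hσ : ∀ i, σ i ≤ 1)
    (hα : ∀ i, 0 < α i) (hS : SingularSystem A B C (fun i => α i ^ 2) A' B') (hε : 0 < ε)
    (hf : IsEndSolution n lam σ α ε f) (hg : IsEndSolution n lam σ α ε g) {w : Fin 5 → ℝ}
    (hfw : HasSecondCoeff σ α f w) (hgw : HasSecondCoeff σ α g w) (i : Fin 5) :
    EqOn (f i) (g i) (Ico 0 ε) := by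
  obtain ⟨H, hH, hfH⟩ := hf.exists_isGerm hε
  obtain ⟨G, hG, hgG⟩ := hg.exists_isGerm hε
  have hHG := hH.unique hred hσ hα hS hG ((hasSecondCoeff_iff hfH w).1 hfw)
    ((hasSecondCoeff_iff hgG w).1 hgw) i
  have hev : ∀ᶠ t in 𝓝[>] 0, f i t = g i t := by
    filter_upwards [hfH, hgG, hHG.filter_mono nhdsWithin_le_nhds] with t h1 h2 h3
    rw [h1, h2, h3]
  obtain ⟨δ, hδ, hsub⟩ := mem_nhdsGT_iff_exists_Ioo_subset.1 hev
  have hδ' : (0 : ℝ) < δ := hδ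
  have hm : 0 < min δ ε := lt_min hδ' hε
  have han : ∀ {f : Fin 5 → ℝ → ℝ}, IsEndSolution n lam σ α ε f →
      AnalyticOnNhd ℝ (f i) (Ioo 0 ε) := fun hf =>
    isOpen_Ioo.analyticOn_iff_analyticOnNhd.1 ((hf.1.analytic i).mono Ioo_subset_Ico_self)
  have hz : min δ ε / 2 ∈ Ioo 0 ε := ⟨by linarith, by linarith [min_le_right δ ε]⟩
  have hIoo : EqOn (f i) (g i) (Ioo 0 ε) :=
    (han hf).eqOn_of_preconnected_of_eventuallyEq (han hg) isPreconnected_Ioo hz (by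
      filter_upwards [Ioo_mem_nhds (a := 0) (b := δ) hz.1 (by linarith [min_le_left δ ε])]
        with s hs using hsub hs)
  intro t ht
  rcases ht.1.eq_or_lt with h0 | h0
  · rw [← h0]
    rcases hf.2 i with h1 | h1 <;> rcases hg.2 i with h2 | h2
    · rw [h1.2.1, h2.2.1]
    · exact absurd (h1.1.symm.trans h2.1) zero_ne_one
    · exact absurd (h2.1.symm.trans h1.1) zero_ne_one
    · rw [h1.2.1, h2.2.1]
  · exact hIoo ⟨h0, ht.2⟩

/-- Solutions that are parametrized by an affine line of second order coefficients: infinitely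
many of them live on a common interval. -/
theorem parametrized_by_ker {Sol : ℝ → (Fin 5 → ℝ → ℝ) → Prop}
    {Sec : (Fin 5 → ℝ → ℝ) → (Fin 5 → ℝ) → Prop} {I : ℝ → Set ℝ}
    {L : (Fin 5 → ℝ) →L[ℝ] Fin 5 → ℝ} {c p : Fin 5 → ℝ}
    (hker : Module.finrank ℝ (LinearMap.ker L.toLinearMap) = 1) (hp : L p = c)
    (hE : ∀ w, L w = c → ∃ ε > 0, ∃ f, Sol ε f ∧ Sec f w)
    (hN : ∀ ε, 0 < ε → ∀ f, Sol ε f → ∃ w, L w = c ∧ Sec f w)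
    (hU : ∀ ε, 0 < ε → ∀ f g, Sol ε f → Sol ε g → ∀ w, Sec f w → Sec g w →
      ∀ i, EqOn (f i) (g i) (I ε))
    (hmono : ∀ ε' ε f, 0 < ε' → ε' ≤ ε → Sol ε f → Sol ε' f)
    (hcongr : ∀ ε f g w, 0 < ε → (∀ i, EqOn (f i) (g i) (I ε)) → Sec f w → Sec g w)
    (hsec : ∀ f w w', Sec f w → Sec f w' → w = w') :
    (∃ ε₀ : ℝ, 0 < ε₀ ∧
      ((fun (f : Fin 5 → ℝ → ℝ) (i : Fin 5) => (I ε₀).domRestrict (f i)) ''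
        {f | Sol ε₀ f}).Infinite) ∧
    Module.finrank ℝ (LinearMap.ker L.toLinearMap) = 1 ∧
    ∃ p : Fin 5 → ℝ,
      (∀ v ∈ LinearMap.ker L.toLinearMap,
        ∃ ε : ℝ, 0 < ε ∧ ∃ f : Fin 5 → ℝ → ℝ, Sol ε f ∧ Sec f (p + v)) ∧
      (∀ ε : ℝ, 0 < ε → ∀ f : Fin 5 → ℝ → ℝ, Sol ε f →
        ∃ v ∈ LinearMap.ker L.toLinearMap, Sec f (p + v)) ∧
      (∀ ε : ℝ, 0 < ε → ∀ f g : Fin 5 → ℝ → ℝ, Sol ε f → Sol ε g →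
        ∀ w : Fin 5 → ℝ, Sec f w → Sec g w → ∀ i, EqOn (f i) (g i) (I ε)) := by
  have hE' : ∀ v ∈ LinearMap.ker L.toLinearMap,
      ∃ ε : ℝ, 0 < ε ∧ ∃ f : Fin 5 → ℝ → ℝ, Sol ε f ∧ Sec f (p + v) := fun v hv =>
    hE (p + v) (by
      have : L v = 0 := hv
      rw [map_add, hp, this, add_zero])
  refine ⟨?_, hker, p, hE', fun ε hε f hf => ?_, hU⟩
  · obtain ⟨⟨v, hv⟩, hv0⟩ : ∃ v : LinearMap.ker L.toLinearMap, v ≠ 0 := by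
      have := Module.nontrivial_of_finrank_pos (R := ℝ) (M := LinearMap.ker L.toLinearMap)
        (by rw [hker]; exact one_pos)
      exact exists_ne 0
    have hv0' : v ≠ 0 := fun h => hv0 (Subtype.ext h)
    choose ε hε f hf hfs using fun s : ℝ =>
      hE' (s • v) ((LinearMap.ker L.toLinearMap).smul_mem s hv)
    -- The length ε(s) may shrink with s. If each threshold 1/(N + 1) were exceeded for only
    -- finitely many s, the real line would be countable.
    obtain ⟨N, hN⟩ : ∃ N : ℕ, {s : ℝ | 1 / ((N : ℝ) + 1) < ε s}.Infinite := by
      by_contra hcon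
      simp only [not_exists, Set.not_infinite] at hcon
      refine not_countable_univ (α := ℝ) ((countable_iUnion fun N => (hcon N).countable).mono ?_)
      intro s _
      exact mem_iUnion.2 (exists_nat_one_div_lt (hε s))
    have hpos : (0 : ℝ) < 1 / ((N : ℝ) + 1) := by positivity
    refine ⟨1 / ((N : ℝ) + 1), hpos, ?_⟩
    refine infinite_of_injOn_mapsTo
      (f := fun s i => (I (1 / ((N : ℝ) + 1))).domRestrict (f s i)) ?_ ?_ hN
    -- Restrictions that agree have the same second coefficient p + sv, and v ≠ 0 recovers s.
    · intro s _ s' _ hss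
      have hEq : ∀ i, EqOn (f s i) (f s' i) (I (1 / ((N : ℝ) + 1))) := fun i t ht =>
        congrFun (congrFun hss i) ⟨t, ht⟩
      have h1 := hsec _ _ _ (hcongr _ _ _ _ hpos hEq (hfs s)) (hfs s')
      exact smul_left_injective ℝ hv0' (add_left_cancel h1)
    · intro s hs
      exact ⟨f s, hmono _ _ _ hpos (le_of_lt hs) (hf s), rfl⟩
  · obtain ⟨w, hw, hfw⟩ := hN ε hε f hf
    refine ⟨w - p, ?_, by rwa [add_sub_cancel]⟩
    change L (w - p) = 0
    rw [map_sub, hw, hp, sub_self]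

end Ends

/-! ### Time reversal -/

section Reflection

variable {n : ℕ} {lam : ℝ} {f : Fin 5 → ℝ → ℝ}

/-- First derivatives enter the equations only through products of two of them. -/
theorem lhs_neg (n : ℝ) (a b : Fin 5 → ℝ) (c : ℝ) (k : Fin 5) :
    lhs n a (fun i => -b i) c k = lhs n a b c k := by
  fin_cases k <;> simp [lhs, lhs1, lhs2, lhs3, lhs4, lhs5]

theorem eqAt_reflect {t : ℝ} : EqAt n lam (fun i s => f i (1 - s)) t ↔ EqAt n lam f (1 - t) := by
  simp only [EqAt, deriv_comp_const_sub, iteratedDeriv_comp_const_sub, lhs_neg]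
  simp

theorem IsSolutionOn.reflect {s : Set ℝ} (h : IsSolutionOn n lam s f) :
    IsSolutionOn n lam ((fun t => 1 - t) ⁻¹' s) (fun i t => f i (1 - t)) := by
  rw [isSolutionOn_iff] at h ⊢
  have hint : interior ((fun t : ℝ => 1 - t) ⁻¹' s) = (fun t => 1 - t) ⁻¹' interior s :=
    ((Homeomorph.subLeft (1 : ℝ)).preimage_interior s).symm
  rw [hint]
  refine ⟨fun i => ?_, fun i t ht => h.2.1 i _ ht, fun t ht => eqAt_reflect.2 (h.2.2 _ ht)⟩
  have h1 : AnalyticOn ℝ (fun t : ℝ => 1 - t) ((fun t => 1 - t) ⁻¹' s) := fun t _ =>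
    AnalyticAt.analyticWithinAt (by fun_prop)
  exact (h.1 i).comp h1 (mapsTo_preimage _ _)

theorem isSolutionOn_reflect_iff {ε : ℝ} : IsSolutionOn n lam (Ioc (1 - ε) 1) f ↔
    IsSolutionOn n lam (Ico 0 ε) (fun i t => f i (1 - t)) := by
  constructor
  · intro h
    simpa using h.reflect
  · intro h
    simpa using h.reflect

end Reflection

/-! ### Reduction of the Einstein equations to singular systems -/

section Reduction

/-- The mean curvature of the orbits, in terms of the logarithmic derivatives `β`. -/
def meanCurvature (n : ℝ) (β : Fin 5 → ℝ) : ℝ :=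
  β 0 + 2 * β 1 + 2 * β 2 + 2 * (n - 1) * β 3 + 2 * (n - 1) * β 4

/-- The zeroth order terms of the equations, in terms of the squares `X = f²`. -/
def potential (n : ℝ) (X : Fin 5 → ℝ) : Fin 5 → ℝ :=
  ![-(2 / (n + 3) / X 0) - 1 / (n + 3) * (X 0 / (X 1 * X 2) - X 1 / (X 0 * X 2) - X 2 / (X 0 * X 1))
      - (n - 1) / (4 * (n + 1) * (n + 3))
        * ((n - 1) * (X 0 / X 2 ^ 2) + X 0 / X 3 ^ 2 + X 0 / X 4 ^ 2),
    -(1 / 2 / X 1)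
      - 1 / (2 * (n + 3)) * (X 1 / (X 0 * X 2) - X 0 / (X 1 * X 2) - X 2 / (X 0 * X 1))
      - (n - 1) / (4 * (n + 3)) * (X 1 / (X 3 * X 4) - X 3 / (X 1 * X 4) - X 4 / (X 1 * X 3)),
    -(1 / 2 / X 2)
      - 1 / (2 * (n + 3)) * (X 2 / (X 0 * X 1) - X 0 / (X 1 * X 2) - X 1 / (X 0 * X 2))
      + (n - 1) / (2 * (n + 1) * (n + 3)) * ((n - 1) / 2 * (X 0 / X 2 ^ 2)
        - X 2 / (X 3 * X 4) + X 3 / (X 2 * X 4) + X 4 / (X 2 * X 3)),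
    -(1 / 2 / X 3)
      - 1 / (4 * (n + 3)) * (X 3 / (X 1 * X 4) - X 1 / (X 3 * X 4) - X 4 / (X 1 * X 3))
      + 1 / (2 * (n + 1) * (n + 3)) * (1 / 2 * (X 0 / X 3 ^ 2)
        - X 3 / (X 2 * X 4) + X 2 / (X 3 * X 4) + X 4 / (X 2 * X 3)),
    -(1 / 2 / X 4)
      - 1 / (4 * (n + 3)) * (X 4 / (X 1 * X 3) - X 1 / (X 3 * X 4) - X 3 / (X 1 * X 4))
      + 1 / (2 * (n + 1) * (n + 3)) * (1 / 2 * (X 0 / X 4 ^ 2)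
        - X 4 / (X 2 * X 3) + X 2 / (X 3 * X 4) + X 3 / (X 2 * X 4))]

/-- In the k-th equation the coefficient of (fₖ'/fₖ)² is dₖ - 1, with d = (1, 2, 2, 2(n-1), 2(n-1)).
Subtracting one such square from the full trace term therefore brings all five equations to one
shape. -/
theorem lhs_eq (n : ℝ) (a b : Fin 5 → ℝ) (c : ℝ) (k : Fin 5) :
    lhs n a b c k = c / a k - (b k / a k) ^ 2 + b k / a k * meanCurvature n (fun i => b i / a i)
      + potential n (fun i => a i ^ 2) k := by
  fin_cases k
  · change lhs1 _ _ _ _ _ _ _ _ _ _ _ _ = _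
    simp [lhs1, meanCurvature, potential]; ring
  · change lhs2 _ _ _ _ _ _ _ _ _ _ _ _ = _
    simp [lhs2, meanCurvature, potential]; ring
  · change lhs3 _ _ _ _ _ _ _ _ _ _ _ _ = _
    simp [lhs3, meanCurvature, potential]; ring
  · change lhs4 _ _ _ _ _ _ _ _ _ _ _ _ = _
    simp [lhs4, meanCurvature, potential]; ring
  · change lhs5 _ _ _ _ _ _ _ _ _ _ _ _ = _
    simp [lhs5, meanCurvature, potential]; ring

/-- The equations are equivalent to the singular system if the potential splits accordingly;
`P` is the regular part of `-xₖ` times the potential. -/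
theorem reduces_of_potential {n : ℕ} (lam : ℝ) {σ : Fin 5 → ℕ} {m : ℝ}
    {A : (Fin 5 → ℝ) → Fin 5 → ℝ} {B : (Fin 5 → ℝ) → (Fin 5 → ℝ) → Fin 5 → ℝ}
    {P : ℝ → (Fin 5 → ℝ) → Fin 5 → ℝ}
    (hσ : ∀ i, σ i ≤ 1) (hm : meanCurvature n (fun i => (σ i : ℝ)) = m)
    (hB : ∀ x y k, B x y k = -(m * y k) - σ k * x k * logTrace n x y)
    (hA : ∀ t : ℝ, 0 < t → ∀ x : Fin 5 → ℝ, (∀ i, 0 < x i) → ∀ k,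
      x k * potential n (fun i => t ^ (2 * σ i) * x i) k
        = (1 - m) * σ k * x k / t ^ 2 - A x k / t ^ 2 - P t x k) :
    Reduces n lam σ A B (fun t x y k =>
      2 * y k ^ 2 / x k - y k * logTrace n x y - lam * x k + P t x k) := by
  intro t ht x y hx a b ha hb k z c hc
  have hxk := (hx k).ne'
  have ht0 := ht.ne'
  have hmc : meanCurvature n (fun i => (σ i : ℝ) / t + y i / x i) = m / t + logTrace n x y := by
    rw [← hm]
    simp only [meanCurvature, logTrace]
    ring
  rw [lhs_eq, hc, funext ha, hb, funext hb, hmc, hB]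
  have hAk := hA t ht x hx k
  set Q := potential n (fun i => t ^ (2 * σ i) * x i) k with hQ
  have e : Q = ((1 - m) * σ k * x k / t ^ 2 - A x k / t ^ 2 - P t x k) / x k := by
    rw [← hAk]; field_simp
  rw [e, ← sub_eq_zero, ← sub_eq_zero (a := z)]
  -- After the 1/t² terms are collected, only (σ - σ²)/t² is left over, which vanishes for σ in {0,
  -- 1}.
  have key : z / x k - y k ^ 2 / x k ^ 2 + 2 * σ k * (y k / (t * x k))
      - ((σ k : ℝ) / t + y k / x k) ^ 2
      + ((σ k : ℝ) / t + y k / x k) * (m / t + logTrace n x y)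
      + ((1 - m) * σ k * x k / t ^ 2 - A x k / t ^ 2 - P t x k) / x k - -lam
      = (z - (1 / t ^ 2 * A x k + 1 / t * (-(m * y k) - σ k * x k * logTrace n x y)
        + (2 * y k ^ 2 / x k - y k * logTrace n x y - lam * x k + P t x k))) / x k
        + (σ k - σ k ^ 2) / t ^ 2 := by
    field_simp
    ring
  have hσk : (σ k : ℝ) - (σ k : ℝ) ^ 2 = 0 := by
    rcases Nat.le_one_iff_eq_zero_or_eq_one.1 (hσ k) with h0 | h0 <;> simp [h0]
  rw [key, hσk, zero_div, add_zero, div_eq_zero_iff, or_iff_left hxk]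

/-- The exponents of the components that collapse at `t = 0`. -/
def σInitial : Fin 5 → ℕ := ![1, 0, 0, 1, 0]

/-- The exponents of the components that collapse at the end `1`. -/
def σFinal : Fin 5 → ℕ := ![0, 1, 0, 0, 0]

/-- The regular part of the potential at `t = 0`. -/
def PInitial (n : ℝ) (t : ℝ) (x : Fin 5 → ℝ) : Fin 5 → ℝ :=
  ![t ^ 2 * (1 / (n + 3) * (x 0 ^ 2 / (x 1 * x 2)) + (n - 1) / (4 * (n + 1) * (n + 3))
      * ((n - 1) * (x 0 ^ 2 / x 2 ^ 2) + x 0 ^ 2 / x 4 ^ 2)),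
    1 / 2 - t ^ 2 * (1 / (2 * (n + 3)) * (x 0 / x 2) + (n - 1) / (4 * (n + 3)) * (x 3 / x 4)),
    1 / 2 - t ^ 2 * (1 / (2 * (n + 3)) * (x 0 / x 1) + (n - 1) / (2 * (n + 1) * (n + 3))
      * ((n - 1) / 2 * (x 0 / x 2) + x 3 / x 4)),
    t ^ 2 * (1 / (4 * (n + 3)) * (x 3 ^ 2 / (x 1 * x 4))
      + 1 / (2 * (n + 1) * (n + 3)) * (x 3 ^ 2 / (x 2 * x 4))),
    1 / 2 - t ^ 2 * (1 / (4 * (n + 3)) * (x 3 / x 1)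
      + 1 / (2 * (n + 1) * (n + 3)) * (1 / 2 * (x 0 / x 4) + x 3 / x 2))]

/-- The regular part of the potential at the end `1`. -/
def PFinal (n : ℝ) (t : ℝ) (x : Fin 5 → ℝ) : Fin 5 → ℝ :=
  ![2 / (n + 3) - t ^ 2 * (1 / (n + 3) * (x 1 / x 2)) + (n - 1) / (4 * (n + 1) * (n + 3))
      * ((n - 1) * (x 0 ^ 2 / x 2 ^ 2) + x 0 ^ 2 / x 3 ^ 2 + x 0 ^ 2 / x 4 ^ 2),
    t ^ 2 * (1 / (2 * (n + 3)) * (x 1 ^ 2 / (x 0 * x 2))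
      + (n - 1) / (4 * (n + 3)) * (x 1 ^ 2 / (x 3 * x 4))),
    1 / 2 - t ^ 2 * (1 / (2 * (n + 3)) * (x 1 / x 0)) - (n - 1) / (2 * (n + 1) * (n + 3))
      * ((n - 1) / 2 * (x 0 / x 2) - x 2 ^ 2 / (x 3 * x 4) + x 3 / x 4 + x 4 / x 3),
    1 / 2 - t ^ 2 * (1 / (4 * (n + 3)) * (x 1 / x 4)) - 1 / (2 * (n + 1) * (n + 3))
      * (1 / 2 * (x 0 / x 3) - x 3 ^ 2 / (x 2 * x 4) + x 2 / x 4 + x 4 / x 2),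
    1 / 2 - t ^ 2 * (1 / (4 * (n + 3)) * (x 1 / x 3)) - 1 / (2 * (n + 1) * (n + 3))
      * (1 / 2 * (x 0 / x 4) - x 4 ^ 2 / (x 2 * x 3) + x 2 / x 3 + x 3 / x 2)]

/-- The regular part of the singular system, in terms of the regular part of the potential. -/
def regularPart (n lam : ℝ) (P : ℝ → (Fin 5 → ℝ) → Fin 5 → ℝ) (t : ℝ) (x y : Fin 5 → ℝ) :
    Fin 5 → ℝ :=
  fun k => 2 * y k ^ 2 / x k - y k * logTrace n x y - lam * x k + P t x k

theorem σInitial_le (i : Fin 5) : σInitial i ≤ 1 := by fin_cases i <;> simp [σInitial]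

theorem σFinal_le (i : Fin 5) : σFinal i ≤ 1 := by fin_cases i <;> simp [σFinal]

/-- The constant m = 2n - 1 = 1 + 2(n - 1) is the total dimension of the collapsing components f₁
and f₄. -/
theorem reduces_initial (n : ℕ) (lam : ℝ) : Reduces n lam σInitial (AInitial n) (BInitial n)
    (regularPart n lam (PInitial n)) := by
  refine reduces_of_potential (m := 2 * (n : ℝ) - 1) lam σInitial_le ?_ ?_ ?_
  · simp [meanCurvature, σInitial]; ring
  · intro x y k
    fin_cases k <;> simp [BInitial, σInitial] <;> ring
  · intro t ht x hx k
    have h0 := (hx 0).ne'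
    have h1 := (hx 1).ne'
    have h2 := (hx 2).ne'
    have h3 := (hx 3).ne'
    have h4 := (hx 4).ne'
    have hn1 : (n : ℝ) + 1 ≠ 0 := by positivity
    have hn3 : (n : ℝ) + 3 ≠ 0 := by positivity
    fin_cases k <;> simp [potential, σInitial, AInitial, PInitial] <;> field_simp <;> ring

theorem reduces_final (n : ℕ) (lam : ℝ) : Reduces n lam σFinal (AFinal n) (BFinal n)
    (regularPart n lam (PFinal n)) := by
  refine reduces_of_potential (m := 2) lam σFinal_le ?_ ?_ ?_
  · simp [meanCurvature, σFinal]
  · intro x y k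
    fin_cases k <;> simp [BFinal, σFinal]
  · intro t ht x hx k
    have h0 := (hx 0).ne'
    have h1 := (hx 1).ne'
    have h2 := (hx 2).ne'
    have h3 := (hx 3).ne'
    have h4 := (hx 4).ne'
    have hn1 : (n : ℝ) + 1 ≠ 0 := by positivity
    have hn3 : (n : ℝ) + 3 ≠ 0 := by positivity
    fin_cases k <;> simp [potential, σFinal, AFinal, PFinal] <;> field_simp <;> ring

end Reduction

/-! ### Analyticity of the coefficients -/

section Analyticity

variable {D : Type*} [NormedAddCommGroup D] [NormedSpace ℝ D] {x y : D → Fin 5 → ℝ} {t : D → ℝ}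
  {z : D}

theorem analyticAt_vec5 {f0 f1 f2 f3 f4 : D → ℝ} (h0 : AnalyticAt ℝ f0 z) (h1 : AnalyticAt ℝ f1 z)
    (h2 : AnalyticAt ℝ f2 z) (h3 : AnalyticAt ℝ f3 z) (h4 : AnalyticAt ℝ f4 z) :
    AnalyticAt ℝ (fun w => ![f0 w, f1 w, f2 w, f3 w, f4 w]) z := by
  have : ∀ i, AnalyticAt ℝ (![f0, f1, f2, f3, f4] i) z := by
    intro i
    fin_cases i
    exacts [h0, h1, h2, h3, h4]
  refine (analyticAt_pi_iff.2 this).congr (Eventually.of_forall fun w => ?_)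
  ext i
  fin_cases i <;> rfl

theorem analyticAt_coord (hx : AnalyticAt ℝ x z) (i : Fin 5) : AnalyticAt ℝ (fun w => x w i) z :=
  analyticAt_pi_iff.1 hx i

theorem analyticAt_logTrace (n : ℝ) (hx : AnalyticAt ℝ x z) (hy : AnalyticAt ℝ y z)
    (h : ∀ i, x z i ≠ 0) : AnalyticAt ℝ (fun w => logTrace n (x w) (y w)) z := by
  have e := analyticAt_coord hx
  have e' := analyticAt_coord hy
  have e0 := e 0; have e1 := e 1; have e2 := e 2; have e3 := e 3; have e4 := e 4
  have f0 := e' 0; have f1 := e' 1; have f2 := e' 2; have f3 := e' 3; have f4 := e' 4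
  have h0 := h 0; have h1 := h 1; have h2 := h 2; have h3 := h 3; have h4 := h 4
  unfold logTrace
  fun_prop (disch := assumption)

theorem analyticAt_AInitial (n : ℝ) (hx : AnalyticAt ℝ x z) (h : ∀ i, x z i ≠ 0) :
    AnalyticAt ℝ (fun w => AInitial n (x w)) z := by
  have e := analyticAt_coord hx
  have e0 := e 0; have e1 := e 1; have e2 := e 2; have e3 := e 3; have e4 := e 4
  have h0 := h 0; have h1 := h 1; have h2 := h 2; have h3 := h 3; have h4 := h 4
  unfold AInitial
  refine analyticAt_vec5 ?_ ?_ ?_ ?_ ?_ <;>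
    fun_prop (disch := first | assumption | simp [*])

theorem analyticAt_AFinal (n : ℝ) (hx : AnalyticAt ℝ x z) (h : ∀ i, x z i ≠ 0) :
    AnalyticAt ℝ (fun w => AFinal n (x w)) z := by
  have e := analyticAt_coord hx
  have e0 := e 0; have e1 := e 1; have e2 := e 2; have e3 := e 3; have e4 := e 4
  have h0 := h 0; have h1 := h 1; have h2 := h 2; have h3 := h 3; have h4 := h 4
  unfold AFinal
  refine analyticAt_vec5 ?_ ?_ ?_ ?_ ?_ <;>
    fun_prop (disch := first | assumption | simp [*])

theorem analyticAt_BInitial (n : ℝ) (hx : AnalyticAt ℝ x z) (hy : AnalyticAt ℝ y z)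
    (h : ∀ i, x z i ≠ 0) : AnalyticAt ℝ (fun w => BInitial n (x w) (y w)) z := by
  have e := analyticAt_coord hx
  have e' := analyticAt_coord hy
  have e0 := e 0; have e1 := e 1; have e2 := e 2; have e3 := e 3; have e4 := e 4
  have f0 := e' 0; have f1 := e' 1; have f2 := e' 2; have f3 := e' 3; have f4 := e' 4
  have hT := analyticAt_logTrace n hx hy h
  unfold BInitial
  refine analyticAt_vec5 ?_ ?_ ?_ ?_ ?_ <;> fun_prop

theorem analyticAt_BFinal (n : ℝ) (hx : AnalyticAt ℝ x z) (hy : AnalyticAt ℝ y z)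
    (h : ∀ i, x z i ≠ 0) : AnalyticAt ℝ (fun w => BFinal n (x w) (y w)) z := by
  have e := analyticAt_coord hx
  have e' := analyticAt_coord hy
  have e0 := e 0; have e1 := e 1; have e2 := e 2; have e3 := e 3; have e4 := e 4
  have f0 := e' 0; have f1 := e' 1; have f2 := e' 2; have f3 := e' 3; have f4 := e' 4
  have hT := analyticAt_logTrace n hx hy h
  unfold BFinal
  refine analyticAt_vec5 ?_ ?_ ?_ ?_ ?_ <;> fun_prop

theorem analyticAt_PInitial (n : ℝ) (ht : AnalyticAt ℝ t z) (hx : AnalyticAt ℝ x z)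
    (h : ∀ i, x z i ≠ 0) : AnalyticAt ℝ (fun w => PInitial n (t w) (x w)) z := by
  have e := analyticAt_coord hx
  have e0 := e 0; have e1 := e 1; have e2 := e 2; have e3 := e 3; have e4 := e 4
  have h0 := h 0; have h1 := h 1; have h2 := h 2; have h3 := h 3; have h4 := h 4
  unfold PInitial
  refine analyticAt_vec5 ?_ ?_ ?_ ?_ ?_ <;>
    fun_prop (disch := first | assumption | simp [*])

theorem analyticAt_PFinal (n : ℝ) (ht : AnalyticAt ℝ t z) (hx : AnalyticAt ℝ x z)
    (h : ∀ i, x z i ≠ 0) : AnalyticAt ℝ (fun w => PFinal n (t w) (x w)) z := by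
  have e := analyticAt_coord hx
  have e0 := e 0; have e1 := e 1; have e2 := e 2; have e3 := e 3; have e4 := e 4
  have h0 := h 0; have h1 := h 1; have h2 := h 2; have h3 := h 3; have h4 := h 4
  unfold PFinal
  refine analyticAt_vec5 ?_ ?_ ?_ ?_ ?_ <;>
    fun_prop (disch := first | assumption | simp [*])

theorem analyticAt_regularPart (n lam : ℝ) {P : ℝ → (Fin 5 → ℝ) → Fin 5 → ℝ}
    (hx : AnalyticAt ℝ x z) (hy : AnalyticAt ℝ y z)
    (h : ∀ i, x z i ≠ 0) (hP : AnalyticAt ℝ (fun w => P (t w) (x w)) z) :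
    AnalyticAt ℝ (fun w => regularPart n lam P (t w) (x w) (y w)) z := by
  have hT := analyticAt_logTrace n hx hy h
  have key : ∀ k, AnalyticAt ℝ (fun w => regularPart n lam P (t w) (x w) (y w) k) z := by
    intro k
    have e1 := analyticAt_coord hx k
    have e2 := analyticAt_coord hy k
    have e3 := analyticAt_coord hP k
    have e4 := h k
    have e5 : AnalyticAt ℝ (fun w => 2 * y w k ^ 2 / x w k - y w k * logTrace n (x w) (y w)
        - lam * x w k) z := by
      fun_prop (disch := assumption)
    exact e5.add e3
  exact analyticAt_pi_iff.2 key

end Analyticity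

/-! ### Tools for computing derivatives and solving linear equations -/

section Linearization

/-- Existence of a solution of `L p = c` from the solvability condition `φ c = 0`, when the kernel
of `L` is a line and the functional `φ` annihilates the range of `L`. -/
theorem exists_apply_eq_of_finrank_ker_eq_one {L : (Fin 5 → ℝ) →L[ℝ] Fin 5 → ℝ}
    (hker : Module.finrank ℝ (LinearMap.ker L.toLinearMap) = 1) {φ : (Fin 5 → ℝ) →ₗ[ℝ] ℝ}
    (hφ : φ ≠ 0) (hφL : ∀ w, φ (L w) = 0) {c : Fin 5 → ℝ} (hc : φ c = 0) : ∃ p, L p = c := by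
  have h1 := LinearMap.finrank_range_add_finrank_ker L.toLinearMap
  have h2 := LinearMap.finrank_range_add_finrank_ker φ
  have h3 : LinearMap.range φ = ⊤ := LinearMap.range_eq_top.2 (LinearMap.surjective hφ)
  rw [h3, finrank_top, Module.finrank_self] at h2
  -- The range of L lies in the kernel of φ, and both have codimension one.
  have h4 : LinearMap.range L.toLinearMap = LinearMap.ker φ := by
    refine Submodule.eq_of_le_of_finrank_eq ?_ (by omega)
    rintro _ ⟨w, rfl⟩
    exact hφL w
  have h5 : c ∈ LinearMap.range L.toLinearMap := by rw [h4]; exact hc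
  exact h5

theorem fderiv_apply_of_isLinearMap {f : (Fin 5 → ℝ) → Fin 5 → ℝ} (hf : IsLinearMap ℝ f)
    (x y : Fin 5 → ℝ) : fderiv ℝ f x y = f y := by
  have h : HasFDerivAt f (LinearMap.toContinuousLinearMap hf.mk') x :=
    (LinearMap.toContinuousLinearMap hf.mk').hasFDerivAt
  rw [h.fderiv]
  rfl

theorem isLinearMap_BInitial (n : ℝ) (x : Fin 5 → ℝ) : IsLinearMap ℝ (BInitial n x) := by
  constructor
  · intro y z
    ext k
    fin_cases k <;> simp [BInitial, logTrace] <;> ring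
  · intro c y
    ext k
    fin_cases k <;> simp [BInitial, logTrace] <;> ring

theorem isLinearMap_BFinal (n : ℝ) (x : Fin 5 → ℝ) : IsLinearMap ℝ (BFinal n x) := by
  constructor
  · intro y z
    ext k
    fin_cases k <;> simp [BFinal, logTrace] <;> ring
  · intro c y
    ext k
    fin_cases k <;> simp [BFinal, logTrace] <;> ring

/-- Directional derivatives of a map into `Fin 5 → ℝ` from those of its components. -/
theorem fderiv_apply_eq {f : (Fin 5 → ℝ) → Fin 5 → ℝ} {x v w : Fin 5 → ℝ}
    (hf : DifferentiableAt ℝ f x)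
    (h : ∀ k, HasDerivAt (fun s : ℝ => f (fun i => x i + s * v i) k) (w k) 0) :
    fderiv ℝ f x v = w := by
  have e : (fun i => x i + (0 : ℝ) * v i) = x := by ext i; simp
  have h1 : HasDerivAt (fun (s : ℝ) (i : Fin 5) => x i + s * v i) v 0 := by
    refine hasDerivAt_pi.2 fun i => ?_
    simpa using ((hasDerivAt_id (0 : ℝ)).mul_const (v i)).const_add (x i)
  have h2 : HasDerivAt (fun s : ℝ => f (fun i => x i + s * v i)) (fderiv ℝ f x v) 0 := by
    refine HasFDerivAt.comp_hasDerivAt (f := fun (s : ℝ) (i : Fin 5) => x i + s * v i) 0 ?_ h1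
    rw [e]
    exact hf.hasFDerivAt
  exact h2.unique (hasDerivAt_pi.2 h)

end Linearization

/-! ### Base points and the derivative of A there -/

section Linearization

/-- The coefficients `αᵢ` of the initial conditions. -/
def αInitial (n : ℕ) (ζ : ℝ) : Fin 5 → ℝ :=
  ![√(((n : ℝ) + 3) / (2 * ((n : ℝ) + 1))), ζ, ζ, 1 / (2 * √((n : ℝ) + 1)), ζ]

/-- The coefficients `αᵢ` of the final conditions, for the reversed time. -/
def αFinal (n : ℕ) (ζ ξ : ℝ) : Fin 5 → ℝ := ![ζ, 1 / √((n : ℝ) + 3), ζ, ξ, ξ]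

theorem αInitial_pos (n : ℕ) {ζ : ℝ} (hζ : 0 < ζ) (i : Fin 5) : 0 < αInitial n ζ i := by
  fin_cases i <;> simp [αInitial, hζ] <;> positivity

theorem αFinal_pos (n : ℕ) {ζ ξ : ℝ} (hζ : 0 < ζ) (hξ : 0 < ξ) (i : Fin 5) :
    0 < αFinal n ζ ξ i := by
  fin_cases i <;> simp [αFinal, hζ, hξ]; positivity

theorem αInitial_sq (n : ℕ) (ζ : ℝ) : (fun i => αInitial n ζ i ^ 2) = baseInitial n ζ := by
  have h1 : √(((n : ℝ) + 3) / (2 * ((n : ℝ) + 1))) ^ 2 = ((n : ℝ) + 3) / (2 * ((n : ℝ) + 1)) :=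
    Real.sq_sqrt (by positivity)
  have h2 : √((n : ℝ) + 1) ^ 2 = (n : ℝ) + 1 := Real.sq_sqrt (by positivity)
  have h3 : (1 / (2 * √((n : ℝ) + 1))) ^ 2 = 1 / (4 * ((n : ℝ) + 1)) := by
    rw [div_pow, mul_pow, h2]; norm_num
  ext i
  fin_cases i
  exacts [h1, rfl, rfl, h3, rfl]

theorem αFinal_sq (n : ℕ) (ζ ξ : ℝ) : (fun i => αFinal n ζ ξ i ^ 2) = baseFinal n ζ ξ := by
  have h2 : √((n : ℝ) + 3) ^ 2 = (n : ℝ) + 3 := Real.sq_sqrt (by positivity)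
  have h3 : (1 / √((n : ℝ) + 3)) ^ 2 = 1 / ((n : ℝ) + 3) := by
    rw [div_pow, h2, one_pow]
  ext i
  fin_cases i
  exacts [rfl, h3, rfl, rfl, rfl]

theorem baseInitial_pos (n : ℕ) {ζ : ℝ} (hζ : 0 < ζ) (i : Fin 5) : 0 < baseInitial n ζ i := by
  rw [← αInitial_sq]; exact pow_pos (αInitial_pos n hζ i) 2

theorem baseFinal_pos (n : ℕ) {ζ ξ : ℝ} (hζ : 0 < ζ) (hξ : 0 < ξ) (i : Fin 5) :
    0 < baseFinal n ζ ξ i := by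
  rw [← αFinal_sq]; exact pow_pos (αFinal_pos n hζ hξ i) 2

theorem AInitial_base (n : ℕ) {ζ : ℝ} (hζ : 0 < ζ) : AInitial n (baseInitial n ζ) = 0 := by
  have hn1 : (n : ℝ) + 1 ≠ 0 := by positivity
  have hn3 : (n : ℝ) + 3 ≠ 0 := by positivity
  have hz := hζ.ne'
  ext k
  fin_cases k <;> simp [AInitial, baseInitial] <;> field_simp <;> ring

theorem AFinal_base (n : ℕ) {ζ ξ : ℝ} (hζ : 0 < ζ) (hξ : 0 < ξ) :
    AFinal n (baseFinal n ζ ξ) = 0 := by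
  have hn3 : (n : ℝ) + 3 ≠ 0 := by positivity
  have hz := hζ.ne'
  have hx := hξ.ne'
  ext k
  fin_cases k <;> simp [AFinal, baseFinal] <;> field_simp <;> ring_nf <;> simp

/-- The matrix splits into the blocks {0, 3} and {1, 2, 4}. In rows 0 and 3 the non-collapsing
variables enter through sums r + 1/r of a ratio and its inverse, critical at r = 1. The other rows
vanish whenever x₁ = x₂ = x₄ and are homogeneous of degree one in these variables, so ζ drops out.
-/
theorem fderiv_AInitial (n : ℕ) {ζ : ℝ} (hζ : 0 < ζ) (v : Fin 5 → ℝ) :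
    fderiv ℝ (AInitial n) (baseInitial n ζ) v =
      ![2 * ((n : ℝ) - 1) * v 0 - 8 * ((n : ℝ) - 1) * ((n : ℝ) + 3) * v 3,
        2 * ((n : ℝ) + 1) / ((n : ℝ) + 3) ^ 2 * (v 1 - v 2)
          + 2 * ((n : ℝ) - 1) * ((n : ℝ) + 1) / ((n : ℝ) + 3) * (v 1 - v 4),
        2 * ((n : ℝ) + 1) / ((n : ℝ) + 3) ^ 2 * (v 2 - v 1)
          + 4 * ((n : ℝ) - 1) / ((n : ℝ) + 3) * (v 2 - v 4),
        -(1 / ((n : ℝ) + 3)) * v 0 - 2 * ((n : ℝ) - 2) * v 3,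
        2 * ((n : ℝ) + 1) / ((n : ℝ) + 3) * (v 4 - v 1)
          + 4 / ((n : ℝ) + 3) * (v 4 - v 2)] := by
  have hn1 : (n : ℝ) + 1 ≠ 0 := by positivity
  have hn3 : (n : ℝ) + 3 ≠ 0 := by positivity
  have hz := hζ.ne'
  have hne : ∀ i, baseInitial n ζ i ≠ 0 := fun i => (baseInitial_pos n hζ i).ne'
  refine fderiv_apply_eq (analyticAt_AInitial n analyticAt_id hne).differentiableAt fun k => ?_
  set X : Fin 5 → ℝ → ℝ := fun i s => baseInitial n ζ i + s * v i with hX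
  have hd : ∀ i, HasDerivAt (X i) (v i) 0 := fun i => by
    have h := ((hasDerivAt_id (0 : ℝ)).mul_const (v i)).const_add (baseInitial n ζ i)
    rw [one_mul] at h
    exact h
  have hX0 : ∀ i, X i 0 = baseInitial n ζ i := fun i => by simp [hX]
  have hXne : ∀ i, X i 0 ≠ 0 := fun i => by rw [hX0]; exact hne i
  have hXXne : ∀ i j, X i 0 * X j 0 ≠ 0 := fun i j => mul_ne_zero (hXne i) (hXne j)
  have hq : ∀ i j, HasDerivAt (fun s => X i s / X j s) _ 0 := fun i j =>
    (hd i).fun_div (hd j) (hXne j)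
  have hq2 : ∀ i j l, HasDerivAt (fun s => X i s ^ 2 / (X j s * X l s)) _ 0 := fun i j l =>
    ((hd i).fun_pow 2).fun_div ((hd j).fun_mul (hd l)) (hXXne j l)
  fin_cases k
  · refine HasDerivAt.congr_deriv (((((hd 0).const_mul (-(2 * ((n : ℝ) - 1)))).add_const
      (2 / ((n : ℝ) + 3))).fun_sub (((hq 1 2).fun_add (hq 2 1)).const_mul
      (1 / ((n : ℝ) + 3)))).fun_add ((((hd 0).fun_pow 2).fun_div ((hd 3).fun_pow 2)
      (pow_ne_zero 2 (hXne 3))).const_mul (((n : ℝ) - 1) / (4 * ((n : ℝ) + 1) * ((n : ℝ) + 3))))) ?_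
    simp [hX0, baseInitial]
    field_simp
    ring
  · refine HasDerivAt.congr_deriv ((((hq2 1 0 2).fun_sub (hq 2 0)).const_mul
      (1 / (2 * ((n : ℝ) + 3)))).fun_add (((hq2 1 3 4).fun_sub (hq 4 3)).const_mul
      (((n : ℝ) - 1) / (4 * ((n : ℝ) + 3))))) ?_
    simp [hX0, baseInitial]
    field_simp
    ring
  · refine HasDerivAt.congr_deriv ((((hq2 2 0 1).fun_sub (hq 1 0)).const_mul
      (1 / (2 * ((n : ℝ) + 3)))).fun_add (((hq2 2 3 4).fun_sub (hq 4 3)).const_mul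
      (((n : ℝ) - 1) / (2 * ((n : ℝ) + 1) * ((n : ℝ) + 3))))) ?_
    simp [hX0, baseInitial]
    field_simp
    ring
  · refine HasDerivAt.congr_deriv (((((hd 3).const_mul (-(2 * ((n : ℝ) - 1)))).add_const
      (1 / 2)).fun_sub (((hq 1 4).fun_add (hq 4 1)).const_mul
      (1 / (4 * ((n : ℝ) + 3))))).fun_sub (((((hq 0 3).const_mul (1 / 2)).fun_add
      (hq 2 4)).fun_add (hq 4 2)).const_mul (1 / (2 * ((n : ℝ) + 1) * ((n : ℝ) + 3))))) ?_
    simp [hX0, baseInitial]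
    field_simp
    ring
  · refine HasDerivAt.congr_deriv ((((hq2 4 1 3).fun_sub (hq 1 3)).const_mul
      (1 / (4 * ((n : ℝ) + 3)))).fun_add (((hq2 4 2 3).fun_sub (hq 2 3)).const_mul
      (1 / (2 * ((n : ℝ) + 1) * ((n : ℝ) + 3))))) ?_
    simp [hX0, baseInitial]
    field_simp
    ring

/-- For the same reasons the blocks are {0, 2}, {1} and {3, 4}, and the entries depend on neither ζ
nor ξ. -/
theorem fderiv_AFinal (n : ℕ) {ζ ξ : ℝ} (hζ : 0 < ζ) (hξ : 0 < ξ) (v : Fin 5 → ℝ) :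
    fderiv ℝ (AFinal n) (baseFinal n ζ ξ) v =
      ![2 * (v 0 - v 2), -v 1, v 2 - v 0, 1 / 2 * (v 3 - v 4), 1 / 2 * (v 4 - v 3)] := by
  have hn3 : (n : ℝ) + 3 ≠ 0 := by positivity
  have hz := hζ.ne'
  have hx := hξ.ne'
  have hne : ∀ i, baseFinal n ζ ξ i ≠ 0 := fun i => (baseFinal_pos n hζ hξ i).ne'
  refine fderiv_apply_eq (analyticAt_AFinal n analyticAt_id hne).differentiableAt fun k => ?_
  set X : Fin 5 → ℝ → ℝ := fun i s => baseFinal n ζ ξ i + s * v i with hX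
  have hd : ∀ i, HasDerivAt (X i) (v i) 0 := fun i => by
    have h := ((hasDerivAt_id (0 : ℝ)).mul_const (v i)).const_add (baseFinal n ζ ξ i)
    rw [one_mul] at h
    exact h
  have hX0 : ∀ i, X i 0 = baseFinal n ζ ξ i := fun i => by simp [hX]
  have hXne : ∀ i, X i 0 ≠ 0 := fun i => by rw [hX0]; exact hne i
  have hXXne : ∀ i j, X i 0 * X j 0 ≠ 0 := fun i j => mul_ne_zero (hXne i) (hXne j)
  have hq : ∀ i j, HasDerivAt (fun s => X i s / X j s) _ 0 := fun i j =>
    (hd i).fun_div (hd j) (hXne j)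
  have hq2 : ∀ i j l, HasDerivAt (fun s => X i s ^ 2 / (X j s * X l s)) _ 0 := fun i j l =>
    ((hd i).fun_pow 2).fun_div ((hd j).fun_mul (hd l)) (hXXne j l)
  fin_cases k
  · refine HasDerivAt.congr_deriv (((hq2 0 1 2).fun_sub (hq 2 1)).const_mul
      (1 / ((n : ℝ) + 3))) ?_
    simp [hX0, baseFinal]
    field_simp
    ring
  · refine HasDerivAt.congr_deriv ((((hd 1).fun_neg.add_const (1 / 2)).fun_sub
      (((hq 0 2).fun_add (hq 2 0)).const_mul (1 / (2 * ((n : ℝ) + 3))))).fun_sub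
      (((hq 3 4).fun_add (hq 4 3)).const_mul (((n : ℝ) - 1) / (4 * ((n : ℝ) + 3))))) ?_
    simp [hX0, baseFinal]
    field_simp
    ring
  · refine HasDerivAt.congr_deriv (((hq2 2 0 1).fun_sub (hq 0 1)).const_mul
      (1 / (2 * ((n : ℝ) + 3)))) ?_
    simp [hX0, baseFinal]
    field_simp
    ring
  · refine HasDerivAt.congr_deriv (((hq2 3 1 4).fun_sub (hq 4 1)).const_mul
      (1 / (4 * ((n : ℝ) + 3)))) ?_
    simp [hX0, baseFinal]
    field_simp
    ring
  · refine HasDerivAt.congr_deriv (((hq2 4 1 3).fun_sub (hq 3 1)).const_mul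
      (1 / (4 * ((n : ℝ) + 3)))) ?_
    simp [hX0, baseFinal]
    field_simp
    ring

end Linearization

/-! ### Kernels of the recursion operators and the solvability condition -/

section Kernels

/-- The block of `𝓛ₘ` at `t = 0` on the components that do not collapse is injective. -/
theorem initial_block_injective {N : ℝ} (hN : 2 ≤ N) (k : ℕ) {v₁ v₂ v₄ : ℝ}
    (h1 : ((k : ℝ) + 2 * N) * v₁ = 2 / ((k : ℝ) + 2) * (2 * (N + 1) / (N + 3) ^ 2 * (v₁ - v₂)
      + 2 * (N - 1) * (N + 1) / (N + 3) * (v₁ - v₄)))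
    (h2 : ((k : ℝ) + 2 * N) * v₂ = 2 / ((k : ℝ) + 2) * (2 * (N + 1) / (N + 3) ^ 2 * (v₂ - v₁)
      + 4 * (N - 1) / (N + 3) * (v₂ - v₄)))
    (h4 : ((k : ℝ) + 2 * N) * v₄ = 2 / ((k : ℝ) + 2) * (2 * (N + 1) / (N + 3) * (v₄ - v₁)
      + 4 / (N + 3) * (v₄ - v₂))) : v₁ = 0 ∧ v₂ = 0 ∧ v₄ = 0 := by
  have hw : N + 3 ≠ 0 := by positivity
  have hk2 : (k : ℝ) + 2 ≠ 0 := by positivity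
  have hk0 : (0 : ℝ) ≤ k := Nat.cast_nonneg k
  set p := 2 * (N + 1) / (N + 3) ^ 2 with hp
  set q := 2 * (N - 1) * (N + 1) / (N + 3) with hq
  set r := 4 * (N - 1) / (N + 3) with hr
  set s := 2 * (N + 1) / (N + 3) with hs
  set u := 4 / (N + 3) with hu
  set ν := ((k : ℝ) + 2) * ((k : ℝ) + 2 * N) / 2 with hν
  have hscale : ∀ {v X : ℝ}, ((k : ℝ) + 2 * N) * v = 2 / ((k : ℝ) + 2) * X → ν * v = X := by
    intro v X h
    have : ν * v = ((k : ℝ) + 2) / 2 * (((k : ℝ) + 2 * N) * v) := by rw [hν]; ring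
    rw [this, h]
    field_simp
  replace h1 := hscale h1
  replace h2 := hscale h2
  replace h4 := hscale h4
  -- The block of dA annihilates (1, 1, 1), so the differences to v₄ satisfy a closed 2 × 2 system.
  have e1 : (ν - (p + q + s)) * (v₁ - v₄) = (u - p) * (v₂ - v₄) := by linear_combination h1 - h4
  have e2 : (ν - (p + r + u)) * (v₂ - v₄) = (s - p) * (v₁ - v₄) := by linear_combination h2 - h4
  have hdet : (ν - (p + q + s)) * (ν - (p + r + u)) - (u - p) * (s - p)
      = ν ^ 2 - (2 * N + 2 * p) * ν + 4 * (N + 1) ^ 2 * (2 * N - 1) / (N + 3) ^ 2 := by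
    simp only [hp, hq, hr, hs, hu]
    field_simp
    ring
  -- For k ≥ 1 one has ν ≥ 2N + 1 ≥ 2N + 2p, so the determinant is at least its positive constant
  -- term. For k = 0 this fails, as ν = 2N, and the determinant is computed exactly.
  have hpos : 0 < ν ^ 2 - (2 * N + 2 * p) * ν + 4 * (N + 1) ^ 2 * (2 * N - 1) / (N + 3) ^ 2 := by
    rcases Nat.eq_zero_or_pos k with h0 | h0
    · have hν' : ν = 2 * N := by rw [hν, h0]; push_cast; ring
      have : ν ^ 2 - (2 * N + 2 * p) * ν + 4 * (N + 1) ^ 2 * (2 * N - 1) / (N + 3) ^ 2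
          = 4 * (N + 1) * (2 * N ^ 2 - N - 1) / (N + 3) ^ 2 := by
        rw [hν', hp]
        field_simp
        ring
      rw [this]
      have : 0 < 2 * N ^ 2 - N - 1 := by nlinarith
      positivity
    · have hk1 : (1 : ℝ) ≤ k := by exact_mod_cast h0
      have hp1 : 2 * p ≤ 1 := by
        rw [hp, ← mul_div_assoc, div_le_one (by positivity)]
        nlinarith
      have hν1 : 2 * N + 1 ≤ ν := by rw [hν]; nlinarith
      have h3 : 0 ≤ ν * (ν - (2 * N + 2 * p)) := mul_nonneg (by linarith) (by linarith)
      have h5 : 0 < 4 * (N + 1) ^ 2 * (2 * N - 1) / (N + 3) ^ 2 := by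
        have : 0 < 2 * N - 1 := by linarith
        positivity
      nlinarith
  rw [← hdet] at hpos
  have hd1 : v₁ - v₄ = 0 := by
    refine (mul_eq_zero.1 ?_).resolve_left hpos.ne'
    linear_combination (ν - (p + r + u)) * e1 + (u - p) * e2
  have hd2 : v₂ - v₄ = 0 := by
    refine (mul_eq_zero.1 ?_).resolve_left hpos.ne'
    linear_combination (ν - (p + q + s)) * e2 + (s - p) * e1
  have hν0 : ν ≠ 0 := by rw [hν]; positivity
  have hv4 : v₄ = 0 := by
    refine (mul_eq_zero.1 ?_).resolve_left hν0
    rw [h4]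
    linear_combination -s * hd1 - u * hd2
  exact ⟨by linarith, by linarith, hv4⟩

variable (n : ℕ)

/-- The equations for the kernel of `𝓛ₖ` at `t = 0`. -/
theorem initial_kernel (hn : 2 ≤ n) {ζ : ℝ} (hζ : 0 < ζ) (k : ℕ) {v : Fin 5 → ℝ}
    (h : ((k : ℝ) + 1) • v - (2 / ((k : ℝ) + 2)) • fderiv ℝ (AInitial n) (baseInitial n ζ) v
      - fderiv ℝ (fun y => BInitial n (baseInitial n ζ) y) 0 v = 0) :
    v 1 = 0 ∧ v 2 = 0 ∧ v 4 = 0 ∧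
      ((k : ℝ) + 2 * n - 4 * n / ((k : ℝ) + 2)) * (v 0 - 2 * ((n : ℝ) + 3) * v 3) = 0 ∧
      ((k : ℝ) + 2 * n + 1 - 4 * ((n : ℝ) - 1) / ((k : ℝ) + 2)) * v 0
        + 2 * ((n : ℝ) + 3) * (8 * ((n : ℝ) - 1) / ((k : ℝ) + 2) + 2 * ((n : ℝ) - 1)) * v 3 = 0 := by
  have hn' : (2 : ℝ) ≤ n := by exact_mod_cast hn
  have hn1 : (n : ℝ) + 1 ≠ 0 := by positivity
  have hn3 : (n : ℝ) + 3 ≠ 0 := by positivity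
  have hk2 : (k : ℝ) + 2 ≠ 0 := by positivity
  have hz := hζ.ne'
  rw [fderiv_AInitial n hζ, fderiv_apply_of_isLinearMap (isLinearMap_BInitial _ _)] at h
  have h0 := congrFun h 0
  have h1 := congrFun h 1
  have h2 := congrFun h 2
  have h3 := congrFun h 3
  have h4 := congrFun h 4
  simp only [Pi.sub_apply, Pi.smul_apply, Pi.zero_apply, smul_eq_mul] at h0 h1 h2 h3 h4
  simp [BInitial, logTrace, baseInitial] at h0 h1 h2 h3 h4
  obtain ⟨e1, e2, e4⟩ := initial_block_injective hn' k (v₁ := v 1) (v₂ := v 2) (v₄ := v 4)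
    (by linear_combination h1) (by linear_combination h2) (by linear_combination h4)
  refine ⟨e1, e2, e4, ?_, ?_⟩
  · rw [e1, e2, e4] at h0 h3
    simp only [zero_div, mul_zero, add_zero] at h0 h3
    -- At the base point x₀ = 2(n + 3)x₃, so this combination of rows 0 and 3 cancels the trace term
    -- T.
    have h5 := congrArg₂ (fun a b : ℝ => a - 2 * ((n : ℝ) + 3) * b) h0 h3
    simp only [mul_zero, sub_zero] at h5
    rw [← h5]
    field_simp
    ring
  · rw [e1, e2, e4] at h0
    simp only [zero_div, mul_zero, add_zero] at h0
    rw [← h0]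
    field_simp
    ring

/-- The equations for the kernel of `𝓛ₖ` at the end `1`. -/
theorem final_kernel {ζ ξ : ℝ} (hζ : 0 < ζ) (hξ : 0 < ξ) (k : ℕ) {v : Fin 5 → ℝ}
    (h : ((k : ℝ) + 1) • v - (2 / ((k : ℝ) + 2)) • fderiv ℝ (AFinal n) (baseFinal n ζ ξ) v
      - fderiv ℝ (fun y => BFinal n (baseFinal n ζ ξ) y) 0 v = 0) :
    ((k : ℝ) + 5) * k * (v 0 - v 2) = 0 ∧ ((k : ℝ) + 3) * ((k : ℝ) + 2) * v 2 = 2 * (v 2 - v 0) ∧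
      v 1 = 0 ∧ v 3 = 0 ∧ v 4 = 0 := by
  have hn3 : (n : ℝ) + 3 ≠ 0 := by positivity
  have hk2 : (k : ℝ) + 2 ≠ 0 := by positivity
  have hk3 : (k : ℝ) + 3 ≠ 0 := by positivity
  have hz := hζ.ne'
  have hx := hξ.ne'
  rw [fderiv_AFinal n hζ hξ, fderiv_apply_of_isLinearMap (isLinearMap_BFinal _ _)] at h
  have h0 := congrFun h 0
  have h1 := congrFun h 1
  have h2 := congrFun h 2
  have h3 := congrFun h 3
  have h4 := congrFun h 4
  simp only [Pi.sub_apply, Pi.smul_apply, Pi.zero_apply, smul_eq_mul] at h0 h1 h2 h3 h4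
  simp [BFinal, logTrace, baseFinal] at h0 h1 h2 h3 h4
  have e2 : ((k : ℝ) + 3) * ((k : ℝ) + 2) * v 2 = 2 * (v 2 - v 0) := by
    field_simp at h2
    linear_combination h2
  have e0 : ((k : ℝ) + 3) * ((k : ℝ) + 2) * v 0 = 4 * (v 0 - v 2) := by
    field_simp at h0
    linear_combination h0
  have e3 : ((k : ℝ) + 3) * ((k : ℝ) + 2) * v 3 = v 3 - v 4 := by
    field_simp at h3
    linear_combination h3
  have e4 : ((k : ℝ) + 3) * ((k : ℝ) + 2) * v 4 = v 4 - v 3 := by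
    field_simp at h4
    linear_combination h4
  have hk0 : (0 : ℝ) ≤ k := Nat.cast_nonneg k
  have h34 : v 3 - v 4 = 0 := by
    have : (((k : ℝ) + 3) * ((k : ℝ) + 2) - 2) * (v 3 - v 4) = 0 := by linear_combination e3 - e4
    refine (mul_eq_zero.1 this).resolve_left ?_
    nlinarith
  have hk32 : ((k : ℝ) + 3) * ((k : ℝ) + 2) ≠ 0 := mul_ne_zero hk3 hk2
  have hv3 : v 3 = 0 := (mul_eq_zero.1 (e3.trans h34)).resolve_left hk32
  have hv4 : v 4 = 0 := by linarith
  have h02 : v 0 + 2 * v 2 = 0 := by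
    refine (mul_eq_zero.1 ?_).resolve_left hk32
    linear_combination e0 + 2 * e2
  refine ⟨by linear_combination e0 - e2, e2, ?_, hv3, hv4⟩
  rw [hv3, hv4] at h1
  have hv0 : v 0 = -(2 * v 2) := by linarith
  rw [hv0] at h1
  -- Because v₀ + 2v₂ = 0 and v₃ = v₄ = 0, only the v₁ term of the trace survives in row 1.
  have : ((k : ℝ) + 5 + 2 / ((k : ℝ) + 2)) * v 1 = 0 := by
    rw [← h1]
    field_simp
    ring
  exact (mul_eq_zero.1 this).resolve_left (by positivity)

theorem singularSystem_initial (hn : 2 ≤ n) (lam : ℝ) {ζ : ℝ} (hζ : 0 < ζ) :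
    SingularSystem (AInitial n) (BInitial n) (regularPart n lam (PInitial n)) (baseInitial n ζ)
      (fderiv ℝ (AInitial n) (baseInitial n ζ))
      (fderiv ℝ (fun y => BInitial n (baseInitial n ζ) y) 0) where
  analyticA := analyticAt_AInitial n analyticAt_id fun i => (baseInitial_pos n hζ i).ne'
  fderivA := rfl
  zeroA := AInitial_base n hζ
  analyticB := fun y => analyticAt_BInitial n analyticAt_fst analyticAt_snd
    fun i => (baseInitial_pos n hζ i).ne'
  smulB := fun x y s => (isLinearMap_BInitial n x).map_smul s y
  baseB := fun y => (fderiv_apply_of_isLinearMap (isLinearMap_BInitial n _) _ y).symm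
  analyticC := analyticAt_regularPart n lam (analyticAt_fst.comp analyticAt_snd)
    (analyticAt_snd.comp analyticAt_snd) (fun i => (baseInitial_pos n hζ i).ne')
    (analyticAt_PInitial n analyticAt_fst (analyticAt_fst.comp analyticAt_snd)
      fun i => (baseInitial_pos n hζ i).ne')
  injective := by
    intro k hk v hv
    obtain ⟨h1, h2, h4, h5, h6⟩ := initial_kernel n hn hζ k hv
    have hn' : (2 : ℝ) ≤ n := by exact_mod_cast hn
    have hk' : (1 : ℝ) ≤ k := by exact_mod_cast hk
    have hk2 : 0 < (k : ℝ) + 2 := by positivity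
    -- The factor equals k(k + 2n + 2)/(k + 2). It vanishes only for k = 0, which is where the
    -- kernel of 𝓛₀ comes from.
    have e1 : 0 < (k : ℝ) + 2 * n - 4 * n / ((k : ℝ) + 2) := by
      rw [sub_pos, div_lt_iff₀ hk2]
      nlinarith
    have e2 := (mul_eq_zero.1 h5).resolve_left e1.ne'
    have e3 : v 0 = 2 * ((n : ℝ) + 3) * v 3 := by linarith
    have e4 : (2 * ((n : ℝ) + 3)
        * ((k : ℝ) + 4 * n - 1 + 4 * ((n : ℝ) - 1) / ((k : ℝ) + 2))) * v 3 = 0 := by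
      rw [← h6, e3]
      field_simp
      ring
    have e5 : 0 < 4 * ((n : ℝ) - 1) / ((k : ℝ) + 2) := div_pos (by linarith) hk2
    have e6 : v 3 = 0 := (mul_eq_zero.1 e4).resolve_left
      (mul_pos (by positivity) (by linarith)).ne'
    ext i
    fin_cases i
    exacts [by simp [e3, e6], h1, h2, e6, h4]

theorem singularSystem_final (lam : ℝ) {ζ ξ : ℝ} (hζ : 0 < ζ) (hξ : 0 < ξ) :
    SingularSystem (AFinal n) (BFinal n) (regularPart n lam (PFinal n)) (baseFinal n ζ ξ)
      (fderiv ℝ (AFinal n) (baseFinal n ζ ξ))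
      (fderiv ℝ (fun y => BFinal n (baseFinal n ζ ξ) y) 0) where
  analyticA := analyticAt_AFinal n analyticAt_id fun i => (baseFinal_pos n hζ hξ i).ne'
  fderivA := rfl
  zeroA := AFinal_base n hζ hξ
  analyticB := fun y => analyticAt_BFinal n analyticAt_fst analyticAt_snd
    fun i => (baseFinal_pos n hζ hξ i).ne'
  smulB := fun x y s => (isLinearMap_BFinal n x).map_smul s y
  baseB := fun y => (fderiv_apply_of_isLinearMap (isLinearMap_BFinal n _) _ y).symm
  analyticC := analyticAt_regularPart n lam (analyticAt_fst.comp analyticAt_snd)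
    (analyticAt_snd.comp analyticAt_snd) (fun i => (baseFinal_pos n hζ hξ i).ne')
    (analyticAt_PFinal n analyticAt_fst (analyticAt_fst.comp analyticAt_snd)
      fun i => (baseFinal_pos n hζ hξ i).ne')
  injective := by
    intro k hk v hv
    obtain ⟨h0, h2, h1, h3, h4⟩ := final_kernel n hζ hξ k hv
    have hk' : (1 : ℝ) ≤ k := by exact_mod_cast hk
    -- The factor k(k + 5) vanishes only for k = 0; this is the source of the kernel of 𝓛₀ at this
    -- end.
    have e0 := (mul_eq_zero.1 h0).resolve_left (by positivity)
    have e2 : ((k : ℝ) + 3) * ((k : ℝ) + 2) * v 2 = 0 := by linear_combination h2 - 2 * e0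
    have e3 := (mul_eq_zero.1 e2).resolve_left (by positivity)
    ext i
    fin_cases i
    exacts [by simp; linarith, h1, e3, h3, h4]

theorem recursionOp_zero_apply (A : (Fin 5 → ℝ) → Fin 5 → ℝ)
    (B : (Fin 5 → ℝ) → (Fin 5 → ℝ) → Fin 5 → ℝ) (x₀ w : Fin 5 → ℝ) :
    recursionOp A B x₀ 0 0 w = w - fderiv ℝ A x₀ w - fderiv ℝ (fun y => B x₀ y) 0 w := by
  simp [recursionOp]

theorem finrank_ker_L0Initial (hn : 2 ≤ n) {ζ : ℝ} (hζ : 0 < ζ) :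
    Module.finrank ℝ (LinearMap.ker (L0Initial n ζ).toLinearMap) = 1 := by
  have hn3 : (n : ℝ) + 3 ≠ 0 := by positivity
  have hz := hζ.ne'
  refine finrank_eq_one (⟨![-(4 * ((n : ℝ) - 1) * ((n : ℝ) + 3)), 0, 0, 1, 0], ?_⟩ :
    LinearMap.ker (L0Initial n ζ).toLinearMap) ?_ ?_
  · change recursionOp _ _ _ 0 0 _ = 0
    rw [recursionOp_zero_apply, fderiv_AInitial n hζ,
      fderiv_apply_of_isLinearMap (isLinearMap_BInitial _ _)]
    have hn1 : (n : ℝ) + 1 ≠ 0 := by positivity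
    ext i
    fin_cases i <;> simp [BInitial, logTrace, baseInitial] <;> field_simp <;> ring
  · intro h
    have := congrFun (congrArg Subtype.val h) 3
    simp at this
  · rintro ⟨w, hw⟩
    have hw' : recursionOp (AInitial n) (BInitial n) (baseInitial n ζ) 0 0 w = 0 := hw
    rw [recursionOp_zero_apply] at hw'
    obtain ⟨h1, h2, h4, -, h5⟩ := initial_kernel n hn hζ 0 (v := w) (by simpa using hw')
    refine ⟨w 3, Subtype.ext ?_⟩
    -- For k = 0 the last kernel equation reads 3w₀ + 12(n - 1)(n + 3)w₃ = 0.
    have h0 : w 0 = -(4 * ((n : ℝ) - 1) * ((n : ℝ) + 3)) * w 3 := by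
      push_cast at h5
      linear_combination (1 / 3) * h5
    ext i
    fin_cases i <;> simp [h0, h1, h2, h4] <;> ring

theorem finrank_ker_L0Final {ζ ξ : ℝ} (hζ : 0 < ζ) (hξ : 0 < ξ) :
    Module.finrank ℝ (LinearMap.ker (L0Final n ζ ξ).toLinearMap) = 1 := by
  have hn3 : (n : ℝ) + 3 ≠ 0 := by positivity
  have hz := hζ.ne'
  refine finrank_eq_one (⟨![-2, 0, 1, 0, 0], ?_⟩ :
    LinearMap.ker (L0Final n ζ ξ).toLinearMap) ?_ ?_
  · change recursionOp _ _ _ 0 0 _ = 0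
    rw [recursionOp_zero_apply, fderiv_AFinal n hζ hξ,
      fderiv_apply_of_isLinearMap (isLinearMap_BFinal _ _)]
    ext i
    fin_cases i <;> simp [BFinal, logTrace, baseFinal] <;> ring_nf <;> simp
  · intro h
    have := congrFun (congrArg Subtype.val h) 2
    simp at this
  · rintro ⟨w, hw⟩
    have hw' : recursionOp (AFinal n) (BFinal n) (baseFinal n ζ ξ) 0 0 w = 0 := hw
    rw [recursionOp_zero_apply] at hw'
    obtain ⟨-, h2, h1, h3, h4⟩ := final_kernel n hζ hξ 0 (v := w) (by simpa using hw')
    refine ⟨w 2, Subtype.ext ?_⟩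
    have h0 : w 0 = -2 * w 2 := by
      push_cast at h2
      linear_combination (1 / 2) * h2
    ext i
    fin_cases i <;> simp [h0, h1, h3, h4] <;> ring

/-- The functional w₀ - 2(n + 3)w₃ annihilates the range of 𝓛₀. On C(0, x₀, 0) only -λx contributes
to it, and the base point itself lies in its kernel. -/
theorem exists_L0Initial_eq (hn : 2 ≤ n) (lam : ℝ) {ζ : ℝ} (hζ : 0 < ζ) :
    ∃ p, L0Initial n ζ p
      = (2 : ℝ) • regularPart n lam (PInitial n) 0 (baseInitial n ζ) 0 := by
  have hn1 : (n : ℝ) + 1 ≠ 0 := by positivity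
  have hn3 : (n : ℝ) + 3 ≠ 0 := by positivity
  have hz := hζ.ne'
  refine exists_apply_eq_of_finrank_ker_eq_one (finrank_ker_L0Initial n hn hζ)
    (φ := (LinearMap.proj 0 : (Fin 5 → ℝ) →ₗ[ℝ] ℝ)
      - (2 * ((n : ℝ) + 3)) • (LinearMap.proj 3 : (Fin 5 → ℝ) →ₗ[ℝ] ℝ)) ?_ ?_ ?_
  · intro h
    have := LinearMap.congr_fun h ![1, 0, 0, 0, 0]
    simp at this
  · intro w
    change recursionOp _ _ _ 0 0 w 0 - 2 * ((n : ℝ) + 3) * recursionOp _ _ _ 0 0 w 3 = 0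
    rw [recursionOp_zero_apply, fderiv_AInitial n hζ,
      fderiv_apply_of_isLinearMap (isLinearMap_BInitial _ _)]
    simp only [Pi.sub_apply]
    simp [BInitial, logTrace, baseInitial]
    field_simp
    ring
  · simp [regularPart, PInitial, baseInitial, logTrace]
    field_simp
    ring

/-- Here the functional is w₀ - w₂: rows 0 and 2 of 𝓛₀ coincide, and the corresponding components of
C(0, x₀, 0) are equal because ζ₁ is the common value of f₁ and f₃. -/
theorem exists_L0Final_eq (lam : ℝ) {ζ ξ : ℝ} (hζ : 0 < ζ) (hξ : 0 < ξ) :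
    ∃ p, L0Final n ζ ξ p
      = (2 : ℝ) • regularPart n lam (PFinal n) 0 (baseFinal n ζ ξ) 0 := by
  have hn1 : (n : ℝ) + 1 ≠ 0 := by positivity
  have hn3 : (n : ℝ) + 3 ≠ 0 := by positivity
  have hz := hζ.ne'
  have hx := hξ.ne'
  refine exists_apply_eq_of_finrank_ker_eq_one (finrank_ker_L0Final n hζ hξ)
    (φ := (LinearMap.proj 0 : (Fin 5 → ℝ) →ₗ[ℝ] ℝ)
      - (LinearMap.proj 2 : (Fin 5 → ℝ) →ₗ[ℝ] ℝ)) ?_ ?_ ?_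
  · intro h
    have := LinearMap.congr_fun h ![1, 0, 0, 0, 0]
    simp at this
  · intro w
    change recursionOp _ _ _ 0 0 w 0 - recursionOp _ _ _ 0 0 w 2 = 0
    rw [recursionOp_zero_apply, fderiv_AFinal n hζ hξ,
      fderiv_apply_of_isLinearMap (isLinearMap_BFinal _ _)]
    simp only [Pi.sub_apply]
    simp [BFinal, logTrace, baseFinal]
    ring
  · simp [regularPart, PFinal, baseFinal, logTrace]
    field_simp
    ring

end Kernels

/-! ### Translation of the boundary conditions -/

section BoundaryConditions

theorem initialSolution_iff {n : ℕ} {lam ζ ε : ℝ} {f : Fin 5 → ℝ → ℝ} :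
    InitialSolution n lam ζ ε f ↔ IsEndSolution n lam σInitial (αInitial n ζ) ε f := by
  refine and_congr_right fun _ => ⟨?_, ?_⟩
  · rintro ⟨h0, h1, h2, h3⟩ i
    fin_cases i
    exacts [Or.inr ⟨rfl, h0 0, h1 0, h2⟩, Or.inl ⟨rfl, h0 1, h1 1⟩, Or.inl ⟨rfl, h0 2, h1 2⟩,
      Or.inr ⟨rfl, h0 3, h1 3, h3⟩, Or.inl ⟨rfl, h0 4, h1 4⟩]
  · intro h
    obtain ⟨a0, b0, c0⟩ := ((h 0).resolve_left fun h => one_ne_zero h.1).2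
    obtain ⟨a1, b1⟩ := ((h 1).resolve_right fun h => zero_ne_one h.1).2
    obtain ⟨a2, b2⟩ := ((h 2).resolve_right fun h => zero_ne_one h.1).2
    obtain ⟨a3, b3, c3⟩ := ((h 3).resolve_left fun h => one_ne_zero h.1).2
    obtain ⟨a4, b4⟩ := ((h 4).resolve_right fun h => zero_ne_one h.1).2
    refine ⟨fun i => ?_, fun i => ?_, c0, c3⟩ <;> fin_cases i
    exacts [a0, a1, a2, a3, a4, b0, b1, b2, b3, b4]

theorem derivWithin_reflect_Ico (ε : ℝ) (f : ℝ → ℝ) :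
    derivWithin (fun t => f (1 - t)) (Ico 0 ε) 0 = -derivWithin f (Ioc (1 - ε) 1) 1 ∧
      iteratedDerivWithin 2 (fun t => f (1 - t)) (Ico 0 ε) 0
        = iteratedDerivWithin 2 f (Ioc (1 - ε) 1) 1 := by
  open scoped Pointwise in
  have h : (1 : ℝ) +ᵥ -(Ico 0 ε) = Ioc (1 - ε) 1 := by
    rw [neg_Ico, neg_zero, ← image_vadd]
    simp only [vadd_eq_add, image_const_add_Ioc, add_zero, sub_eq_add_neg]
  rw [derivWithin_comp_const_sub, iteratedDerivWithin_comp_const_sub, h]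
  simp

theorem finalSolution_iff {n : ℕ} {lam ζ ξ ε : ℝ} {f : Fin 5 → ℝ → ℝ} :
    FinalSolution n lam ζ ξ ε f ↔
      IsEndSolution n lam σFinal (αFinal n ζ ξ) ε (fun i t => f i (1 - t)) := by
  refine and_congr isSolutionOn_reflect_iff ⟨?_, ?_⟩
  · rintro ⟨h0, h1, h2⟩
    have v : ∀ i, f i (1 - 0) = ![ζ, 0, ζ, ξ, ξ] i := fun i => by rw [sub_zero, h0]
    have d : ∀ i, derivWithin (fun t => f i (1 - t)) (Ico 0 ε) 0
        = ![0, 1 / √((n : ℝ) + 3), 0, 0, 0] i := fun i => by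
      rw [(derivWithin_reflect_Ico ε (f i)).1, h1]
      fin_cases i <;> simp
    intro i
    fin_cases i
    exacts [Or.inl ⟨rfl, v 0, d 0⟩,
      Or.inr ⟨rfl, v 1, d 1, (derivWithin_reflect_Ico ε (f 1)).2.trans h2⟩,
      Or.inl ⟨rfl, v 2, d 2⟩, Or.inl ⟨rfl, v 3, d 3⟩, Or.inl ⟨rfl, v 4, d 4⟩]
  · intro h
    obtain ⟨a0, b0⟩ := ((h 0).resolve_right fun h => zero_ne_one h.1).2
    obtain ⟨a1, b1, c1⟩ := ((h 1).resolve_left fun h => one_ne_zero h.1).2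
    obtain ⟨a2, b2⟩ := ((h 2).resolve_right fun h => zero_ne_one h.1).2
    obtain ⟨a3, b3⟩ := ((h 3).resolve_right fun h => zero_ne_one h.1).2
    obtain ⟨a4, b4⟩ := ((h 4).resolve_right fun h => zero_ne_one h.1).2
    simp only [sub_zero] at a0 a1 a2 a3 a4
    rw [(derivWithin_reflect_Ico ε _).2] at c1
    rw [(derivWithin_reflect_Ico ε _).1, neg_eq_iff_eq_neg] at b0 b1 b2 b3 b4
    rw [neg_zero] at b0 b2 b3 b4
    refine ⟨fun i => ?_, fun i => ?_, c1⟩ <;> fin_cases i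
    exacts [a0, a1, a2, a3, a4, b0, b1, b2, b3, b4]

theorem secondCoeffInitial_iff {n : ℕ} {ζ : ℝ} {f : Fin 5 → ℝ → ℝ} {w : Fin 5 → ℝ} :
    SecondCoeffInitial n ζ f w ↔ HasSecondCoeff σInitial (αInitial n ζ) f w := by
  have h : xInitial f = fun t i => f i t ^ 2 / t ^ (2 * σInitial i) := by
    ext t i
    fin_cases i <;> simp [xInitial, σInitial]
  rw [SecondCoeffInitial, HasSecondCoeff, h, αInitial_sq]

theorem secondCoeffFinal_iff {n : ℕ} {ζ ξ : ℝ} {f : Fin 5 → ℝ → ℝ} {w : Fin 5 → ℝ} :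
    SecondCoeffFinal n ζ ξ f w ↔
      HasSecondCoeff σFinal (αFinal n ζ ξ) (fun i t => f i (1 - t)) w := by
  have h : xFinal f = fun t i => f i (1 - t) ^ 2 / t ^ (2 * σFinal i) := by
    ext t i
    fin_cases i <;> simp [xFinal, σFinal]
  rw [SecondCoeffFinal, HasSecondCoeff, h, αFinal_sq]

theorem eqOn_Ioc_iff {ε : ℝ} {f g : ℝ → ℝ} :
    EqOn f g (Ioc (1 - ε) 1) ↔ EqOn (fun t => f (1 - t)) (fun t => g (1 - t)) (Ico 0 ε) := by
  constructor
  · intro h t ht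
    exact h ⟨by linarith [ht.2], by linarith [ht.1]⟩
  · intro h t ht
    have := h (x := 1 - t) ⟨by linarith [ht.2], by linarith [ht.1]⟩
    simpa using this

end BoundaryConditions

end ModelB

end

/-! ### Assembly at the two ends -/

theorem mainTheorem6 (n : ℕ) (hn : 2 ≤ n) (lam : ℝ) :
    (∀ ζ₀ : ℝ, 0 < ζ₀ →
      (∃ ε₀ : ℝ, 0 < ε₀ ∧
        ((fun (f : Fin 5 → ℝ → ℝ) (i : Fin 5) => (Set.Ico (0 : ℝ) ε₀).domRestrict (f i)) ''
          {f | ModelB.InitialSolution n lam ζ₀ ε₀ f}).Infinite) ∧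
      Module.finrank ℝ (LinearMap.ker (ModelB.L0Initial n ζ₀).toLinearMap) = 1 ∧
      ∃ p : Fin 5 → ℝ,
        (∀ v ∈ LinearMap.ker (ModelB.L0Initial n ζ₀).toLinearMap,
          ∃ ε : ℝ, 0 < ε ∧ ∃ f : Fin 5 → ℝ → ℝ,
            ModelB.InitialSolution n lam ζ₀ ε f ∧ ModelB.SecondCoeffInitial n ζ₀ f (p + v)) ∧
        (∀ ε : ℝ, 0 < ε → ∀ f : Fin 5 → ℝ → ℝ, ModelB.InitialSolution n lam ζ₀ ε f →
          ∃ v ∈ LinearMap.ker (ModelB.L0Initial n ζ₀).toLinearMap,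
            ModelB.SecondCoeffInitial n ζ₀ f (p + v)) ∧
        (∀ ε : ℝ, 0 < ε → ∀ f g : Fin 5 → ℝ → ℝ,
          ModelB.InitialSolution n lam ζ₀ ε f → ModelB.InitialSolution n lam ζ₀ ε g →
          ∀ w : Fin 5 → ℝ, ModelB.SecondCoeffInitial n ζ₀ f w →
            ModelB.SecondCoeffInitial n ζ₀ g w →
            ∀ i, Set.EqOn (f i) (g i) (Set.Ico 0 ε))) ∧
    (∀ ζ₁ ξ₁ : ℝ, 0 < ζ₁ → 0 < ξ₁ →
      (∃ ε₁ : ℝ, 0 < ε₁ ∧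
        ((fun (f : Fin 5 → ℝ → ℝ) (i : Fin 5) => (Set.Ioc (1 - ε₁) (1 : ℝ)).domRestrict (f i)) ''
          {f | ModelB.FinalSolution n lam ζ₁ ξ₁ ε₁ f}).Infinite) ∧
      Module.finrank ℝ (LinearMap.ker (ModelB.L0Final n ζ₁ ξ₁).toLinearMap) = 1 ∧
      ∃ p : Fin 5 → ℝ,
        (∀ v ∈ LinearMap.ker (ModelB.L0Final n ζ₁ ξ₁).toLinearMap,
          ∃ ε : ℝ, 0 < ε ∧ ∃ f : Fin 5 → ℝ → ℝ,
            ModelB.FinalSolution n lam ζ₁ ξ₁ ε f ∧ ModelB.SecondCoeffFinal n ζ₁ ξ₁ f (p + v)) ∧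
        (∀ ε : ℝ, 0 < ε → ∀ f : Fin 5 → ℝ → ℝ, ModelB.FinalSolution n lam ζ₁ ξ₁ ε f →
          ∃ v ∈ LinearMap.ker (ModelB.L0Final n ζ₁ ξ₁).toLinearMap,
            ModelB.SecondCoeffFinal n ζ₁ ξ₁ f (p + v)) ∧
        (∀ ε : ℝ, 0 < ε → ∀ f g : Fin 5 → ℝ → ℝ,
          ModelB.FinalSolution n lam ζ₁ ξ₁ ε f → ModelB.FinalSolution n lam ζ₁ ξ₁ ε g →
          ∀ w : Fin 5 → ℝ, ModelB.SecondCoeffFinal n ζ₁ ξ₁ f w →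
            ModelB.SecondCoeffFinal n ζ₁ ξ₁ g w →
            ∀ i, Set.EqOn (f i) (g i) (Set.Ioc (1 - ε) 1))) := by
  refine ⟨fun ζ hζ => ?_, fun ζ ξ hζ hξ => ?_⟩
  · have hS := ModelB.singularSystem_initial n hn lam hζ
    have hα := ModelB.αInitial_pos n hζ
    have hred := ModelB.reduces_initial n lam
    obtain ⟨p, hp⟩ := ModelB.exists_L0Initial_eq n hn lam hζ
    have hL := ModelB.recursionOp_zero_apply (ModelB.AInitial n) (ModelB.BInitial n)
      (ModelB.baseInitial n ζ)
    change ∀ w, ModelB.L0Initial n ζ w = _ at hL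
    have hker := ModelB.finrank_ker_L0Initial n hn hζ
    rw [← ModelB.αInitial_sq] at hS hL hp
    refine ModelB.parametrized_by_ker (I := fun ε => Ico 0 ε) hker hp
      (fun w hw => ?_) (fun ε hε f hf => ?_) (fun ε hε f g hf hg w hfw hgw => ?_)
      (fun ε' ε f hε' hle hf => ?_) (fun ε f g w hε h hf => ?_) (fun f w w' hw hw' => ?_)
    · simp only [ModelB.initialSolution_iff, ModelB.secondCoeffInitial_iff]
      exact ModelB.exists_isEndSolution hred ModelB.σInitial_le hα hS ((hL w).symm.trans hw)
    · rw [ModelB.initialSolution_iff] at hf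
      obtain ⟨w, hw, hfw⟩ := hf.exists_secondCoeff hred ModelB.σInitial_le hα hS hε
      exact ⟨w, (hL w).trans hw, ModelB.secondCoeffInitial_iff.2 hfw⟩
    · rw [ModelB.initialSolution_iff] at hf hg
      exact hf.eqOn hred ModelB.σInitial_le hα hS hε hg (ModelB.secondCoeffInitial_iff.1 hfw)
        (ModelB.secondCoeffInitial_iff.1 hgw)
    · rw [ModelB.initialSolution_iff] at hf ⊢
      exact hf.mono hε' hle
    · rw [ModelB.secondCoeffInitial_iff] at hf ⊢
      exact hf.congr hε h
    · exact (ModelB.secondCoeffInitial_iff.1 hw).unique (ModelB.secondCoeffInitial_iff.1 hw')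
  · have hS := ModelB.singularSystem_final n lam hζ hξ
    have hα := ModelB.αFinal_pos n hζ hξ
    have hred := ModelB.reduces_final n lam
    obtain ⟨p, hp⟩ := ModelB.exists_L0Final_eq n lam hζ hξ
    have hL := ModelB.recursionOp_zero_apply (ModelB.AFinal n) (ModelB.BFinal n)
      (ModelB.baseFinal n ζ ξ)
    change ∀ w, ModelB.L0Final n ζ ξ w = _ at hL
    have hker := ModelB.finrank_ker_L0Final n hζ hξ
    rw [← ModelB.αFinal_sq] at hS hL hp
    refine ModelB.parametrized_by_ker (I := fun ε => Ioc (1 - ε) 1) hker hp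
      (fun w hw => ?_) (fun ε hε f hf => ?_) (fun ε hε f g hf hg w hfw hgw i => ?_)
      (fun ε' ε f hε' hle hf => ?_) (fun ε f g w hε h hf => ?_) (fun f w w' hw hw' => ?_)
    -- The solution is constructed at 0 and reflected; reflecting twice gives it back.
    · obtain ⟨ε, hε, g, hg, hgw⟩ := ModelB.exists_isEndSolution hred ModelB.σFinal_le hα hS
        ((hL w).symm.trans hw)
      refine ⟨ε, hε, fun i t => g i (1 - t), ?_, ?_⟩
      · rw [ModelB.finalSolution_iff]
        simpa using hg
      · rw [ModelB.secondCoeffFinal_iff]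
        simpa using hgw
    · rw [ModelB.finalSolution_iff] at hf
      obtain ⟨w, hw, hfw⟩ := hf.exists_secondCoeff hred ModelB.σFinal_le hα hS hε
      exact ⟨w, (hL w).trans hw, ModelB.secondCoeffFinal_iff.2 hfw⟩
    · rw [ModelB.finalSolution_iff] at hf hg
      exact ModelB.eqOn_Ioc_iff.2 (hf.eqOn hred ModelB.σFinal_le hα hS hε hg
        (ModelB.secondCoeffFinal_iff.1 hfw) (ModelB.secondCoeffFinal_iff.1 hgw) i)
    · rw [ModelB.finalSolution_iff] at hf ⊢
      exact hf.mono hε' hle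
    · rw [ModelB.secondCoeffFinal_iff] at hf ⊢
      exact hf.congr hε fun i => ModelB.eqOn_Ioc_iff.1 (h i)
    · exact (ModelB.secondCoeffFinal_iff.1 hw).unique (ModelB.secondCoeffFinal_iff.1 hw')
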